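/- **Setting.** Let $\Omega\subset\mathbb R^d$ ($d\ge 1$) be a bounded Lipschitz domain and $Y=(0,1)^d$. Let $D:\mathbb R^d\to\mathbb R^{d\times d}$ have invertible values $D_x=D(x)$, with $D$ and $D^{-1}$ Lipschitz on $\mathbb R^d$ and $0<D_1\le|\det D_x|\le D_2<\infty$ for $x\in\overline\Omega$; put $Y_x=D_xY$. A function on $\mathbb R^d$ is $Y_x$-periodic if it is invariant under translation by $D_x\xi$ for all $\xi\in\mathbb Z^d$. $W^{1,p}_{\rm per}(Y)$ is the space of the functions in $W^{1,p}(Y)$ whose $Y$-periodic extension belongs to $W^{1,p}_{\rm loc}(\mathbb R^d)$, and $w\in L^p(\Omega;W^{1,p}_{\rm per}(Y_x))$ means that $w(x,\cdot)$ is $Y_x$-periodic for a.e. $x\in\Omega$ and that the function $(x,y)\mapsto w(x,D_xy)$ belongs to $L^p(\Omega;W^{1,p}_{\rm per}(Y))$. Fix $0<r<1$. For $\varepsilon>0$ let $\{\Omega_n^\varepsilon\}_{1\le n\le N_\varepsilon}$ be any finite family of pairwise disjoint open cubes of side $\varepsilon^r$ with $\Omega\subset\bigcup_n\overline{\Omega_n^\varepsilon}$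 and $\Omega_n^\varepsilon\cap\Omega\ne\emptyset$, and let $x_n^\varepsilon\in\Omega_n^\varepsilon\cap\Omega$ be arbitrary points. Let $\hat\Omega_n^\varepsilon$ be the interior of the union of the sets $\varepsilon D_{x_n^\varepsilon}(\overline Y+\xi)$ over those $\xi\in\mathbb Z^d$ for which $\varepsilon D_{x_n^\varepsilon}(Y+\xi)\subset\Omega_n^\varepsilon\cap\Omega$. For a (scalar or vector valued) function $\psi$ on $\Omega$ the locally periodic unfolding operator is $$\mathcal T^\varepsilon_{\mathcal L}(\psi)(x,y)=\sum_{n=1}^{N_\varepsilon}\psi\Big(\varepsilon D_{x_n^\varepsilon}\big[D_{x_n^\varepsilon}^{-1}x/\varepsilon\big]_Y+\varepsilon D_{x_n^\varepsilon}y\Big)\chi_{\hat\Omega_n^\varepsilon}(x),\qquad x\in\Omega,\ y\in Y,$$ where $[z]_Y\in\mathbb Z^d$ is the vector of the integer parts of the coordinates of $z$. **Theorem.** Let $1<p<\infty$, let $\varepsilon$ run through a sequence of positive numbers tending to $0$, and let $w^\varepsilon\in L^p(\Omega)$ have weak gradients $\nabla w^\varepsilon\in L^p(\Omega)^d$ such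 that $$\|w^\varepsilon\|_{L^p(\Omega)}+\varepsilon\|\nabla w^\varepsilon\|_{L^p(\Omega)}\le C$$ with $C$ independent of $\varepsilon$. Then there exist a subsequence (denoted again by $\{w^\varepsilon\}$) and a function $w\in L^p(\Omega;W^{1,p}_{\rm per}(Y_x))$ such that, along this subsequence, $$\mathcal T^\varepsilon_{\mathcal L}(w^\varepsilon)\rightharpoonup w(\cdot,D_x\cdot)\quad\text{weakly in }L^p(\Omega;W^{1,p}(Y)),$$ $$\varepsilon\,\mathcal T^\varepsilon_{\mathcal L}(\nabla w^\varepsilon)\rightharpoonup D_x^{-T}\nabla_y w(\cdot,D_x\cdot)\quad\text{weakly in }L^p(\Omega\times Y)^d,$$ where $\nabla_y w(\cdot,D_x\cdot)$ denotes the weak gradient with respect to $y\in Y$ of the function $(x,y)\mapsto w(x,D_xy)$. -/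

import Mathlib

open MeasureTheory Filter Topology Set
open scoped ENNReal NNReal Matrix

namespace LocPer

noncomputable section

/-- The Euclidean space `ℝᵈ`. -/
abbrev Eu (d : ℕ) : Type := EuclideanSpace ℝ (Fin d)

/-! ### Sobolev spaces -/

/-- `g` is the weak gradient of `u` in the open set `U`: both are locally integrable in `U` and
`∫_U u ∂ᵥφ = - ∫_U (g · v) φ` for all `φ ∈ C_c^∞(U)` and all directions `v`. -/
def HasWeakGrad {d : ℕ} (U : Set (Eu d)) (u : Eu d → ℝ) (g : Eu d → Eu d) : Prop :=
  LocallyIntegrableOn u U volume ∧ LocallyIntegrableOn g U volume ∧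
    ∀ φ : Eu d → ℝ, ContDiff ℝ (⊤ : ℕ∞) φ → HasCompactSupport φ → tsupport φ ⊆ U → ∀ v : Eu d,
      ∫ y in U, u y * fderiv ℝ φ y v = - ∫ y in U, inner ℝ (g y) v * φ y

lemma HasWeakGrad.zero {d : ℕ} (U : Set (Eu d)) :
    HasWeakGrad U (fun _ => 0) (fun _ => 0) := by
  refine ⟨locallyIntegrableOn_zero, locallyIntegrableOn_zero, ?_⟩
  intros
  simp

lemma HasWeakGrad.congr {d : ℕ} {U : Set (Eu d)} {u u' : Eu d → ℝ} {g g' : Eu d → Eu d}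
    (h : HasWeakGrad U u g) (hu : u' =ᵐ[volume.restrict U] u)
    (hg : g' =ᵐ[volume.restrict U] g) : HasWeakGrad U u' g' := by
  refine ⟨h.1.congr hu.symm, h.2.1.congr hg.symm, ?_⟩
  intro φ h1 h2 h3 v
  have e1 : ∫ y in U, u' y * fderiv ℝ φ y v = ∫ y in U, u y * fderiv ℝ φ y v :=
    integral_congr_ae (hu.mono fun y hy => by simp only [hy])
  have e2 : ∫ y in U, inner ℝ (g' y) v * φ y = ∫ y in U, inner ℝ (g y) v * φ y :=
    integral_congr_ae (hg.mono fun y hy => by simp only [hy])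
  rw [e1, e2, h.2.2 φ h1 h2 h3 v]

lemma integrableOn_mul_of_tsupport {d : ℕ} {U : Set (Eu d)} {f ψ : Eu d → ℝ}
    (hf : LocallyIntegrableOn f U volume) (hψ : Continuous ψ)
    (hc : HasCompactSupport ψ) (hs : tsupport ψ ⊆ U) :
    IntegrableOn (fun y => f y * ψ y) U volume := by
  have h1 : IntegrableOn f (tsupport ψ) volume := hf.integrableOn_compact_subset hs hc
  have h2 : IntegrableOn (fun y => f y * ψ y) (tsupport ψ) volume :=
    h1.mul_continuousOn hψ.continuousOn hc
  have h3 : Integrable (fun y => f y * ψ y) volume := by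
    refine (integrableOn_iff_integrable_of_support_subset ?_).1 h2
    intro y hy
    exact subset_tsupport _ (fun h0 => hy (by simp [h0]))
  exact h3.integrableOn

lemma HasWeakGrad.integrableOn_left {d : ℕ} {U : Set (Eu d)} {u : Eu d → ℝ} {g : Eu d → Eu d}
    (h : HasWeakGrad U u g) {φ : Eu d → ℝ} (h1 : ContDiff ℝ (⊤ : ℕ∞) φ) (h2 : HasCompactSupport φ)
    (h3 : tsupport φ ⊆ U) (v : Eu d) :
    IntegrableOn (fun y => u y * fderiv ℝ φ y v) U volume := by
  have hsub : tsupport (fun y => fderiv ℝ φ y v) ⊆ tsupport φ :=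
    tsupport_fderiv_apply_subset ℝ v
  refine integrableOn_mul_of_tsupport h.1 ?_ ?_ (hsub.trans h3)
  · exact (h1.continuous_fderiv (by simp)).clm_apply continuous_const
  · exact h2.fderiv_apply (𝕜 := ℝ) v

lemma HasWeakGrad.integrableOn_right {d : ℕ} {U : Set (Eu d)} {u : Eu d → ℝ} {g : Eu d → Eu d}
    (h : HasWeakGrad U u g) {φ : Eu d → ℝ} (h1 : ContDiff ℝ (⊤ : ℕ∞) φ) (h2 : HasCompactSupport φ)
    (h3 : tsupport φ ⊆ U) (v : Eu d) :
    IntegrableOn (fun y => inner ℝ (g y) v * φ y) U volume := by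
  refine integrableOn_mul_of_tsupport ?_ h1.continuous h2 h3
  intro x hx
  obtain ⟨s, hs, hi⟩ := h.2.1 x hx
  exact ⟨s, hs, hi.inner_const v⟩

lemma HasWeakGrad.add {d : ℕ} {U : Set (Eu d)} {u u' : Eu d → ℝ} {g g' : Eu d → Eu d}
    (h : HasWeakGrad U u g) (h' : HasWeakGrad U u' g') :
    HasWeakGrad U (fun y => u y + u' y) (fun y => g y + g' y) := by
  refine ⟨h.1.add h'.1, h.2.1.add h'.2.1, ?_⟩
  intro φ h1 h2 h3 v
  simp only [inner_add_left, add_mul]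
  rw [integral_add (h.integrableOn_left h1 h2 h3 v) (h'.integrableOn_left h1 h2 h3 v),
    integral_add (h.integrableOn_right h1 h2 h3 v) (h'.integrableOn_right h1 h2 h3 v),
    h.2.2 φ h1 h2 h3 v, h'.2.2 φ h1 h2 h3 v]
  ring

lemma HasWeakGrad.smul {d : ℕ} {U : Set (Eu d)} {u : Eu d → ℝ} {g : Eu d → Eu d}
    (h : HasWeakGrad U u g) (c : ℝ) :
    HasWeakGrad U (fun y => c * u y) (fun y => c • g y) := by
  refine ⟨h.1.smul c, h.2.1.smul c, ?_⟩
  intro φ h1 h2 h3 v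
  simp only [real_inner_smul_left, mul_assoc]
  rw [integral_const_mul, integral_const_mul, h.2.2 φ h1 h2 h3 v]
  ring

/-- The Sobolev space `W^{1,p}(U)`, as the space of the pairs `(u, ∇u)` in
`L^p(U) × L^p(U; ℝᵈ)` whose second entry is the weak gradient of the first one. Its norm is
`max (‖u‖_{L^p}) (‖∇u‖_{L^p})`, which is equivalent to the other usual choices. -/
def sobolev {d : ℕ} (U : Set (Eu d)) (p : ℝ≥0∞) [Fact (1 ≤ p)] :
    Submodule ℝ (Lp ℝ p (volume.restrict U) × Lp (Eu d) p (volume.restrict U)) where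
  carrier := {u | HasWeakGrad U u.1 u.2}
  zero_mem' := (HasWeakGrad.zero U).congr (Lp.coeFn_zero _ _ _) (Lp.coeFn_zero _ _ _)
  add_mem' := fun {a b} ha hb => (HasWeakGrad.add ha hb).congr
    (Lp.coeFn_add a.1 b.1) (Lp.coeFn_add a.2 b.2)
  smul_mem' := fun c a ha => (HasWeakGrad.smul ha c).congr
    (Lp.coeFn_smul c a.1) (Lp.coeFn_smul c a.2)

/-- The function underlying an element of `W^{1,p}(U)`. -/
def fn {d : ℕ} {U : Set (Eu d)} {p : ℝ≥0∞} [Fact (1 ≤ p)] (u : sobolev U p) :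
    Lp ℝ p (volume.restrict U) := u.1.1

/-- The weak gradient of an element of `W^{1,p}(U)`. -/
def grad {d : ℕ} {U : Set (Eu d)} {p : ℝ≥0∞} [Fact (1 ≤ p)] (u : sobolev U p) :
    Lp (Eu d) p (volume.restrict U) := u.1.2

/-- The unit cell `Y = (0,1)ᵈ`. -/
def unitCell (d : ℕ) : Set (Eu d) := {y | ∀ i, 0 < y i ∧ y i < 1}

/-- An integer vector as an element of `ℝᵈ`. -/
def latt {d : ℕ} (ξ : Fin d → ℤ) : Eu d := WithLp.toLp 2 fun i => (ξ i : ℝ)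

/-- The space `W^{1,p}_per(Y)`: the functions in `W^{1,p}(Y)` that are the restriction to `Y` of
a `Y`-periodic function on `ℝᵈ` which has a weak gradient on all of `ℝᵈ` (so that, being
periodic and in `W^{1,p}(Y)`, it is in `W^{1,p}_loc(ℝᵈ)`). -/
def sobolevPer (d : ℕ) (p : ℝ≥0∞) [Fact (1 ≤ p)] : Submodule ℝ (sobolev (unitCell d) p) where
  carrier := {u | ∃ (v : Eu d → ℝ) (h : Eu d → Eu d),
    (∀ y ξ, v (y + latt ξ) = v y) ∧ HasWeakGrad univ v h ∧
    v =ᵐ[volume.restrict (unitCell d)] fn u ∧ h =ᵐ[volume.restrict (unitCell d)] grad u}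
  zero_mem' := ⟨fun _ => 0, fun _ => 0, fun _ _ => rfl, HasWeakGrad.zero _,
    (Lp.coeFn_zero _ _ _).symm, (Lp.coeFn_zero _ _ _).symm⟩
  add_mem' := by
    rintro a b ⟨v, h, hv, hw, h1, h2⟩ ⟨v', h', hv', hw', h1', h2'⟩
    exact ⟨_, _, fun y ξ => by simp only [hv, hv'], hw.add hw',
      (h1.add h1').trans (Lp.coeFn_add (fn a) (fn b)).symm,
      (h2.add h2').trans (Lp.coeFn_add (grad a) (grad b)).symm⟩
  smul_mem' := by
    rintro c a ⟨v, h, hv, hw, h1, h2⟩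
    exact ⟨_, _, fun y ξ => by simp only [hv], hw.smul c,
      (h1.const_smul c).trans (Lp.coeFn_smul c (fn a)).symm,
      (h2.const_smul c).trans (Lp.coeFn_smul c (grad a)).symm⟩

/-! ### Bounded Lipschitz domains -/

/-- A bounded Lipschitz domain: a bounded, open, connected (hence non-empty) set which, near each
of its boundary points and after a rotation taking the unit vector `ν` to the last coordinate
direction, is the region above the graph of a Lipschitz function `γ` of the component
`z - ⟪ν, z⟫ ν` of `z` orthogonal to `ν`. -/
structure IsBoundedLipschitzDomain {d : ℕ} (Ω : Set (Eu d)) : Prop where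
  bounded : Bornology.IsBounded Ω
  isOpen : IsOpen Ω
  connected : IsConnected Ω
  lipschitz : ∀ x₀ ∈ frontier Ω, ∃ (ν : Eu d) (γ : Eu d → ℝ) (L : ℝ≥0) (ρ : ℝ),
    ‖ν‖ = 1 ∧ LipschitzWith L γ ∧ 0 < ρ ∧
      ∀ z ∈ Metric.ball x₀ ρ, z ∈ Ω ↔ γ (z - inner ℝ ν z • ν) < inner ℝ ν z

/-! ### Locally periodic microstructures -/

/-- The linear action of a matrix on `ℝᵈ`. -/
def act {d : ℕ} (A : Matrix (Fin d) (Fin d) ℝ) (y : Eu d) : Eu d := Matrix.toEuclideanLin A y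

/-- A matrix-valued function on `ℝᵈ` is (globally) Lipschitz, i.e. all its entries are. -/
def IsLipMatrix {d : ℕ} (A : Eu d → Matrix (Fin d) (Fin d) ℝ) : Prop :=
  ∃ L : ℝ≥0, ∀ i j, LipschitzWith L fun x => A x i j

/-- An open cube of side `s` in `ℝᵈ`, in any position. -/
def IsOpenCube {d : ℕ} (s : ℝ) (Q : Set (Eu d)) : Prop :=
  ∃ T : Eu d ≃ᵃⁱ[ℝ] Eu d, Q = T '' {y | ∀ i, 0 < y i ∧ y i < s}

/-- A partition covering of `Ω` by finitely many non-intersecting open cubes `Ωₙ` of side `s`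
that meet `Ω`, with a chosen point `xₙ ∈ Ωₙ ∩ Ω` in each of them. -/
structure CubeCovering {d : ℕ} (Ω : Set (Eu d)) (s : ℝ) where
  N : ℕ
  cube : Fin N → Set (Eu d)
  isCube : ∀ n, IsOpenCube s (cube n)
  disj : Pairwise fun m n => Disjoint (cube m) (cube n)
  cover : Ω ⊆ ⋃ n, closure (cube n)
  pt : Fin N → Eu d
  pt_mem : ∀ n, pt n ∈ cube n ∩ Ω

/-- The parallelepiped `ε A (S + ξ)`. -/
def cell {d : ℕ} (ε : ℝ) (A : Matrix (Fin d) (Fin d) ℝ) (S : Set (Eu d)) (ξ : Fin d → ℤ) :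
    Set (Eu d) := (fun y => ε • act A (y + latt ξ)) '' S

/-- The set `Ω̂ₙ`: the interior of the union of the closures of those cells `ε D_{xₙ}(Y + ξ)`,
`ξ ∈ ℤᵈ`, that are contained in `Ωₙ ∩ Ω`. -/
def hatCube {d : ℕ} {Ω : Set (Eu d)} {s : ℝ} (D : Eu d → Matrix (Fin d) (Fin d) ℝ) (ε : ℝ)
    (𝒞 : CubeCovering Ω s) (n : Fin 𝒞.N) : Set (Eu d) :=
  interior (⋃ ξ ∈ {ξ : Fin d → ℤ | cell ε (D (𝒞.pt n)) (unitCell d) ξ ⊆ 𝒞.cube n ∩ Ω},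
    cell ε (D (𝒞.pt n)) (closure (unitCell d)) ξ)

/-- The integer part `[z]_Y`, the vector `ξ ∈ ℤᵈ` with `z - ξ ∈ [0,1)ᵈ`. -/
def intPart {d : ℕ} (z : Eu d) : Eu d := latt fun i => ⌊z i⌋

/-- The locally periodic unfolding operator:
`T(ψ)(x,y) = ∑ₙ ψ(ε D_{xₙ} [D_{xₙ}⁻¹ x / ε]_Y + ε D_{xₙ} y) χ_{Ω̂ₙ}(x)`. -/
def unfolding {d : ℕ} {Ω : Set (Eu d)} {s : ℝ} {F : Type*} [AddCommMonoid F]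
    (D : Eu d → Matrix (Fin d) (Fin d) ℝ) (ε : ℝ) (𝒞 : CubeCovering Ω s) (ψ : Eu d → F)
    (x y : Eu d) : F :=
  ∑ n : Fin 𝒞.N, (hatCube D ε 𝒞 n).indicator
    (fun x => ψ (ε • act (D (𝒞.pt n)) (intPart (ε⁻¹ • act (D (𝒞.pt n))⁻¹ x))
      + ε • act (D (𝒞.pt n)) y)) x

/-! ### The function spaces and the mode of convergence -/

/-- The element `u` of the Bochner space `L^p(Ω; W^{1,p}(U))` is the function `f` of
`(x, y) ∈ Ω × U`. -/
def IsRep {d : ℕ} {Ω U : Set (Eu d)} {p : ℝ≥0∞} [Fact (1 ≤ p)]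
    (u : Lp (sobolev U p) p (volume.restrict Ω)) (f : Eu d → Eu d → ℝ) : Prop :=
  ∀ᵐ x ∂volume.restrict Ω, fn (u x) =ᵐ[volume.restrict U] f x

/-- `w ∈ L^p(Ω; W^{1,p}_per(Y_x))`, `Y_x = D_x Y`: for almost every `x ∈ Ω` the function `w x` on
`ℝᵈ` is `Y_x`-periodic, and `w(x, D_x ·)` is an element of `L^p(Ω; W^{1,p}_per(Y))`. -/
def MemLpSobolevPer {d : ℕ} (Ω : Set (Eu d)) (D : Eu d → Matrix (Fin d) (Fin d) ℝ) (p : ℝ≥0∞)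
    [Fact (1 ≤ p)] (w : Eu d → Eu d → ℝ) : Prop :=
  (∀ᵐ x ∂volume.restrict Ω, ∀ y ξ, w x (y + act (D x) (latt ξ)) = w x y) ∧
  ∃ W : Lp (sobolevPer d p) p (volume.restrict Ω), ∀ᵐ x ∂volume.restrict Ω,
    fn (W x : sobolev (unitCell d) p) =ᵐ[volume.restrict (unitCell d)] fun y => w x (act (D x) y)

/-- Weak convergence of a sequence in a normed space. -/
def WeakTendsto {X : Type*} [NormedAddCommGroup X] [NormedSpace ℝ X] (u : ℕ → X) (u₀ : X) :
    Prop :=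
  ∀ ℓ : StrongDual ℝ X, Tendsto (fun k => ℓ (u k)) atTop (𝓝 (ℓ u₀))

end

end LocPer

open LocPer

/-! Put Lₙ = ε D_{xₙ}. On a cell of the lattice Lₙℤᵈ the unfolded function is w composed with the
affine map `tile` of Y onto that cell. It therefore lies in W^{1,p}(Y), with gradient ε D_{xₙ}ᵀ
times the unfolded gradient of w. Unfolding does not increase the L^p norm (`lintegral_hat_le`), so
the hypothesis gives a bound in L^p(Ω; W^{1,p}(Y)). That space is weakly sequentially compact
(`weakSeqCompact_lp_sobolev`): by currying it is a closed subspace of a product of L^p spaces over Ω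
× Y, and these are handled by Riesz representation and sequential Banach–Alaoglu.

The heart of the matter is the periodicity of the weak limit. A function u on Y has a periodic
extension with a weak gradient if, for every test function φ on ℝᵈ and direction v, the sum over ζ
of the pairings of u with φ(· + ζ) on Y vanishes (`mem_sobolevPer_of_cellPairing`). For the unfolded
function this fails when all summands are taken at the same x. If the ζ-th one is taken at x + Lₙζ,
neighbouring cells fit together, and the sum is the weak formulation of ∇w in Ω; it vanishes as soon
as x is at a distance of order ε from the complement of Ωₙ ∩ Ω (`sum_cellPairing_unfSobolev`). After
integration against η ∈ C_c(Ω) the shifts can be moved onto η. They are of size O(ε), so η changes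
uniformly little outside the boundary layers of the cubes. These have relative volume O(ε^{1-r}),
which tends to 0 because r < 1 (`tendsto_volume_layer`). As p > 1, the error is small in L^q with q
< ∞ while the pairings stay bounded in L^p (`tendsto_sum_integral_of_cancellation`). In the limit
the periodicity sum vanishes for almost every x, simultaneously for all test functions by a Lindelöf
argument (`ae_mem_sobolevPer_of_forall`).

For the gradients, ε times the unfolded gradient equals D_{xₙ}^{-T} ∇_y of the unfolded function.
Replacing D_{xₙ}^{-T} by D_x^{-T} costs O(ε^r) in norm since D⁻¹ is Lipschitz
(`ae_norm_unf_sub_le`), and u ↦ D_x^{-T} ∇_y u is a bounded operator, hence weakly continuous. -/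

namespace LocPer

noncomputable section

/-! ### Riesz representation: the dual of L^q over a finite measure. -/

section Riesz

variable {α : Type*} {m : MeasurableSpace α} {μ : Measure α} [IsFiniteMeasure μ]

lemma Lp.clm_ext_indicator {q : ℝ≥0∞} [Fact (1 ≤ q)] (hq : q ≠ ∞) {E F : Type*}
    [NormedAddCommGroup E] [NormedSpace ℝ E] [NormedAddCommGroup F] [NormedSpace ℝ F]
    {S T : Lp E q μ →L[ℝ] F}
    (h : ∀ (A : Set α) (hA : MeasurableSet A) (c : E),
      S (indicatorConstLp q hA (measure_ne_top μ A) c) =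
        T (indicatorConstLp q hA (measure_ne_top μ A) c)) : S = T := by
  ext1 f
  refine Lp.induction hq (motive := fun f => S f = T f) ?_ ?_ ?_ f
  · intro c s hs hμs
    exact h s hs c
  · intro f g hf hg _ h1 h2
    rw [map_add, map_add, h1, h2]
  · exact isClosed_eq S.continuous T.continuous

lemma sum_indicatorConstLp {q : ℝ≥0∞} {ι : Type*} {f : ι → Set α} (hf : ∀ i, MeasurableSet (f i))
    (hd : Pairwise (Function.onFun Disjoint f)) (s : Finset ι) :
    ∑ i ∈ s, indicatorConstLp q (hf i) (measure_ne_top μ (f i)) (1 : ℝ) =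
      indicatorConstLp q (Finset.measurableSet_biUnion s fun i _ => hf i)
        (measure_ne_top μ (⋃ i ∈ s, f i)) (1 : ℝ) := by
  classical
  induction s using Finset.induction_on with
  | empty => simp [indicatorConstLp_empty]
  | insert i s hi ih =>
    rw [Finset.sum_insert hi, ih, ← indicatorConstLp_disjoint_union]
    · congr 1
      simp
    · refine Set.disjoint_iUnion₂_right.2 fun j hj => hd ?_
      rintro rfl
      exact hi hj

/-- Countable additivity is continuity of ℓ: for q < ∞ the indicators of the finite partial unions
of a disjoint sequence converge in L^q, because the omitted sets have small total measure. -/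
lemma exists_signedMeasure_of_dual {q : ℝ≥0∞} [Fact (1 ≤ q)] (hq : q ≠ ∞)
    (ℓ : StrongDual ℝ (Lp ℝ q μ)) :
    ∃ ν : SignedMeasure α, ∀ (A : Set α) (hA : MeasurableSet A),
      ν A = ℓ (indicatorConstLp q hA (measure_ne_top μ A) 1) := by
  classical
  refine ⟨⟨fun A => if hA : MeasurableSet A then
    ℓ (indicatorConstLp q hA (measure_ne_top μ A) 1) else 0, ?_, ?_, ?_⟩, ?_⟩
  · simp [indicatorConstLp_empty]
  · intro A hA
    simp [hA]
  · intro f hf hd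
    have hU : MeasurableSet (⋃ i, f i) := MeasurableSet.iUnion hf
    simp only [hf, hU, dif_pos]
    have key : Tendsto (fun s : Finset ℕ => indicatorConstLp q
        (Finset.measurableSet_biUnion s fun i _ => hf i)
        (measure_ne_top μ (⋃ i ∈ s, f i)) (1 : ℝ)) atTop
        (𝓝 (indicatorConstLp q hU (measure_ne_top μ _) 1)) := by
      refine tendsto_indicatorConstLp_set hq ?_
      have h1 : ∀ s : Finset ℕ, symmDiff (⋃ i ∈ s, f i) (⋃ i, f i)
          = ⋃ i : {i // i ∉ s}, f i := by
        intro s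
        ext x
        simp only [mem_symmDiff, mem_iUnion, exists_prop, not_exists, not_and, Subtype.exists]
        constructor
        · rintro (⟨⟨i, -, hi⟩, h⟩ | ⟨⟨i, hi⟩, h⟩)
          · exact absurd hi (h i)
          · exact ⟨i, fun his => h i his hi, hi⟩
        · rintro ⟨i, his, hi⟩
          refine Or.inr ⟨⟨i, hi⟩, fun j hj hxj => ?_⟩
          exact (Set.disjoint_left.1 (hd (by rintro rfl; exact his hj : j ≠ i)) hxj) hi
      have h2 : ∀ s : Finset ℕ, μ (symmDiff (⋃ i ∈ s, f i) (⋃ i, f i))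
          = ∑' i : {i // i ∉ s}, μ (f i) := by
        intro s
        rw [h1]
        exact measure_iUnion (f := fun i : {i // i ∉ s} => f i)
          (fun i j hij => hd (fun h => hij (Subtype.ext h))) fun i => hf i
      simp only [h2]
      refine ENNReal.tendsto_tsum_compl_atTop_zero (f := fun i => μ (f i)) ?_
      rw [← measure_iUnion hd hf]
      exact measure_ne_top _ _
    have := (ℓ.continuous.tendsto _).comp key
    refine this.congr fun s => ?_
    simp only [Function.comp]
    rw [← sum_indicatorConstLp hf hd, map_sum]
  · intro A hA
    change (if hA : MeasurableSet A then
      ℓ (indicatorConstLp q hA (measure_ne_top μ A) 1) else 0) = _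
    rw [dif_pos hA]

/-- The density of a functional on `L^q` with respect to the measure. -/
lemma exists_density_of_dual {q : ℝ≥0∞} [Fact (1 ≤ q)] (hq : q ≠ ∞)
    (ℓ : StrongDual ℝ (Lp ℝ q μ)) :
    ∃ g : α → ℝ, Measurable g ∧ Integrable g μ ∧ ∀ (A : Set α) (hA : MeasurableSet A),
      ℓ (indicatorConstLp q hA (measure_ne_top μ A) 1) = ∫ x in A, g x ∂μ := by
  obtain ⟨ν, hν⟩ := exists_signedMeasure_of_dual hq ℓ
  refine ⟨ν.rnDeriv μ, SignedMeasure.measurable_rnDeriv ν μ, SignedMeasure.integrable_rnDeriv ν μ, ?_⟩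
  -- A null set has the zero class as its indicator, so Radon–Nikodym applies.
  have hac : ν ≪ᵥ μ.toENNRealVectorMeasure := by
    refine VectorMeasure.AbsolutelyContinuous.mk fun A hA h0 => ?_
    rw [Measure.toENNRealVectorMeasure_apply_measurable hA] at h0
    rw [hν A hA]
    have : indicatorConstLp q hA (measure_ne_top μ A) (1 : ℝ) = 0 := by
      rw [← norm_eq_zero]
      have := norm_indicatorConstLp (p := q) (hs := hA) (hμs := measure_ne_top μ A) (c := (1:ℝ))
        (zero_lt_one.trans_le (Fact.out : 1 ≤ q)).ne' hq
      rw [this, Measure.real, h0]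
      have : 0 < q.toReal := ENNReal.toReal_pos (zero_lt_one.trans_le (Fact.out : 1 ≤ q)).ne' hq
      simp [this.ne']
    rw [this, map_zero]
  intro A hA
  rw [← hν A hA]
  conv_lhs => rw [← SignedMeasure.withDensityᵥ_rnDeriv_eq ν μ hac]
  rw [withDensityᵥ_apply (SignedMeasure.integrable_rnDeriv ν μ) hA]

/-- A truncated density of a functional on `L^q` has `L^p` norm at most the norm of the
functional. -/
lemma eLpNorm_indicator_density_le {p q : ℝ≥0∞} [Fact (1 ≤ p)] [Fact (1 ≤ q)]
    [ENNReal.HolderConjugate p q] (hp : p ≠ ∞) (hq : q ≠ ∞) (ℓ : StrongDual ℝ (Lp ℝ q μ))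
    {g : α → ℝ} (hg : Measurable g)
    (h : ∀ (A : Set α) (hA : MeasurableSet A),
      ℓ (indicatorConstLp q hA (measure_ne_top μ A) 1) = ∫ x in A, g x ∂μ) (n : ℕ) :
    eLpNorm ({x | |g x| ≤ n}.indicator g) p μ ≤ ENNReal.ofReal ‖ℓ‖ := by
  -- The truncation makes u bounded, so every integral below is finite before any L^p bound on g is
  -- known.
  set A : Set α := {x | |g x| ≤ n} with hAdef
  have hA : MeasurableSet A := measurableSet_le (by fun_prop) measurable_const
  set u : α → ℝ := A.indicator g with hu
  have hum : Measurable u := hg.indicator hA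
  have hub : ∀ x, |u x| ≤ n := by
    intro x
    by_cases hx : x ∈ A
    · rw [hu, indicator_of_mem hx]; exact hx
    · rw [hu, indicator_of_notMem hx]; simp
  have hmemu : ∀ s : ℝ≥0∞, MemLp u s μ := fun s =>
    MemLp.of_bound hum.aestronglyMeasurable n (Eventually.of_forall hub)
  set T : Lp ℝ ∞ μ := indicatorConstLp ∞ hA (measure_ne_top μ A) 1 with hT
  -- M is multiplication by the indicator of A, a contraction of L^q; ℓ ∘ M turns out to be the
  -- pairing with the bounded function u.
  set M : Lp ℝ q μ →L[ℝ] Lp ℝ q μ := (ContinuousLinearMap.mul ℝ ℝ).holderL μ ∞ q q T with hM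
  have hMae : ∀ f : Lp ℝ q μ, M f =ᵐ[μ] A.indicator f := by
    intro f
    have h1 := (ContinuousLinearMap.mul ℝ ℝ).coeFn_holder (r := q) T f
    filter_upwards [h1, indicatorConstLp_coeFn (p := ∞) (hs := hA) (hμs := measure_ne_top μ A)
      (c := (1 : ℝ))] with x hx1 hx2
    rw [hM, ContinuousLinearMap.holderL_apply_apply, hx1, hT, hx2]
    by_cases hx : x ∈ A <;> simp [hx]
  have claim : ℓ.comp M = (ContinuousLinearMap.mul ℝ ℝ).lpPairing μ p q ((hmemu p).toLp u) := by
    refine Lp.clm_ext_indicator hq fun B hB c => ?_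
    rw [ContinuousLinearMap.lpPairing_eq_integral, ContinuousLinearMap.comp_apply]
    have e1 : M (indicatorConstLp q hB (measure_ne_top μ B) c) =
        c • indicatorConstLp q (hA.inter hB) (measure_ne_top μ _) (1 : ℝ) := by
      ext1
      filter_upwards [hMae (indicatorConstLp q hB (measure_ne_top μ B) c),
        indicatorConstLp_coeFn (p := q) (hs := hB) (hμs := measure_ne_top μ B) (c := c),
        Lp.coeFn_smul c (indicatorConstLp q (hA.inter hB) (measure_ne_top μ _) (1 : ℝ)),
        indicatorConstLp_coeFn (p := q) (hs := hA.inter hB) (hμs := measure_ne_top μ _)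
          (c := (1 : ℝ))] with x h1 h2 h3 h4
      rw [h1, h3, Pi.smul_apply, h4, ← Set.indicator_indicator]
      by_cases hx : x ∈ A <;> by_cases hx' : x ∈ B <;> simp [hx, hx', h2]
    rw [e1, map_smul, h _ (hA.inter hB), inter_comm, ← setIntegral_indicator hA]
    have e2 : (fun x => (ContinuousLinearMap.mul ℝ ℝ) ((hmemu p).toLp u x)
        (indicatorConstLp q hB (measure_ne_top μ B) c x)) =ᵐ[μ] B.indicator fun x => c * u x := by
      filter_upwards [(hmemu p).coeFn_toLp, indicatorConstLp_coeFn (p := q) (hs := hB)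
        (hμs := measure_ne_top μ B) (c := c)] with x h1 h2
      rw [h1, h2]
      by_cases hx' : x ∈ B <;> simp [hx', mul_comm]
    rw [integral_congr_ae e2, integral_indicator hB, integral_const_mul, smul_eq_mul]
  have hconj := ENNReal.HolderConjugate.toReal_of_ne_top hp hq
  set P := p.toReal with hP
  set Q := q.toReal with hQ
  have hP1 : 1 < P := hconj.lt
  have hQ1 : 1 < Q := hconj.symm.lt
  -- The extremal function for Hölder's inequality: u f = |u|^P = |f|^Q. Inserted in ℓ ∘ M it gives
  -- N ≤ ‖ℓ‖ N^{1/Q} with N = ∫ |u|^P, and division by N^{1/Q} is the claim.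
  set f : α → ℝ := fun x => u x * |u x| ^ (P - 2) with hf
  have hfabs : ∀ x, |f x| = |u x| ^ (P - 1) := by
    intro x
    rcases eq_or_ne (u x) 0 with h0 | h0
    · simp [hf, h0, Real.zero_rpow (sub_ne_zero.2 hP1.ne')]
    · have : 0 < |u x| := abs_pos.2 h0
      rw [hf, abs_mul, abs_of_nonneg (Real.rpow_nonneg this.le _)]
      nth_rewrite 1 [← Real.rpow_one |u x|]
      rw [← Real.rpow_add this]
      ring_nf
  have hfm : Measurable f := by fun_prop
  have hfmem : MemLp f q μ := by
    refine MemLp.of_bound hfm.aestronglyMeasurable ((n : ℝ) ^ (P - 1))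
      (Eventually.of_forall fun x => ?_)
    rw [Real.norm_eq_abs, hfabs]
    exact Real.rpow_le_rpow (abs_nonneg _) (hub x) (by linarith)
  have huf : ∀ x, u x * f x = |u x| ^ P := by
    intro x
    rcases eq_or_ne (u x) 0 with h0 | h0
    · simp [hf, h0, Real.zero_rpow (zero_lt_one.trans hP1).ne']
    · have : 0 < |u x| := abs_pos.2 h0
      rw [hf]
      simp only
      rw [← mul_assoc, ← abs_mul_abs_self (u x)]
      nth_rewrite 1 [← Real.rpow_one |u x|]
      nth_rewrite 2 [← Real.rpow_one |u x|]
      rw [← Real.rpow_add this, ← Real.rpow_add this]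
      ring_nf
  have hfQ : ∀ x, |f x| ^ Q = |u x| ^ P := by
    intro x
    rw [hfabs, ← Real.rpow_mul (abs_nonneg _), hconj.sub_one_mul_conj]
  have hq0 : q ≠ 0 := (zero_lt_one.trans_le (Fact.out : 1 ≤ q)).ne'
  have hp0 : p ≠ 0 := (zero_lt_one.trans_le (Fact.out : 1 ≤ p)).ne'
  set N : ℝ := ∫ x, |u x| ^ P ∂μ with hN
  have hN0 : 0 ≤ N := integral_nonneg fun x => Real.rpow_nonneg (abs_nonneg _) _
  have hnormf : ‖hfmem.toLp f‖ = N ^ Q⁻¹ := by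
    rw [Lp.norm_toLp, hfmem.eLpNorm_eq_integral_rpow_norm hq0 hq, ENNReal.toReal_ofReal]
    · simp only [Real.norm_eq_abs, ← hQ, hfQ, hN]
    · positivity
  have hNeq : N = ℓ (M (hfmem.toLp f)) := by
    have := congrArg (fun S => S (hfmem.toLp f)) claim
    simp only [ContinuousLinearMap.comp_apply, ContinuousLinearMap.lpPairing_eq_integral] at this
    rw [this, hN]
    refine integral_congr_ae ?_
    filter_upwards [(hmemu p).coeFn_toLp, hfmem.coeFn_toLp] with x h1 h2
    rw [h1, h2, ← huf]
    simp
  have hMle : ‖M (hfmem.toLp f)‖ ≤ ‖hfmem.toLp f‖ := by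
    refine Lp.norm_le_norm_of_ae_le ?_
    filter_upwards [hMae (hfmem.toLp f)] with x hx
    rw [hx]
    exact norm_indicator_le_norm_self _ _
  have hle : N ≤ ‖ℓ‖ * N ^ Q⁻¹ := by
    rw [← hnormf]
    calc N = ℓ (M (hfmem.toLp f)) := hNeq
      _ ≤ ‖ℓ (M (hfmem.toLp f))‖ := Real.le_norm_self _
      _ ≤ ‖ℓ‖ * ‖M (hfmem.toLp f)‖ := ℓ.le_opNorm _
      _ ≤ _ := by gcongr
  rw [(hmemu p).eLpNorm_eq_integral_rpow_norm hp0 hp]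
  refine ENNReal.ofReal_le_ofReal ?_
  simp only [Real.norm_eq_abs, ← hP, ← hN]
  rcases hN0.eq_or_lt with h0 | h0
  · rw [← h0, Real.zero_rpow (inv_ne_zero (by linarith))]
    exact norm_nonneg _
  · have h1 : 0 < N ^ Q⁻¹ := Real.rpow_pos_of_pos h0 _
    have h2 : N ^ P⁻¹ * N ^ Q⁻¹ = N := by
      rw [← Real.rpow_add h0, hconj.inv_add_inv_eq_one, Real.rpow_one]
    refine le_of_mul_le_mul_right ?_ h1
    rw [h2]
    exact hle

/-- Every continuous functional on `L^q` is the pairing with a function in `L^p`. -/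
theorem exists_lp_of_dual {p q : ℝ≥0∞} [Fact (1 ≤ p)] [Fact (1 ≤ q)]
    [ENNReal.HolderConjugate p q] (hp : p ≠ ∞) (hq : q ≠ ∞) (ℓ : StrongDual ℝ (Lp ℝ q μ)) :
    ∃ g : Lp ℝ p μ, ∀ f : Lp ℝ q μ, ℓ f = ∫ x, g x * f x ∂μ := by
  obtain ⟨g, hg, hgi, h⟩ := exists_density_of_dual hq ℓ
  have hmem : MemLp g p μ := by
    refine ⟨hg.aestronglyMeasurable, ?_⟩
    -- Fatou's lemma carries the uniform bound for the truncations over to g.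
    refine lt_of_le_of_lt (Lp.eLpNorm_lim_le_liminf_eLpNorm
      (f := fun n : ℕ => {x | |g x| ≤ n}.indicator g) (fun n => ?_) g ?_) ?_
    · exact (hg.indicator (measurableSet_le (by fun_prop) measurable_const)).aestronglyMeasurable
    · refine Eventually.of_forall fun x => ?_
      refine tendsto_const_nhds.congr' ?_
      filter_upwards [eventually_ge_atTop ⌈|g x|⌉₊] with n hn
      rw [indicator_of_mem]
      exact (Nat.le_ceil |g x|).trans (Nat.cast_le.2 hn)
    · refine lt_of_le_of_lt ?_ (ENNReal.ofReal_lt_top (r := ‖ℓ‖))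
      refine liminf_le_of_le (by isBoundedDefault) fun b hb => ?_
      obtain ⟨n, hn⟩ := hb.exists
      exact hn.trans (eLpNorm_indicator_density_le hp hq ℓ hg h n)
  refine ⟨hmem.toLp g, fun f => ?_⟩
  have key : ℓ = (ContinuousLinearMap.mul ℝ ℝ).lpPairing μ p q (hmem.toLp g) := by
    refine Lp.clm_ext_indicator hq fun B hB c => ?_
    rw [ContinuousLinearMap.lpPairing_eq_integral]
    have e1 : indicatorConstLp q hB (measure_ne_top μ B) c =
        c • indicatorConstLp q hB (measure_ne_top μ _) (1 : ℝ) := by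
      ext1
      filter_upwards [indicatorConstLp_coeFn (p := q) (hs := hB)
        (hμs := measure_ne_top μ B) (c := c), Lp.coeFn_smul c (indicatorConstLp q hB
        (measure_ne_top μ _) (1 : ℝ)), indicatorConstLp_coeFn (p := q) (hs := hB)
        (hμs := measure_ne_top μ B) (c := (1 : ℝ))] with x h1 h2 h3
      rw [h1, h2, Pi.smul_apply, h3]
      by_cases hx : x ∈ B <;> simp [hx]
    have e2 : (fun x => (ContinuousLinearMap.mul ℝ ℝ) (hmem.toLp g x)
        (indicatorConstLp q hB (measure_ne_top μ B) c x)) =ᵐ[μ] B.indicator fun x => c * g x := by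
      filter_upwards [hmem.coeFn_toLp, indicatorConstLp_coeFn (p := q) (hs := hB)
        (hμs := measure_ne_top μ B) (c := c)] with x h1 h2
      rw [h1, h2]
      by_cases hx' : x ∈ B <;> simp [hx', mul_comm]
    rw [integral_congr_ae e2, integral_indicator hB, integral_const_mul, e1, map_smul, h B hB,
      smul_eq_mul]
  rw [key, ContinuousLinearMap.lpPairing_eq_integral]
  rfl

end Riesz

/-! ### Weak sequential compactness and its permanence properties; the scalar L^p spaces. -/

section WeakCompactness

/-- Every bounded sequence has a weakly convergent subsequence. -/
def WeakSeqCompact (X : Type*) [NormedAddCommGroup X] [NormedSpace ℝ X] : Prop :=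
  ∀ (u : ℕ → X) (C : ℝ), (∀ k, ‖u k‖ ≤ C) →
    ∃ (φ : ℕ → ℕ) (u₀ : X), StrictMono φ ∧ WeakTendsto (fun k => u (φ k)) u₀

variable {X Z : Type*} [NormedAddCommGroup X] [NormedSpace ℝ X] [NormedAddCommGroup Z]
  [NormedSpace ℝ Z]

lemma WeakTendsto.comp_strictMono {u : ℕ → X} {u₀ : X} (h : WeakTendsto u u₀) {φ : ℕ → ℕ}
    (hφ : StrictMono φ) : WeakTendsto (fun k => u (φ k)) u₀ :=
  fun ℓ => (h ℓ).comp hφ.tendsto_atTop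

lemma WeakTendsto.map {u : ℕ → X} {u₀ : X} (h : WeakTendsto u u₀) (T : X →L[ℝ] Z) :
    WeakTendsto (fun k => T (u k)) (T u₀) :=
  fun ℓ => h (ℓ.comp T)

lemma WeakTendsto.congr_of_norm_sub_tendsto {u v : ℕ → X} {u₀ : X} (h : WeakTendsto u u₀)
    (hv : Tendsto (fun k => ‖v k - u k‖) atTop (𝓝 0)) : WeakTendsto v u₀ := by
  intro ℓ
  have h1 : Tendsto (fun k => ℓ (v k - u k)) atTop (𝓝 0) := by
    rw [← map_zero ℓ]
    exact (ℓ.continuous.tendsto 0).comp (tendsto_zero_iff_norm_tendsto_zero.2 hv)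
  have h2 := h1.add (h ℓ)
  simpa using h2

/-- A closed subspace is weakly sequentially closed. -/
lemma WeakTendsto.mem_of_isClosed {u : ℕ → X} {u₀ : X} (h : WeakTendsto u u₀)
    {S : Submodule ℝ X} (hS : IsClosed (S : Set X)) (hu : ∀ k, u k ∈ S) : u₀ ∈ S := by
  by_contra hx
  obtain ⟨f, a, h1, h2⟩ := geometric_hahn_banach_closed_point S.convex hS hx
  have h3 : f u₀ ≤ a := le_of_tendsto (h f) (Eventually.of_forall fun k => (h1 _ (hu k)).le)
  exact absurd h3 (not_le.2 h2)

/-- The range of T is closed, hence weakly closed, so the weak limit found in Z comes from X. A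
functional on X becomes a bounded functional on the range through the inverse of T, and Hahn–Banach
extends it to Z, where the convergence is known. -/
lemma WeakSeqCompact.of_embedding [CompleteSpace X] (hZ : WeakSeqCompact Z) (T : X →L[ℝ] Z)
    {c : ℝ≥0} (hT : ∀ x, ‖x‖ ≤ c * ‖T x‖) : WeakSeqCompact X := by
  intro u C hu
  have hanti : AntilipschitzWith c T := AddMonoidHomClass.antilipschitz_of_bound T hT
  have hcl : IsClosed (T.range : Set Z) := by
    rw [LinearMap.coe_range]
    exact hanti.isClosed_range T.uniformContinuous
  obtain ⟨φ, z, hφ, hz⟩ := hZ (fun k => T (u k)) (‖T‖ * C) fun k =>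
    (T.le_opNorm _).trans (by gcongr; exact hu k)
  have hmem : z ∈ T.range := hz.mem_of_isClosed hcl fun k => ⟨_, rfl⟩
  obtain ⟨x, rfl⟩ := hmem
  refine ⟨φ, x, hφ, fun ℓ => ?_⟩
  have hinj : Function.Injective T := hanti.injective
  set e : X ≃ₗ[ℝ] T.range := LinearEquiv.ofInjective T.toLinearMap hinj with he
  have hez : ∀ x, T x = (e x : Z) := fun x => rfl
  set m : T.range →L[ℝ] ℝ := LinearMap.mkContinuous (ℓ.toLinearMap ∘ₗ e.symm.toLinearMap)
    (‖ℓ‖ * c) (fun y => by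
      obtain ⟨x, rfl⟩ := e.surjective y
      simp only [LinearMap.comp_apply, LinearEquiv.coe_coe, LinearEquiv.symm_apply_apply]
      rw [mul_assoc]
      exact (ℓ.le_opNorm x).trans (mul_le_mul_of_nonneg_left (hT x) (norm_nonneg _))) with hm
  obtain ⟨g, hg, -⟩ := exists_extension_norm_eq T.range m
  have hgT : ∀ x, g (T x) = ℓ x := by
    intro x
    rw [hez, hg, hm]
    simp
  have h := hz g
  change Tendsto _ _ (𝓝 (g (T x))) at h
  simpa only [hgT] using h

lemma WeakSeqCompact.prod (hX : WeakSeqCompact X) (hZ : WeakSeqCompact Z) :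
    WeakSeqCompact (X × Z) := by
  intro u C hu
  obtain ⟨φ, x, hφ, hx⟩ := hX (fun k => (u k).1) C fun k => (norm_fst_le _).trans (hu k)
  obtain ⟨ψ, z, hψ, hz⟩ := hZ (fun k => (u (φ k)).2) C fun k => (norm_snd_le _).trans (hu _)
  refine ⟨φ ∘ ψ, (x, z), hφ.comp hψ, fun ℓ => ?_⟩
  have h1 := (hx.comp_strictMono hψ) (ℓ.comp (ContinuousLinearMap.inl ℝ X Z))
  have h2 := hz (ℓ.comp (ContinuousLinearMap.inr ℝ X Z))
  have h3 := h1.add h2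
  simp only [ContinuousLinearMap.comp_apply, ContinuousLinearMap.inl_apply,
    ContinuousLinearMap.inr_apply, ← map_add, Prod.mk_add_mk, add_zero, zero_add] at h3
  exact h3

lemma WeakSeqCompact.pi (hX : WeakSeqCompact X) (n : ℕ) : WeakSeqCompact (Fin n → X) := by
  induction n with
  | zero =>
    intro u C hu
    refine ⟨id, 0, strictMono_id, fun ℓ => ?_⟩
    have : ∀ v : Fin 0 → X, v = 0 := fun v => Subsingleton.elim _ _
    simp [this (u _)]
  | succ n ih =>
    intro u C hu
    obtain ⟨φ, x, hφ, hx⟩ := (hX.prod ih) (fun k => (u k 0, fun i => u k i.succ)) C fun k => by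
      rw [Prod.norm_def]
      refine max_le ((norm_le_pi_norm (u k) 0).trans (hu k)) ?_
      refine (pi_norm_le_iff_of_nonneg ((norm_nonneg _).trans (hu k))).2 fun i => ?_
      exact (norm_le_pi_norm (u k) i.succ).trans (hu k)
    refine ⟨φ, Fin.cons x.1 x.2, hφ, fun ℓ => ?_⟩
    set T : X × (Fin n → X) →L[ℝ] (Fin (n + 1) → X) := ContinuousLinearMap.pi fun i =>
      Fin.cases (motive := fun _ => X × (Fin n → X) →L[ℝ] X) (ContinuousLinearMap.fst ℝ _ _)
        (fun j => (ContinuousLinearMap.proj j).comp (ContinuousLinearMap.snd ℝ _ _)) i with hT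
    have h := hx.map T ℓ
    have hTx : ∀ z : X × (Fin n → X), T z = Fin.cons z.1 z.2 := by
      intro z
      ext i
      refine Fin.cases ?_ (fun j => ?_) i <;> simp [hT]
    simp only [hTx] at h
    refine h.congr fun k => ?_
    congr 1
    exact Fin.cons_self_tail (u (φ k))

variable {α : Type*} {m : MeasurableSpace α} {μ : Measure α} [IsFiniteMeasure μ]

/-- L^p maps into the dual of L^q, and L^q is separable because q < ∞ and the σ-algebra is countably
generated; bounded sequences thus have weak-* convergent subsequences. Riesz representation is used
twice: the weak-* limit is a function in L^p, and each functional on L^p is tested by some f ∈ L^q,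
so that weak-* convergence is weak convergence. -/
theorem weakSeqCompact_lp [MeasurableSpace.CountablyGenerated α] {p : ℝ≥0∞} [Fact (1 ≤ p)]
    (hp1 : 1 < p) (hp : p ≠ ∞) : WeakSeqCompact (Lp ℝ p μ) := by
  intro u C hu
  set q := p.conjExponent with hqdef
  have hpq : p.HolderConjugate q := ENNReal.HolderConjugate.conjExponent hp1.le
  have hqp : q.HolderConjugate p := hpq.symm
  have hq : q ≠ ∞ := ((ENNReal.HolderConjugate.lt_top_iff_one_lt q p).2 hp1).ne
  have hq1 : Fact (1 ≤ q) := ⟨ENNReal.HolderConjugate.one_le q p⟩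
  have : Fact (q ≠ ∞) := ⟨hq⟩
  set Φ := (ContinuousLinearMap.mul ℝ ℝ).lpPairing μ p q with hΦ
  have hmem : ∀ k, StrongDual.toWeakDual (Φ (u k)) ∈
      WeakDual.toStrongDual ⁻¹' Metric.closedBall (0 : StrongDual ℝ (Lp ℝ q μ)) (‖Φ‖ * C) := by
    intro k
    simp only [mem_preimage, mem_closedBall_zero_iff]
    refine (Φ.le_opNorm (u k)).trans ?_
    gcongr
    exact hu k
  obtain ⟨ℓ, -, φ, hφ, hl⟩ := WeakDual.isSeqCompact_closedBall ℝ (Lp ℝ q μ) 0 (‖Φ‖ * C) hmem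
  obtain ⟨g, hg⟩ := exists_lp_of_dual (p := p) hp hq (WeakDual.toStrongDual ℓ)
  refine ⟨φ, g, hφ, fun m => ?_⟩
  obtain ⟨f, hf⟩ := exists_lp_of_dual (p := q) hq hp m
  have h1 : Tendsto (fun k => Φ (u (φ k)) f) atTop (𝓝 (ℓ f)) :=
    ((WeakDual.eval_continuous f).tendsto ℓ).comp hl
  have h2 : ℓ f = m g := by
    rw [hf]
    refine (hg f).trans ?_
    simp only [mul_comm]
  have h3 : ∀ k, Φ (u (φ k)) f = m (u (φ k)) := by
    intro k
    rw [hf, hΦ, ContinuousLinearMap.lpPairing_eq_integral]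
    simp [mul_comm]
  rw [← h2]
  exact h1.congr h3

end WeakCompactness

/-! ### The identification of L^p(α × β) with L^p(α; L^p(β)). -/

section Curry

/-- By the Lindelöf property an open set is a countable union of balls, and the preimage of a ball
is a sublevel set of a distance function. For maps into L^p this reduces measurability to Tonelli's
theorem. -/
lemma stronglyMeasurable_of_measurable_edist {α X : Type*} [MeasurableSpace α] [MetricSpace X]
    [SecondCountableTopology X] {f : α → X} (h : ∀ c, Measurable fun x => edist (f x) c) :
    StronglyMeasurable f := by
  borelize X
  refine Measurable.stronglyMeasurable (measurable_of_isOpen fun U hU => ?_)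
  have hr : ∀ x : U, ∃ r > 0, Metric.eball (x : X) r ⊆ U := fun x =>
    EMetric.isOpen_iff.1 hU x x.2
  choose r hr0 hr using hr
  obtain ⟨T, hT, hTU⟩ := TopologicalSpace.isOpen_iUnion_countable
    (fun x : U => Metric.eball (x : X) (r x)) fun x => Metric.isOpen_eball
  have hU' : U = ⋃ x ∈ T, Metric.eball (x : X) (r x) := by
    rw [hTU]
    refine subset_antisymm (fun x hx => mem_iUnion.2 ⟨⟨x, hx⟩, ?_⟩) (iUnion_subset hr)
    exact Metric.mem_eball_self (hr0 _)
  rw [hU', preimage_iUnion₂]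
  refine MeasurableSet.biUnion hT fun x _ => ?_
  exact measurableSet_lt (h x) measurable_const

lemma eLpNorm_rpow_toReal {α E : Type*} [MeasurableSpace α] {μ : Measure α}
    [NormedAddCommGroup E] {p : ℝ≥0∞} (hp0 : p ≠ 0) (hp : p ≠ ∞) (f : α → E) :
    eLpNorm f p μ ^ p.toReal = ∫⁻ x, ‖f x‖ₑ ^ p.toReal ∂μ := by
  rw [eLpNorm_eq_lintegral_rpow_enorm_toReal hp0 hp, ← ENNReal.rpow_mul, one_div,
    inv_mul_cancel₀ (ENNReal.toReal_pos hp0 hp).ne', ENNReal.rpow_one]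

variable {α β E : Type*} [MeasurableSpace α] [MeasurableSpace β] {μ : Measure α} {ν : Measure β}
  [IsFiniteMeasure ν] [NormedAddCommGroup E]
  {p : ℝ≥0∞} [Fact (1 ≤ p)]

lemma measurable_eLpNorm_section (hp : p ≠ ∞) {F : α × β → E} (hF : StronglyMeasurable F) :
    Measurable fun x => eLpNorm (fun y => F (x, y)) p ν := by
  have hp0 : p ≠ 0 := (zero_lt_one.trans_le (Fact.out : 1 ≤ p)).ne'
  simp only [eLpNorm_eq_lintegral_rpow_enorm_toReal hp0 hp]
  refine Measurable.pow_const ?_ _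
  exact Measurable.lintegral_prod_right' (f := fun z : α × β => ‖F z‖ₑ ^ p.toReal)
    (hF.enorm.pow_const _)

lemma lintegral_eLpNorm_section (hp : p ≠ ∞) {F : α × β → E} (hF : StronglyMeasurable F) :
    ∫⁻ x, eLpNorm (fun y => F (x, y)) p ν ^ p.toReal ∂μ
      = eLpNorm F p (μ.prod ν) ^ p.toReal := by
  have hp0 : p ≠ 0 := (zero_lt_one.trans_le (Fact.out : 1 ≤ p)).ne'
  simp only [eLpNorm_rpow_toReal hp0 hp]
  rw [lintegral_prod _ (hF.enorm.pow_const _).aemeasurable]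

variable [MeasurableSpace.CountablyGenerated β] [SecondCountableTopology E]

lemma exists_curry (hp : p ≠ ∞) (F : Lp E p (μ.prod ν)) :
    ∃ G : Lp (Lp E p ν) p μ, (∀ᵐ x ∂μ, G x =ᵐ[ν] fun y => F (x, y)) ∧ ‖G‖ = ‖F‖ := by
  classical
  have hp0 : p ≠ 0 := (zero_lt_one.trans_le (Fact.out : 1 ≤ p)).ne'
  have hP : 0 < p.toReal := ENNReal.toReal_pos hp0 hp
  have : Fact (p ≠ ∞) := ⟨hp⟩
  have hF : StronglyMeasurable F := Lp.stronglyMeasurable F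
  have hsec : ∀ x, AEStronglyMeasurable (fun y => F (x, y)) ν := fun x =>
    (hF.comp_measurable measurable_prodMk_left).aestronglyMeasurable
  -- The value 0 is used on the null set of those x whose section is not in L^p.
  set g : α → Lp E p ν := fun x =>
    if h : MemLp (fun y => F (x, y)) p ν then h.toLp else 0 with hg
  set S : Set α := {x | eLpNorm (fun y => F (x, y)) p ν < ∞} with hS
  have hSm : MeasurableSet S := measurableSet_lt (measurable_eLpNorm_section hp hF)
    measurable_const
  have hgS : ∀ x (h : x ∈ S), g x = MemLp.toLp (fun y => F (x, y)) ⟨hsec x, h⟩ := fun x h =>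
    dif_pos (show MemLp (fun y => F (x, y)) p ν from ⟨hsec x, h⟩)
  have hgS' : ∀ x ∉ S, g x = 0 := fun x h =>
    dif_neg fun h' : MemLp (fun y => F (x, y)) p ν => h h'.2
  have hgm : StronglyMeasurable g := by
    refine stronglyMeasurable_of_measurable_edist fun c => ?_
    -- The distance to a fixed c is the L^p norm of the section of F(x, y) - c(y), which is
    -- measurable in x by Tonelli.
    have e : (fun x => edist (g x) c) = S.piecewise
        (fun x => eLpNorm (fun y => F (x, y) - c y) p ν) fun _ => edist 0 c := by
      ext x
      by_cases h : x ∈ S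
      · rw [piecewise_eq_of_mem _ _ _ h, hgS x h, Lp.edist_def]
        refine eLpNorm_congr_ae ?_
        filter_upwards [MemLp.coeFn_toLp (f := fun y => F (x, y)) (p := p) (μ := ν)
          ⟨hsec x, h⟩] with y hy
        simp [hy]
      · rw [piecewise_eq_of_notMem _ _ _ h, hgS' x h]
    rw [e]
    refine Measurable.piecewise hSm ?_ measurable_const
    exact measurable_eLpNorm_section (F := fun z : α × β => F z - c z.2) hp
      (hF.sub ((Lp.stronglyMeasurable c).comp_measurable measurable_snd))
  have hint := lintegral_eLpNorm_section (μ := μ) (ν := ν) hp hF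
  have hfin : eLpNorm F p (μ.prod ν) ^ p.toReal ≠ ∞ :=
    ENNReal.rpow_ne_top_of_nonneg hP.le (Lp.eLpNorm_ne_top F)
  have hae : ∀ᵐ x ∂μ, x ∈ S := by
    have := ae_lt_top' ((measurable_eLpNorm_section (ν := ν) hp hF).pow_const p.toReal).aemeasurable
      (hint.trans_ne hfin)
    filter_upwards [this] with x hx
    exact (ENNReal.rpow_lt_top_iff_of_pos hP).1 hx
  have henorm : ∀ᵐ x ∂μ, ‖g x‖ₑ = eLpNorm (fun y => F (x, y)) p ν := by
    filter_upwards [hae] with x hx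
    rw [hgS x hx, Lp.enorm_def]
    exact eLpNorm_congr_ae (MemLp.coeFn_toLp _)
  have hnorm : eLpNorm g p μ = eLpNorm F p (μ.prod ν) := by
    rw [eLpNorm_eq_lintegral_rpow_enorm_toReal hp0 hp]
    rw [lintegral_congr_ae (g := fun x => eLpNorm (fun y => F (x, y)) p ν ^ p.toReal), hint,
      ← ENNReal.rpow_mul, mul_one_div_cancel hP.ne', ENNReal.rpow_one]
    filter_upwards [henorm] with x hx
    rw [hx]
  have hmem : MemLp g p μ := ⟨hgm.aestronglyMeasurable, by rw [hnorm]; exact Lp.eLpNorm_lt_top F⟩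
  refine ⟨hmem.toLp g, ?_, ?_⟩
  · filter_upwards [hmem.coeFn_toLp, hae] with x hx hxS
    rw [hx, hgS x hxS]
    exact MemLp.coeFn_toLp _
  · rw [Lp.norm_toLp, hnorm, Lp.norm_def]

variable [IsFiniteMeasure μ] [NormedSpace ℝ E] [CompleteSpace E]

variable (μ ν E) in
/-- Functions of two variables as functions of the first variable with values in the functions of
the second one. -/
theorem exists_curry_equiv (hp : p ≠ ∞) :
    ∃ K : Lp E p (μ.prod ν) ≃ₗᵢ[ℝ] Lp (Lp E p ν) p μ,
      ∀ F, ∀ᵐ x ∂μ, K F x =ᵐ[ν] fun y => F (x, y) := by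
  choose K hK hnorm using exists_curry (μ := μ) (ν := ν) (E := E) hp
  have hadd : ∀ F G, K (F + G) = K F + K G := by
    intro F G
    ext1
    filter_upwards [hK F, hK G, hK (F + G), Lp.coeFn_add (K F) (K G),
      Measure.ae_ae_of_ae_prod (Lp.coeFn_add F G)] with x h1 h2 h3 h4 h5
    rw [h4]
    ext1
    refine (h3.trans ?_).trans (Lp.coeFn_add (K F x) (K G x)).symm
    filter_upwards [h1, h2, h5] with y h1 h2 h5
    rw [h5, Pi.add_apply, Pi.add_apply, h1, h2]
  have hsmul : ∀ (c : ℝ) F, K (c • F) = c • K F := by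
    intro c F
    ext1
    filter_upwards [hK F, hK (c • F), Lp.coeFn_smul c (K F),
      Measure.ae_ae_of_ae_prod (Lp.coeFn_smul c F)] with x h1 h3 h4 h5
    rw [h4]
    ext1
    refine (h3.trans ?_).trans (Lp.coeFn_smul c (K F x)).symm
    filter_upwards [h1, h5] with y h1 h5
    rw [h5, Pi.smul_apply, Pi.smul_apply, h1]
  set Kl : Lp E p (μ.prod ν) →ₗᵢ[ℝ] Lp (Lp E p ν) p μ :=
    ⟨⟨⟨K, hadd⟩, hsmul⟩, hnorm⟩ with hKl
  have hsurj : Function.Surjective Kl := by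
    intro G
    -- The range contains the functions 1_s(x) c(y), is closed under sums, and is closed because the
    -- map is an isometry.
    refine Lp.induction hp (motive := fun G => ∃ F, Kl F = G) ?_ ?_ ?_ G
    · intro c s hs hμs
      have hmem : MemLp (fun z : α × β => s.indicator (fun _ => c z.2) z.1) p (μ.prod ν) := by
        have h1 : MemLp (fun z : α × β => c z.2) p (μ.prod ν) :=
          (Lp.memLp c).comp_snd μ
        have h2 := h1.indicator (measurable_fst hs)
        refine h2.ae_eq (Eventually.of_forall fun z => ?_)
        by_cases hz : z.1 ∈ s <;> simp [hz]
      refine ⟨hmem.toLp _, ?_⟩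
      ext1
      filter_upwards [hK (hmem.toLp _), Measure.ae_ae_of_ae_prod hmem.coeFn_toLp,
        indicatorConstLp_coeFn (p := p) (hs := hs) (hμs := hμs.ne) (c := c)] with x h1 h2 h3
      change K (hmem.toLp _) x = indicatorConstLp p hs hμs.ne c x
      rw [h3]
      ext1
      refine (h1.trans h2).trans ?_
      by_cases hx : x ∈ s
      · simp only [hx, indicator_of_mem]
        rfl
      · simp only [hx, not_false_eq_true, indicator_of_notMem]
        exact (Lp.coeFn_zero E p ν).symm
    · rintro f g hf hg - ⟨F, hF⟩ ⟨G, hG⟩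
      exact ⟨F + G, by rw [map_add, hF, hG]⟩
    · exact Kl.isometry.isClosedEmbedding.isClosed_range
  exact ⟨LinearIsometryEquiv.ofSurjective Kl hsurj, hK⟩

end Curry

/-! ### Decomposition of integrals over the cells of a lattice. -/

section Tiling

variable {d : ℕ}

/-- The integer parts of the coordinates. -/
def fl (z : Eu d) : Fin d → ℤ := fun i => ⌊z i⌋

@[simp] lemma latt_apply (ξ : Fin d → ℤ) (i : Fin d) : latt ξ i = ξ i := rfl

lemma latt_add (ξ ζ : Fin d → ℤ) : latt (ξ + ζ) = latt ξ + latt ζ := by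
  ext i
  simp

@[simp] lemma latt_zero : latt (0 : Fin d → ℤ) = 0 := by
  ext i
  simp

lemma fl_add_latt (z : Eu d) (ξ : Fin d → ℤ) : fl (z + latt ξ) = fl z + ξ := by
  ext i
  simp [fl]

lemma fl_of_mem_unitCell {y : Eu d} (hy : y ∈ unitCell d) : fl y = 0 := by
  ext i
  simp [fl, Int.floor_eq_zero_iff, (hy i).1.le, (hy i).2]

lemma measurable_fl : Measurable (fl : Eu d → Fin d → ℤ) := by
  refine measurable_pi_lambda _ fun i => Int.measurable_floor.comp ?_
  fun_prop

lemma isOpen_unitCell : IsOpen (unitCell d) := by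
  have : unitCell d = ⋂ i, {y : Eu d | 0 < y i ∧ y i < 1} := by
    ext y; simp [unitCell]
  rw [this]
  refine isOpen_iInter_of_finite fun i => ?_
  exact isOpen_Ioo.preimage (f := fun y : Eu d => y i) (by fun_prop)

lemma norm_le_of_abs_le {z : Eu d} {c : ℝ} (hc : 0 ≤ c) (h : ∀ i, |z i| ≤ c) :
    ‖z‖ ≤ √d * c := by
  rw [EuclideanSpace.norm_eq]
  refine Real.sqrt_le_iff.2 ⟨by positivity, ?_⟩
  rw [mul_pow, Real.sq_sqrt (by positivity)]
  calc ∑ i, ‖z i‖ ^ 2 ≤ ∑ _i : Fin d, c ^ 2 := by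
        refine Finset.sum_le_sum fun i _ => ?_
        gcongr
        exact h i
    _ = _ := by simp

lemma abs_apply_le_norm (z : Eu d) (i : Fin d) : |z i| ≤ ‖z‖ := by
  simpa using PiLp.norm_apply_le z i

lemma norm_sub_latt_fl_le (z : Eu d) : ‖z - latt (fl z)‖ ≤ √d := by
  have := norm_le_of_abs_le (z := z - latt (fl z)) zero_le_one fun i => ?_
  · simpa using this
  · have h1 := Int.floor_le (z i)
    have h2 := Int.lt_floor_add_one (z i)
    simp only [PiLp.sub_apply, latt_apply, fl]
    rw [abs_le]
    constructor <;> linarith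

lemma norm_le_of_mem_unitCell {y : Eu d} (hy : y ∈ unitCell d) : ‖y‖ ≤ √d := by
  have := norm_sub_latt_fl_le y
  rwa [fl_of_mem_unitCell hy, latt_zero, sub_zero] at this

lemma finite_norm_latt_le (R : ℝ) : {ξ : Fin d → ℤ | ‖latt ξ‖ ≤ R}.Finite := by
  refine (Set.Finite.pi' (t := fun _ => Icc (-⌈R⌉) ⌈R⌉) fun _ => finite_Icc _ _).subset ?_
  intro ξ hξ i
  have h1 : |(ξ i : ℝ)| ≤ R := (abs_apply_le_norm (latt ξ) i).trans hξ
  rw [abs_le] at h1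
  have h2 := Int.le_ceil R
  constructor
  · exact_mod_cast (show (-⌈R⌉ : ℝ) ≤ ξ i by linarith)
  · exact_mod_cast (show (ξ i : ℝ) ≤ ⌈R⌉ by linarith)

lemma volume_hyperplane (i : Fin d) (c : ℝ) : volume {y : Eu d | y i = c} = 0 := by
  have h := (EuclideanSpace.volume_preserving_symm_measurableEquiv_toLp (Fin d)).measure_preimage_equiv
    {y : Fin d → ℝ | y i = c}
  rw [volume_pi, Measure.pi_hyperplane (fun _ : Fin d => (volume : Measure ℝ)) i c] at h
  exact h

/-- The half-open cells tile the space exactly; the open ones used in the statement miss only null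
pieces of hyperplanes. -/
lemma fl_eq_zero_ae_eq : {y : Eu d | fl y = 0} =ᵐ[volume] unitCell d := by
  have h : ∀ᵐ y : Eu d, ∀ i, y i ≠ 0 := ae_all_iff.2 fun i => by
    rw [ae_iff]
    simpa using volume_hyperplane i 0
  filter_upwards [h] with y hy
  refine propext ⟨fun h i => ?_, fun h => fl_of_mem_unitCell h⟩
  have := congrFun (h : fl y = 0) i
  simp only [fl, Pi.zero_apply, Int.floor_eq_zero_iff, mem_Ico] at this
  exact ⟨lt_of_le_of_ne this.1 (hy i).symm, this.2⟩

lemma measurableSet_fl_eq (ξ : Fin d → ℤ) : MeasurableSet {z : Eu d | fl z = ξ} :=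
  measurable_fl (measurableSet_singleton ξ)

lemma iUnion_fl_eq : ⋃ ξ : Fin d → ℤ, {z : Eu d | fl z = ξ} = univ :=
  eq_univ_of_forall fun z => mem_iUnion.2 ⟨fl z, rfl⟩

lemma pairwise_disjoint_fl_eq :
    Pairwise (Function.onFun Disjoint fun ξ : Fin d → ℤ => {z : Eu d | fl z = ξ}) :=
  fun ξ ζ h => Set.disjoint_left.2 fun z (h1 : fl z = ξ) (h2 : fl z = ζ) => h (h1 ▸ h2)

lemma preimage_add_latt (ξ : Fin d → ℤ) :
    (fun y : Eu d => y + latt ξ) ⁻¹' {z | fl z = ξ} = {y | fl y = 0} := by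
  ext y
  simp [fl_add_latt]

lemma measurableEmbedding_add_latt (ξ : Fin d → ℤ) :
    MeasurableEmbedding (fun y : Eu d => y + latt ξ) :=
  (Homeomorph.addRight (latt ξ)).measurableEmbedding

lemma lintegral_eq_tsum_unitCell (f : Eu d → ℝ≥0∞) :
    ∫⁻ z, f z = ∑' ξ, ∫⁻ y in unitCell d, f (y + latt ξ) := by
  rw [← setLIntegral_univ, ← iUnion_fl_eq, lintegral_iUnion measurableSet_fl_eq
    pairwise_disjoint_fl_eq]
  refine tsum_congr fun ξ => ?_
  rw [← (measurePreserving_add_right volume (latt ξ)).setLIntegral_comp_preimage_emb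
    (measurableEmbedding_add_latt ξ), preimage_add_latt, setLIntegral_congr fl_eq_zero_ae_eq]

lemma hasSum_integral_unitCell {F : Type*} [NormedAddCommGroup F] [NormedSpace ℝ F]
    {f : Eu d → F} (hf : Integrable f) :
    HasSum (fun ξ => ∫ y in unitCell d, f (y + latt ξ)) (∫ z, f z) := by
  have h := hasSum_integral_iUnion (μ := volume) (f := f) measurableSet_fl_eq
    (pairwise_disjoint_fl_eq (d := d)) hf.integrableOn
  rw [iUnion_fl_eq, setIntegral_univ] at h
  convert h using 2 with ξ
  rw [← (measurePreserving_add_right volume (latt ξ)).setIntegral_preimage_emb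
    (measurableEmbedding_add_latt ξ) f, preimage_add_latt, setIntegral_congr_set fl_eq_zero_ae_eq]

/-- The affine map of the unit cell onto the cell with index `ξ` of the lattice `L ℤᵈ`. -/
def tile (L : Eu d ≃L[ℝ] Eu d) (ξ : Fin d → ℤ) (y : Eu d) : Eu d := L (y + latt ξ)

/-- The volume of a cell of the lattice `L ℤᵈ`. -/
def jac (L : Eu d ≃L[ℝ] Eu d) : ℝ := |LinearMap.det (L : Eu d →ₗ[ℝ] Eu d)|

variable (L : Eu d ≃L[ℝ] Eu d)

lemma jac_pos : 0 < jac L := abs_pos.2 L.toLinearEquiv.isUnit_det'.ne_zero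

lemma map_clequiv_volume :
    Measure.map L volume = ENNReal.ofReal (jac L)⁻¹ • (volume : Measure (Eu d)) := by
  have := Measure.map_linearMap_addHaar_eq_smul_addHaar (volume : Measure (Eu d))
    (f := (L : Eu d →ₗ[ℝ] Eu d)) L.toLinearEquiv.isUnit_det'.ne_zero
  rw [abs_inv] at this
  exact this

lemma continuous_tile (ξ : Fin d → ℤ) : Continuous (tile L ξ) :=
  L.continuous.comp (by fun_prop)

lemma measurableEmbedding_tile (ξ : Fin d → ℤ) : MeasurableEmbedding (tile L ξ) :=
  ((Homeomorph.addRight (latt ξ)).trans L.toHomeomorph).measurableEmbedding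

lemma injective_tile (ξ : Fin d → ℤ) : Function.Injective (tile L ξ) :=
  ((Homeomorph.addRight (latt ξ)).trans L.toHomeomorph).injective

lemma map_tile_volume (ξ : Fin d → ℤ) :
    Measure.map (tile L ξ) volume = ENNReal.ofReal (jac L)⁻¹ • (volume : Measure (Eu d)) := by
  rw [← map_clequiv_volume, ← map_add_right_eq_self (volume : Measure (Eu d)) (latt ξ),
    Measure.map_map L.continuous.measurable (by fun_prop), map_add_right_eq_self]
  rfl

lemma map_tile_restrict (ξ : Fin d → ℤ) (A : Set (Eu d)) :
    Measure.map (tile L ξ) (volume.restrict A) =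
      ENNReal.ofReal (jac L)⁻¹ • volume.restrict (tile L ξ '' A) := by
  rw [← Measure.restrict_smul, ← map_tile_volume L ξ,
    (measurableEmbedding_tile L ξ).restrict_map, (injective_tile L ξ).preimage_image]

lemma lintegral_eq_tsum_tile (f : Eu d → ℝ≥0∞) :
    ∫⁻ z, f z = ENNReal.ofReal (jac L) * ∑' ξ, ∫⁻ y in unitCell d, f (tile L ξ y) := by
  have h := lintegral_eq_tsum_unitCell fun z => f (L z)
  have h2 : ∫⁻ z, f (L z) = ENNReal.ofReal (jac L)⁻¹ * ∫⁻ z, f z := by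
    rw [← smul_eq_mul, ← lintegral_smul_measure, ← map_clequiv_volume]
    exact (L.toHomeomorph.measurableEmbedding.lintegral_map _).symm
  have h3 : ENNReal.ofReal (jac L) * ENNReal.ofReal (jac L)⁻¹ = 1 := by
    rw [← ENNReal.ofReal_mul (jac_pos L).le, mul_inv_cancel₀ (jac_pos L).ne', ENNReal.ofReal_one]
  rw [← one_mul (∫⁻ z, f z), ← h3, mul_assoc, ← h2, h]
  rfl

lemma hasSum_integral_tile {F : Type*} [NormedAddCommGroup F] [NormedSpace ℝ F] {f : Eu d → F}
    (hf : Integrable f) :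
    HasSum (fun ξ => ∫ y in unitCell d, f (tile L ξ y)) ((jac L)⁻¹ • ∫ z, f z) := by
  have hemb : MeasurableEmbedding L := L.toHomeomorph.measurableEmbedding
  have hi : Integrable (fun z => f (L z)) := by
    refine (hemb.integrable_map_iff (μ := volume)).1 ?_
    rw [map_clequiv_volume]
    exact hf.smul_measure ENNReal.ofReal_ne_top
  have h := hasSum_integral_unitCell hi
  rw [← hemb.integral_map, map_clequiv_volume, integral_smul_measure, ENNReal.toReal_ofReal
    (inv_nonneg.2 (jac_pos L).le)] at h
  exact h

lemma memLp_comp_tile {F : Type*} [NormedAddCommGroup F] {p : ℝ≥0∞} {U : Set (Eu d)}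
    {ξ : Fin d → ℤ} {A : Set (Eu d)} (h : tile L ξ '' A ⊆ U) {f : Eu d → F}
    (hf : MemLp f p (volume.restrict U)) :
    MemLp (fun y => f (tile L ξ y)) p (volume.restrict A) := by
  have h1 : MemLp f p (Measure.map (tile L ξ) (volume.restrict A)) := by
    rw [map_tile_restrict]
    exact (hf.mono_measure (Measure.restrict_mono h le_rfl)).smul_measure ENNReal.ofReal_ne_top
  exact ((measurableEmbedding_tile L ξ).memLp_map_measure_iff).1 h1

end Tiling

/-! ### Sobolev functions on cells, and periodicity tested by finite sums over cells. -/

section Sobolev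

variable {d : ℕ}

/-- A bounded weight on a finite measure space lies in the conjugate space, so Hölder's inequality
gives continuity. All weak formulations below become continuous functionals in this way. -/
lemma exists_integral_inner_clm {α E : Type*} [MeasurableSpace α] {μ : Measure α}
    [IsFiniteMeasure μ] [NormedAddCommGroup E] [InnerProductSpace ℝ E] {p : ℝ≥0∞} [Fact (1 ≤ p)]
    {g : α → E} (hg : AEStronglyMeasurable g μ) {C : ℝ} (hC : ∀ x, ‖g x‖ ≤ C) :
    ∃ T : Lp E p μ →L[ℝ] ℝ, ∀ f, T f = ∫ x, inner ℝ (f x) (g x) ∂μ := by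
  set q := p.conjExponent with hqdef
  have hpq : p.HolderConjugate q := ENNReal.HolderConjugate.conjExponent Fact.out
  have hqp : q.HolderConjugate p := hpq.symm
  have hq1 : Fact (1 ≤ q) := ⟨ENNReal.HolderConjugate.one_le q p⟩
  have hmem : MemLp g q μ := MemLp.of_bound hg C (Eventually.of_forall hC)
  refine ⟨((innerSL ℝ (E := E)).lpPairing μ p q).flip (hmem.toLp g), fun f => ?_⟩
  rw [ContinuousLinearMap.flip_apply, ContinuousLinearMap.lpPairing_eq_integral]
  refine integral_congr_ae ?_
  filter_upwards [hmem.coeFn_toLp] with x hx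
  rw [hx, innerSL_apply_apply]

/-- The pairing of a pair `(u, g)` with a scalar weight for `u` and another one for the component
of `g` in the direction `v`. -/
lemma exists_pair_clm {U : Set (Eu d)} [IsFiniteMeasure (volume.restrict U)] {p : ℝ≥0∞}
    [Fact (1 ≤ p)] {a b : Eu d → ℝ} (ha : Measurable a) (hb : Measurable b)
    {C : ℝ} (haC : ∀ x, ‖a x‖ ≤ C) (hbC : ∀ x, ‖b x‖ ≤ C) (v : Eu d) :
    ∃ T : Lp ℝ p (volume.restrict U) × Lp (Eu d) p (volume.restrict U) →L[ℝ] ℝ,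
      ∀ u, T u = (∫ y in U, u.1 y * a y) + ∫ y in U, inner ℝ (u.2 y) v * b y := by
  obtain ⟨S, hS⟩ := exists_integral_inner_clm (μ := volume.restrict U) (p := p)
    ha.aestronglyMeasurable haC
  obtain ⟨T, hT⟩ := exists_integral_inner_clm (μ := volume.restrict U) (p := p)
    (g := fun y => b y • v) (C := C * ‖v‖) (hb.smul_const v).aestronglyMeasurable (fun x => by
      rw [norm_smul]
      gcongr
      exact hbC x)
  refine ⟨S.comp (ContinuousLinearMap.fst ℝ _ _) + T.comp (ContinuousLinearMap.snd ℝ _ _),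
    fun u => ?_⟩
  simp only [add_apply, ContinuousLinearMap.comp_apply,
    ContinuousLinearMap.coe_fst', ContinuousLinearMap.coe_snd', hS, hT, inner_smul_right]
  congr 1
  · refine integral_congr_ae (Eventually.of_forall fun x => ?_)
    simp [mul_comm]
  · refine integral_congr_ae (Eventually.of_forall fun x => ?_)
    simp [mul_comm]

lemma exists_bound_test {φ : Eu d → ℝ} (h1 : ContDiff ℝ (⊤ : ℕ∞) φ) (h2 : HasCompactSupport φ)
    (v : Eu d) : ∃ C, (∀ x, ‖fderiv ℝ φ x v‖ ≤ C) ∧ ∀ x, ‖φ x‖ ≤ C := by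
  obtain ⟨C1, hC1⟩ := (h2.fderiv_apply (𝕜 := ℝ) v).exists_bound_of_continuous
    ((h1.continuous_fderiv (by simp)).clm_apply continuous_const)
  obtain ⟨C2, hC2⟩ := h2.exists_bound_of_continuous h1.continuous
  exact ⟨max C1 C2, fun x => (hC1 x).trans (le_max_left _ _),
    fun x => (hC2 x).trans (le_max_right _ _)⟩

lemma measurable_fderiv_test {φ : Eu d → ℝ} (h1 : ContDiff ℝ (⊤ : ℕ∞) φ) (v : Eu d) :
    Measurable fun y => fderiv ℝ φ y v :=
  ((h1.continuous_fderiv (by simp)).clm_apply continuous_const).measurable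

/-- The space is an intersection of kernels of continuous functionals, one for each test function
and direction; local integrability is automatic for L^p over a finite measure. -/
lemma isClosed_sobolev {U : Set (Eu d)} [IsFiniteMeasure (volume.restrict U)] {p : ℝ≥0∞}
    [Fact (1 ≤ p)] : IsClosed (sobolev U p : Set (Lp ℝ p (volume.restrict U) ×
      Lp (Eu d) p (volume.restrict U))) := by
  have h : (sobolev U p : Set (Lp ℝ p (volume.restrict U) × Lp (Eu d) p (volume.restrict U))) =
      ⋂ (φ : Eu d → ℝ) (_ : ContDiff ℝ (⊤ : ℕ∞) φ) (_ : HasCompactSupport φ)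
        (_ : tsupport φ ⊆ U) (v : Eu d), {u | (∫ y in U, u.1 y * fderiv ℝ φ y v) +
          ∫ y in U, inner ℝ (u.2 y) v * φ y = 0} := by
    ext u
    simp only [mem_iInter, mem_ofPred_eq]
    constructor
    · intro h φ h1 h2 h3 v
      rw [h.2.2 φ h1 h2 h3 v, neg_add_cancel]
    · intro h
      refine ⟨?_, ?_, fun φ h1 h2 h3 v => eq_neg_of_add_eq_zero_left (h φ h1 h2 h3 v)⟩
      · exact IntegrableOn.locallyIntegrableOn ((Lp.memLp u.1).integrable Fact.out)
      · exact IntegrableOn.locallyIntegrableOn ((Lp.memLp u.2).integrable Fact.out)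
  rw [h]
  refine isClosed_iInter fun φ => isClosed_iInter fun h1 => isClosed_iInter fun h2 =>
    isClosed_iInter fun h3 => isClosed_iInter fun v => ?_
  obtain ⟨C, hC1, hC2⟩ := exists_bound_test h1 h2 v
  obtain ⟨T, hT⟩ := exists_pair_clm (U := U) (p := p) (measurable_fderiv_test h1 v)
    h1.continuous.measurable hC1 hC2 v
  simp only [← hT]
  exact isClosed_eq T.continuous continuous_const

instance {U : Set (Eu d)} [IsFiniteMeasure (volume.restrict U)] {p : ℝ≥0∞} [Fact (1 ≤ p)] :
    CompleteSpace (sobolev U p) := isClosed_sobolev.completeSpace_coe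

lemma isBounded_unitCell : Bornology.IsBounded (unitCell d) :=
  (Metric.isBounded_closedBall (x := (0 : Eu d)) (r := √d)).subset fun y hy => by
    simpa using norm_le_of_mem_unitCell hy

instance : IsFiniteMeasure (volume.restrict (unitCell d)) :=
  ⟨by simpa using isBounded_unitCell.measure_lt_top⟩

/-- The part of the weak formulation of a periodic gradient that is tested in the cell with
index `ζ`. -/
def cellPairing {p : ℝ≥0∞} [Fact (1 ≤ p)] (φ : Eu d → ℝ) (v : Eu d) (ζ : Fin d → ℤ)
    (u : sobolev (unitCell d) p) : ℝ :=
  (∫ y in unitCell d, fn u y * fderiv ℝ φ (y + latt ζ) v) +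
    ∫ y in unitCell d, inner ℝ (grad u y) v * φ (y + latt ζ)

lemma exists_cellPairing_clm {p : ℝ≥0∞} [Fact (1 ≤ p)] {φ : Eu d → ℝ}
    (h1 : ContDiff ℝ (⊤ : ℕ∞) φ) (h2 : HasCompactSupport φ) (v : Eu d) (ζ : Fin d → ℤ) :
    ∃ T : sobolev (unitCell d) p →L[ℝ] ℝ, ∀ u, T u = cellPairing φ v ζ u := by
  obtain ⟨C, hC1, hC2⟩ := exists_bound_test h1 h2 v
  obtain ⟨T, hT⟩ := exists_pair_clm (U := unitCell d) (p := p)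
    ((measurable_fderiv_test h1 v).comp (measurable_add_const (latt ζ)))
    (h1.continuous.measurable.comp (measurable_add_const (latt ζ)))
    (fun x => hC1 _) (fun x => hC2 _) v
  exact ⟨T.comp (sobolev (unitCell d) p).subtypeL, fun u => hT u⟩

lemma exists_finset_tsupport {φ : Eu d → ℝ} (h2 : HasCompactSupport φ) :
    ∃ S : Finset (Fin d → ℤ), ∀ ζ ∉ S, ∀ y ∈ unitCell d, y + latt ζ ∉ tsupport φ := by
  obtain ⟨R, hR⟩ := h2.isBounded.subset_closedBall 0
  refine ⟨(finite_norm_latt_le (R + √d) : {ξ : Fin d → ℤ | _}.Finite).toFinset, fun ζ hζ y hy h => ?_⟩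
  refine hζ ?_
  rw [Set.Finite.mem_toFinset, mem_ofPred_eq]
  have h3 : ‖y + latt ζ‖ ≤ R := by simpa using hR h
  have h4 := norm_le_of_mem_unitCell hy
  have h5 := norm_sub_le (y + latt ζ) y
  rw [add_sub_cancel_left] at h5
  linarith

lemma fderiv_eq_zero_of_notMem {φ : Eu d → ℝ} {x : Eu d} (hx : x ∉ tsupport φ) :
    fderiv ℝ φ x = 0 :=
  image_eq_zero_of_notMem_tsupport fun h => hx (tsupport_fderiv_subset ℝ h)

/-- The representative in the half-open unit cell. -/
def frac (z : Eu d) : Eu d := z - latt (fl z)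

lemma measurable_frac : Measurable (frac : Eu d → Eu d) :=
  measurable_id.sub ((Measurable.of_discrete (f := fun ξ : Fin d → ℤ => latt ξ)).comp measurable_fl)

lemma frac_add_latt (z : Eu d) (ξ : Fin d → ℤ) : frac (z + latt ξ) = frac z := by
  simp only [frac, fl_add_latt, latt_add]
  abel

lemma frac_of_mem_unitCell {y : Eu d} (hy : y ∈ unitCell d) : frac y = y := by
  simp [frac, fl_of_mem_unitCell hy]

/-- A compact set meets finitely many cells, and each of them contributes at most the integral of
‖g‖ over Y. -/
lemma locallyIntegrable_comp_frac {F : Type*} [NormedAddCommGroup F] {g : Eu d → F}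
    (hm : StronglyMeasurable g) (hg : IntegrableOn g (unitCell d)) :
    LocallyIntegrable (fun z => g (frac z)) := by
  rw [locallyIntegrable_iff]
  intro K hK
  refine ⟨(hm.comp_measurable measurable_frac).aestronglyMeasurable, ?_⟩
  obtain ⟨R, hR⟩ := hK.isBounded.subset_closedBall 0
  set S := (finite_norm_latt_le (d := d) (R + √d)).toFinset with hS
  have hle : ∀ ζ, ∫⁻ y in unitCell d, K.indicator (fun z => ‖g (frac z)‖ₑ) (y + latt ζ)
      ≤ (S : Set (Fin d → ℤ)).indicator (fun _ => ∫⁻ y in unitCell d, ‖g y‖ₑ) ζ := by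
    intro ζ
    by_cases hζ : ζ ∈ S
    · rw [indicator_of_mem (by exact hζ)]
      refine setLIntegral_mono' isOpen_unitCell.measurableSet fun y hy => ?_
      refine (indicator_le_self K _ (y + latt ζ)).trans ?_
      rw [frac_add_latt, frac_of_mem_unitCell hy]
    · refine le_trans (le_of_eq ?_) zero_le
      rw [setLIntegral_congr_fun (g := fun _ => 0) isOpen_unitCell.measurableSet, lintegral_zero]
      intro y hy
      refine indicator_of_notMem (fun h => hζ ?_) _
      rw [hS, Set.Finite.mem_toFinset, mem_ofPred_eq]
      have h3 : ‖y + latt ζ‖ ≤ R := by simpa using hR h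
      have h4 := norm_le_of_mem_unitCell hy
      have h5 := norm_sub_le (y + latt ζ) y
      rw [add_sub_cancel_left] at h5
      linarith
  rw [HasFiniteIntegral, ← lintegral_indicator hK.measurableSet, lintegral_eq_tsum_unitCell]
  refine lt_of_le_of_lt (ENNReal.tsum_le_tsum hle) ?_
  rw [tsum_eq_sum (s := S) (fun ζ hζ => indicator_of_notMem (by exact hζ) _)]
  refine ENNReal.sum_lt_top.2 fun ζ hζ => ?_
  rw [indicator_of_mem (by exact hζ)]
  exact hg.2

/-- A function in `W^{1,p}(Y)` is in `W^{1,p}_per(Y)` if its gradient is tested correctly by all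
periodized test functions. -/
lemma mem_sobolevPer_of_cellPairing {p : ℝ≥0∞} [Fact (1 ≤ p)] {u : sobolev (unitCell d) p}
    (h : ∀ φ : Eu d → ℝ, ContDiff ℝ (⊤ : ℕ∞) φ → HasCompactSupport φ → ∀ (v : Eu d)
      (S : Finset (Fin d → ℤ)), (∀ ζ ∉ S, ∀ y ∈ unitCell d, y + latt ζ ∉ tsupport φ) →
      ∑ ζ ∈ S, cellPairing φ v ζ u = 0) : u ∈ sobolevPer d p := by
  have hY := (isOpen_unitCell (d := d)).measurableSet
  have hi1 : LocallyIntegrable (fun z => fn u (frac z)) :=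
    locallyIntegrable_comp_frac (Lp.stronglyMeasurable _) ((Lp.memLp (fn u)).integrable Fact.out)
  have hi2 : LocallyIntegrable (fun z => grad u (frac z)) :=
    locallyIntegrable_comp_frac (Lp.stronglyMeasurable _) ((Lp.memLp (grad u)).integrable Fact.out)
  refine ⟨fun z => fn u (frac z), fun z => grad u (frac z), fun y ξ => by simp only [frac_add_latt],
    ⟨hi1.locallyIntegrableOn _, hi2.locallyIntegrableOn _, fun φ h1 h2 h3 v => ?_⟩, ?_, ?_⟩
  · obtain ⟨S, hS⟩ := exists_finset_tsupport h2
    have hsum := h φ h1 h2 v S hS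
    have I1 : Integrable (fun z => fn u (frac z) * fderiv ℝ φ z v) := by
      rw [← integrableOn_univ]
      exact integrableOn_mul_of_tsupport (hi1.locallyIntegrableOn _)
        ((h1.continuous_fderiv (by simp)).clm_apply continuous_const)
        (h2.fderiv_apply (𝕜 := ℝ) v) (subset_univ _)
    have I2 : Integrable (fun z => inner ℝ (grad u (frac z)) v * φ z) := by
      rw [← integrableOn_univ]
      refine integrableOn_mul_of_tsupport ?_ h1.continuous h2 (subset_univ _)
      intro x hx
      obtain ⟨s, hs, hi⟩ := hi2.locallyIntegrableOn univ x hx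
      exact ⟨s, hs, hi.inner_const v⟩
    -- Cutting the integrals over ℝᵈ into cells turns the weak formulation for the periodic
    -- extension into the sum of the `cellPairing`s.
    have H1 := (hasSum_integral_unitCell I1).add (hasSum_integral_unitCell I2)
    have e : ∀ ζ, (∫ y in unitCell d, fn u (frac (y + latt ζ)) * fderiv ℝ φ (y + latt ζ) v) +
        ∫ y in unitCell d, inner ℝ (grad u (frac (y + latt ζ))) v * φ (y + latt ζ)
        = cellPairing φ v ζ u := by
      intro ζ
      rw [cellPairing]
      congr 1
      · refine setIntegral_congr_fun hY fun y hy => ?_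
        simp only [frac_add_latt, frac_of_mem_unitCell hy]
      · refine setIntegral_congr_fun hY fun y hy => ?_
        simp only [frac_add_latt, frac_of_mem_unitCell hy]
    simp only [e] at H1
    have H2 : HasSum (fun ζ => cellPairing φ v ζ u) (∑ ζ ∈ S, cellPairing φ v ζ u) := by
      refine hasSum_sum_of_ne_finset_zero fun ζ hζ => ?_
      rw [cellPairing, setIntegral_eq_zero_of_forall_eq_zero,
        setIntegral_eq_zero_of_forall_eq_zero, add_zero]
      · intro y hy
        rw [image_eq_zero_of_notMem_tsupport (hS ζ hζ y hy), mul_zero]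
      · intro y hy
        rw [fderiv_eq_zero_of_notMem (hS ζ hζ y hy)]
        simp
    rw [setIntegral_univ, setIntegral_univ]
    exact eq_neg_of_add_eq_zero_left ((H1.unique H2).trans hsum)
  · filter_upwards [ae_restrict_mem hY] with y hy
    rw [frac_of_mem_unitCell hy]
  · filter_upwards [ae_restrict_mem hY] with y hy
    rw [frac_of_mem_unitCell hy]

/-- The weak formulation of the gradient in the cells of the lattice `L ℤᵈ`. -/
lemma HasWeakGrad.hasSum_tile {Ω : Set (Eu d)} {w : Eu d → ℝ} {g : Eu d → Eu d}
    (hw : HasWeakGrad Ω w g) (L : Eu d ≃L[ℝ] Eu d) (ξ : Fin d → ℤ) {φ : Eu d → ℝ}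
    (h1 : ContDiff ℝ (⊤ : ℕ∞) φ) (h2 : HasCompactSupport φ)
    (h3 : ∀ z ∈ tsupport φ, tile L ξ z ∈ Ω) (v : Eu d) :
    HasSum (fun ζ => (∫ y in unitCell d, w (tile L (ξ + ζ) y) * fderiv ℝ φ (y + latt ζ) v) +
      ∫ y in unitCell d, inner ℝ (g (tile L (ξ + ζ) y)) (L v) * φ (y + latt ζ)) 0 := by
  -- The test function is transported by e, the inverse of `tile L ξ`. Testing φ ∘ e in the
  -- direction L v makes the chain rule return the derivative of φ in the direction v.
  set e : Eu d ≃ₜ Eu d := (L.toHomeomorph.symm).trans (Homeomorph.addRight (-latt ξ)) with he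
  have hex : ∀ x, e x = L.symm x - latt ξ := fun x => (sub_eq_add_neg _ _).symm
  set ψ : Eu d → ℝ := fun x => φ (e x) with hψ
  have hψ1 : ContDiff ℝ (⊤ : ℕ∞) ψ := by
    have : ψ = fun x => φ (L.symm x - latt ξ) := funext fun x => by rw [hψ]; simp only [hex]
    rw [this]
    exact h1.comp (L.symm.contDiff.sub contDiff_const)
  have hψ2 : HasCompactSupport ψ := h2.comp_homeomorph e
  have hts : tsupport ψ = e ⁻¹' tsupport φ := tsupport_comp_eq_preimage φ e
  have hψ3 : tsupport ψ ⊆ Ω := by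
    intro x hx
    rw [hts] at hx
    have := h3 _ hx
    rwa [tile, hex, sub_add_cancel, L.apply_symm_apply] at this
  have hfd : ∀ x, fderiv ℝ ψ x (L v) = fderiv ℝ φ (e x) v := by
    intro x
    have h4 : HasFDerivAt e (L.symm : Eu d →L[ℝ] Eu d) x := by
      have : (e : Eu d → Eu d) = fun x => L.symm x - latt ξ := funext hex
      rw [this]
      exact (L.symm.hasFDerivAt).sub_const _
    have h5 : HasFDerivAt φ (fderiv ℝ φ (e x)) (e x) :=
      (h1.differentiable (by simp) (e x)).hasFDerivAt
    have h6 : HasFDerivAt ψ _ x := h5.comp x h4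
    rw [h6.fderiv]
    simp
  have hz1 : ∀ x ∉ Ω, w x * fderiv ℝ ψ x (L v) = 0 := fun x hx => by
    rw [fderiv_eq_zero_of_notMem fun h => hx (hψ3 h)]; simp
  have hz2 : ∀ x ∉ Ω, inner ℝ (g x) (L v) * ψ x = 0 := fun x hx => by
    rw [image_eq_zero_of_notMem_tsupport fun h => hx (hψ3 h), mul_zero]
  have I1 : Integrable (fun x => w x * fderiv ℝ ψ x (L v)) :=
    (integrableOn_iff_integrable_of_support_subset fun x hx => by
      by_contra h; exact hx (hz1 x h)).1 (hw.integrableOn_left hψ1 hψ2 hψ3 (L v))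
  have I2 : Integrable (fun x => inner ℝ (g x) (L v) * ψ x) :=
    (integrableOn_iff_integrable_of_support_subset fun x hx => by
      by_contra h; exact hx (hz2 x h)).1 (hw.integrableOn_right hψ1 hψ2 hψ3 (L v))
  have H := (hasSum_integral_tile L I1).add (hasSum_integral_tile L I2)
  have hW := hw.2.2 ψ hψ1 hψ2 hψ3 (L v)
  rw [setIntegral_eq_integral_of_forall_compl_eq_zero hz1,
    setIntegral_eq_integral_of_forall_compl_eq_zero hz2] at hW
  rw [hW, ← smul_add, neg_add_cancel, smul_zero] at H
  -- Reindexing relative to ξ, so that the cell ξ + ζ is matched with the translate of φ by ζ.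
  rw [← (Equiv.addLeft ξ).hasSum_iff] at H
  have he2 : ∀ ζ y, e (tile L (ξ + ζ) y) = y + latt ζ := by
    intro ζ y
    rw [hex, tile, L.symm_apply_apply, latt_add]
    abel
  have hψ2 : ∀ ζ y, ψ (tile L (ξ + ζ) y) = φ (y + latt ζ) := fun ζ y => by
    rw [← he2]
  simpa only [Function.comp_def, Equiv.coe_addLeft, hfd, hψ2, he2] using H

lemma add_latt_notMem_unitCell {y : Eu d} (hy : y ∈ unitCell d) {ζ : Fin d → ℤ} (hζ : ζ ≠ 0) :
    y + latt ζ ∉ unitCell d := fun h => hζ <| by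
  have := fl_of_mem_unitCell h
  rwa [fl_add_latt, fl_of_mem_unitCell hy, zero_add] at this

/-- For a test function supported in Y only the term ζ = 0 of `HasWeakGrad.hasSum_tile` survives;
passing to the adjoint moves L from the direction v onto the gradient. -/
lemma HasWeakGrad.comp_tile {Ω : Set (Eu d)} {w : Eu d → ℝ} {g : Eu d → Eu d}
    (hw : HasWeakGrad Ω w g) {L : Eu d ≃L[ℝ] Eu d} {ξ : Fin d → ℤ}
    (h : tile L ξ '' unitCell d ⊆ Ω)
    (hi : IntegrableOn (fun y => w (tile L ξ y)) (unitCell d))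
    (hi' : IntegrableOn (fun y => g (tile L ξ y)) (unitCell d)) :
    HasWeakGrad (unitCell d) (fun y => w (tile L ξ y))
      (fun y => (L : Eu d →L[ℝ] Eu d).adjoint (g (tile L ξ y))) := by
  refine ⟨hi.locallyIntegrableOn, ?_, fun φ h1 h2 h3 v => ?_⟩
  · exact IntegrableOn.locallyIntegrableOn
      (((L : Eu d →L[ℝ] Eu d).adjoint).integrable_comp hi')
  have H := hw.hasSum_tile L ξ h1 h2 (fun z hz => h ⟨z, h3 hz, rfl⟩) v
  have H2 := hasSum_single (f := fun ζ => (∫ y in unitCell d, w (tile L (ξ + ζ) y) *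
      fderiv ℝ φ (y + latt ζ) v) +
      ∫ y in unitCell d, inner ℝ (g (tile L (ξ + ζ) y)) (L v) * φ (y + latt ζ)) 0 (by
    intro ζ hζ
    rw [setIntegral_eq_zero_of_forall_eq_zero, setIntegral_eq_zero_of_forall_eq_zero, add_zero]
    · intro y hy
      rw [image_eq_zero_of_notMem_tsupport fun h => add_latt_notMem_unitCell hy hζ (h3 h), mul_zero]
    · intro y hy
      rw [fderiv_eq_zero_of_notMem fun h => add_latt_notMem_unitCell hy hζ (h3 h)]
      simp)
  have H3 := H2.unique H
  simp only [add_zero, latt_zero] at H3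
  simp only [ContinuousLinearMap.adjoint_inner_left]
  exact eq_neg_of_add_eq_zero_left H3

lemma memLp_grad_comp_tile {Ω : Set (Eu d)} {p : ℝ≥0∞} [Fact (1 ≤ p)] (w : sobolev Ω p)
    (L : Eu d ≃L[ℝ] Eu d) (ξ : Fin d → ℤ) (h : tile L ξ '' unitCell d ⊆ Ω) :
    MemLp (fun y => (L : Eu d →L[ℝ] Eu d).adjoint (grad w (tile L ξ y))) p
      (volume.restrict (unitCell d)) :=
  ((L : Eu d →L[ℝ] Eu d).adjoint).comp_memLp' (memLp_comp_tile L h (Lp.memLp (grad w)))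

/-- The rescaled restriction to a cell of an element of `W^{1,p}(Ω)`. -/
def cellElt {Ω : Set (Eu d)} {p : ℝ≥0∞} [Fact (1 ≤ p)] (w : sobolev Ω p)
    (L : Eu d ≃L[ℝ] Eu d) (ξ : Fin d → ℤ) (h : tile L ξ '' unitCell d ⊆ Ω) :
    sobolev (unitCell d) p :=
  ⟨((memLp_comp_tile L h (Lp.memLp (fn w))).toLp _, (memLp_grad_comp_tile w L ξ h).toLp _),
    (HasWeakGrad.comp_tile w.2 h ((memLp_comp_tile L h (Lp.memLp (fn w))).integrable Fact.out)
      ((memLp_comp_tile L h (Lp.memLp (grad w))).integrable Fact.out)).congr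
      (MemLp.coeFn_toLp (memLp_comp_tile L h (Lp.memLp (fn w))))
      (MemLp.coeFn_toLp (memLp_grad_comp_tile w L ξ h))⟩

lemma fn_cellElt {Ω : Set (Eu d)} {p : ℝ≥0∞} [Fact (1 ≤ p)] (w : sobolev Ω p)
    (L : Eu d ≃L[ℝ] Eu d) (ξ : Fin d → ℤ) (h : tile L ξ '' unitCell d ⊆ Ω) :
    fn (cellElt w L ξ h) =ᵐ[volume.restrict (unitCell d)] fun y => fn w (tile L ξ y) :=
  MemLp.coeFn_toLp (memLp_comp_tile L h (Lp.memLp (fn w)))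

lemma grad_cellElt {Ω : Set (Eu d)} {p : ℝ≥0∞} [Fact (1 ≤ p)] (w : sobolev Ω p)
    (L : Eu d ≃L[ℝ] Eu d) (ξ : Fin d → ℤ) (h : tile L ξ '' unitCell d ⊆ Ω) :
    grad (cellElt w L ξ h) =ᵐ[volume.restrict (unitCell d)]
      fun y => (L : Eu d →L[ℝ] Eu d).adjoint (grad w (tile L ξ y)) :=
  MemLp.coeFn_toLp (memLp_grad_comp_tile w L ξ h)

/-- The periodized test functions see no gradient defect of a function in `W^{1,p}(Ω)` around a
cell which is well inside `Ω`. -/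
lemma sum_cellPairing_cellElt {Ω : Set (Eu d)} {p : ℝ≥0∞} [Fact (1 ≤ p)] (w : sobolev Ω p)
    (L : Eu d ≃L[ℝ] Eu d) (ξ : Fin d → ℤ) {φ : Eu d → ℝ}
    (h1 : ContDiff ℝ (⊤ : ℕ∞) φ) (h2 : HasCompactSupport φ)
    (h3 : ∀ z ∈ tsupport φ, tile L ξ z ∈ Ω) (v : Eu d) {S : Finset (Fin d → ℤ)}
    (hS : ∀ ζ ∉ S, ∀ y ∈ unitCell d, y + latt ζ ∉ tsupport φ)
    (W : (Fin d → ℤ) → sobolev (unitCell d) p)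
    (hW : ∀ ζ ∈ S, ∃ h, W ζ = cellElt w L (ξ + ζ) h) :
    ∑ ζ ∈ S, cellPairing φ v ζ (W ζ) = 0 := by
  have H := w.2.hasSum_tile L ξ h1 h2 h3 v
  set T : (Fin d → ℤ) → ℝ := fun ζ => (∫ y in unitCell d,
      fn w (tile L (ξ + ζ) y) * fderiv ℝ φ (y + latt ζ) v) +
      ∫ y in unitCell d, inner ℝ (grad w (tile L (ξ + ζ) y)) (L v) * φ (y + latt ζ) with hT
  have H2 : HasSum T (∑ ζ ∈ S, T ζ) := hasSum_sum_of_ne_finset_zero (by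
    intro ζ hζ
    simp only [hT]
    rw [setIntegral_eq_zero_of_forall_eq_zero, setIntegral_eq_zero_of_forall_eq_zero, add_zero]
    · intro y hy
      rw [image_eq_zero_of_notMem_tsupport (hS ζ hζ y hy), mul_zero]
    · intro y hy
      rw [fderiv_eq_zero_of_notMem (hS ζ hζ y hy)]
      simp)
  rw [← (H2.unique H : ∑ ζ ∈ S, T ζ = 0)]
  refine Finset.sum_congr rfl fun ζ hζ => ?_
  obtain ⟨h, hWζ⟩ := hW ζ hζ
  rw [cellPairing, hWζ]
  congr 1
  · refine integral_congr_ae ?_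
    filter_upwards [fn_cellElt w L (ξ + ζ) h] with y hy
    rw [hy]
  · refine integral_congr_ae ?_
    filter_upwards [grad_cellElt w L (ξ + ζ) h] with y hy
    rw [hy, ContinuousLinearMap.adjoint_inner_left]
    rfl

end Sobolev

/-! ### The cell containing a point, and the sets Ω̂ₙ as `hat L V`. -/

section Cells

variable {d : ℕ}

lemma volume_unitCell : volume (unitCell d) = 1 := by
  have h := (EuclideanSpace.volume_preserving_symm_measurableEquiv_toLp (Fin d)).measure_preimage_equiv
    (Set.pi univ fun _ => Ioo (0 : ℝ) 1)
  rw [Real.volume_pi_Ioo] at h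
  simp only [sub_zero, ENNReal.ofReal_one, Finset.prod_const_one] at h
  rw [← h]
  congr 1
  ext y
  simp [unitCell, Set.mem_pi]

lemma frac_mem_Ico (z : Eu d) (i : Fin d) : 0 ≤ frac z i ∧ frac z i < 1 := by
  simp only [frac, PiLp.sub_apply, latt_apply, fl]
  exact ⟨Int.fract_nonneg _, Int.fract_lt_one _⟩

lemma mem_closure_unitCell {y : Eu d} (hy : ∀ i, 0 ≤ y i ∧ y i ≤ 1) : y ∈ closure (unitCell d) := by
  set c : Eu d := WithLp.toLp 2 fun _ => (1 / 2 : ℝ) with hc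
  have h : Tendsto (fun t : ℝ => y + t • (c - y)) (𝓝[>] 0) (𝓝 y) := by
    have : Continuous fun t : ℝ => y + t • (c - y) := by fun_prop
    have h2 := (this.tendsto 0).mono_left (nhdsWithin_le_nhds (s := Ioi 0))
    simpa using h2
  refine mem_closure_of_tendsto h ?_
  filter_upwards [Ioo_mem_nhdsGT (zero_lt_one' ℝ)] with t ht i
  obtain ⟨h0, h1⟩ := hy i
  have hci : c i = 1 / 2 := rfl
  simp only [PiLp.add_apply, PiLp.smul_apply, PiLp.sub_apply, smul_eq_mul, hci]
  constructor <;> nlinarith [ht.1, ht.2]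

lemma frac_mem_closure (z : Eu d) : frac z ∈ closure (unitCell d) :=
  mem_closure_unitCell fun i => ⟨(frac_mem_Ico z i).1, (frac_mem_Ico z i).2.le⟩

lemma le_of_mem_closure_unitCell {y : Eu d} (hy : y ∈ closure (unitCell d)) (i : Fin d) :
    0 ≤ y i ∧ y i ≤ 1 := by
  have h : IsClosed {y : Eu d | y i ∈ Icc (0 : ℝ) 1} :=
    isClosed_Icc.preimage (f := fun y : Eu d => y i) (by fun_prop)
  have hsub : unitCell d ⊆ {y : Eu d | y i ∈ Icc (0 : ℝ) 1} := fun y hy => ⟨(hy i).1.le, (hy i).2.le⟩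
  exact closure_minimal hsub h hy

/-- The index of the cell of the lattice `L ℤᵈ` which contains `x`. -/
def idx (L : Eu d ≃L[ℝ] Eu d) (x : Eu d) : Fin d → ℤ := fl (L.symm x)

/-- The interior of the union of the closures of the cells of `L ℤᵈ` contained in `V`. -/
def hat (L : Eu d ≃L[ℝ] Eu d) (V : Set (Eu d)) : Set (Eu d) :=
  interior (⋃ ξ ∈ {ξ : Fin d → ℤ | tile L ξ '' unitCell d ⊆ V}, tile L ξ '' closure (unitCell d))

variable (L : Eu d ≃L[ℝ] Eu d)

lemma measurable_idx : Measurable (idx L) := measurable_fl.comp L.symm.continuous.measurable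

lemma idx_add (x : Eu d) (ζ : Fin d → ℤ) : idx L (x + L (latt ζ)) = idx L x + ζ := by
  rw [idx, map_add, L.symm_apply_apply, fl_add_latt, idx]

lemma idx_tile {y : Eu d} (hy : y ∈ unitCell d) (ξ : Fin d → ℤ) : idx L (tile L ξ y) = ξ := by
  rw [idx, tile, L.symm_apply_apply, fl_add_latt, fl_of_mem_unitCell hy, zero_add]

lemma tile_idx_frac (x : Eu d) : tile L (idx L x) (frac (L.symm x)) = x := by
  rw [tile, frac, idx, sub_add_cancel, L.apply_symm_apply]

/-- This settles points on cell faces. Since `hat` is open and x lies in the closure of its own open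
cell, `hat` meets that open cell; and an open cell meets the closed cell of ξ only if ξ is its own
index. -/
lemma tile_idx_subset {V : Set (Eu d)} {x : Eu d} (hx : x ∈ hat L V) :
    tile L (idx L x) '' unitCell d ⊆ V := by
  have hcl : x ∈ closure (tile L (idx L x) '' unitCell d) := by
    have := image_closure_subset_closure_image (continuous_tile L (idx L x)) (s := unitCell d)
    exact this ⟨_, frac_mem_closure _, tile_idx_frac L x⟩
  obtain ⟨z, hz, y, hy, hyz⟩ := mem_closure_iff.1 hcl _ isOpen_interior hx
  obtain ⟨ξ, hξ, y', hy', hyz'⟩ := mem_iUnion₂.1 (interior_subset hz)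
  suffices h : idx L x = ξ by
    rw [h]
    exact hξ
  rw [← hyz'] at hyz
  have h1 := L.injective hyz
  ext i
  have h2 : y i + (idx L x i : ℝ) = y' i + ξ i := by
    have := congrArg (fun z : Eu d => z i) h1
    simpa using this
  have h3 := hy i
  have h4 := le_of_mem_closure_unitCell hy' i
  -- With y i in (0,1) and y' i in [0,1], the integer `idx L x i - ξ i` lies strictly between -1 and
  -- 1.
  have h5 : ((idx L x i - ξ i : ℤ) : ℝ) < 1 := by push_cast; linarith
  have h6 : (-1 : ℝ) < ((idx L x i - ξ i : ℤ) : ℝ) := by push_cast; linarith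
  have h7 : idx L x i - ξ i < 1 := by exact_mod_cast h5
  have h8 : -1 < idx L x i - ξ i := by exact_mod_cast h6
  omega

lemma norm_tile_sub_le (x : Eu d) {y : Eu d} (hy : y ∈ unitCell d) :
    ‖tile L (idx L x) y - x‖ ≤ ‖(L : Eu d →L[ℝ] Eu d)‖ * (2 * √d) := by
  have e : tile L (idx L x) y - x = L (y - frac (L.symm x)) := by
    conv_lhs => rw [← congrArg (tile L (idx L x) y - ·) (tile_idx_frac L x)]
    simp only [tile]
    rw [← map_sub, add_sub_add_right_eq_sub]
  rw [e]
  refine ((L : Eu d →L[ℝ] Eu d).le_opNorm _).trans ?_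
  gcongr
  have h1 := norm_le_of_mem_unitCell hy
  have h2 : ‖frac (L.symm x)‖ ≤ √d := norm_sub_latt_fl_le _
  exact (norm_sub_le _ _).trans (by linarith)

/-- A point lies within ‖L‖ · 2√d of every point of its cell. Hence around x there is a smaller ball
all of whose points have their cell inside V. -/
lemma mem_hat_of_ball_subset {V : Set (Eu d)} {x : Eu d} {R : ℝ}
    (hR : ‖(L : Eu d →L[ℝ] Eu d)‖ * (2 * √d) < R) (hx : Metric.ball x R ⊆ V) : x ∈ hat L V := by
  rw [hat, mem_interior]
  refine ⟨Metric.ball x (R - ‖(L : Eu d →L[ℝ] Eu d)‖ * (2 * √d)), fun z hz => ?_,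
    Metric.isOpen_ball, Metric.mem_ball_self (by linarith)⟩
  refine mem_iUnion₂.2 ⟨idx L z, ?_, _, frac_mem_closure _, tile_idx_frac L z⟩
  rintro _ ⟨y, hy, rfl⟩
  refine hx ?_
  have h1 := norm_tile_sub_le L z hy
  rw [mem_ball_iff_norm] at hz ⊢
  have h2 := norm_add_le (tile L (idx L z) y - z) (z - x)
  rw [sub_add_sub_cancel] at h2
  linarith

lemma hat_subset_closure (V : Set (Eu d)) : hat L V ⊆ closure V := by
  intro x hx
  have h := image_closure_subset_closure_image (continuous_tile L (idx L x)) (s := unitCell d)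
  exact closure_mono (tile_idx_subset L hx) (h ⟨_, frac_mem_closure _, tile_idx_frac L x⟩)

lemma isOpen_hat (V : Set (Eu d)) : IsOpen (hat L V) := isOpen_interior

/-- A `hat` is only known to lie in the closure of its set, but openness of the two hats and of V
moves a common point first into V' and then into V ∩ V'. -/
lemma disjoint_hat {L' : Eu d ≃L[ℝ] Eu d} {V V' : Set (Eu d)} (hV : IsOpen V)
    (h : Disjoint V V') : Disjoint (hat L V) (hat L' V') := by
  refine Set.disjoint_left.2 fun x hx hx' => ?_
  obtain ⟨z, ⟨hz, hz'⟩, hzV⟩ := mem_closure_iff.1 (hat_subset_closure L V hx) _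
    ((isOpen_hat L V).inter (isOpen_hat L' V')) ⟨hx, hx'⟩
  obtain ⟨t, ht, htV⟩ := mem_closure_iff.1 (hat_subset_closure L' V' hz') _ hV hzV
  exact Set.disjoint_left.1 h ht htV

/-- The inner integral depends on x only through its cell. Integrating it over a cell of volume `jac
L` gives back the integral of f over that cell, and only cells contained in V occur. -/
lemma lintegral_hat_le {V : Set (Eu d)} (hV : MeasurableSet V) (f : Eu d → ℝ≥0∞) :
    ∫⁻ x in hat L V, ∫⁻ y in unitCell d, f (tile L (idx L x) y) ≤ ∫⁻ x in V, f x := by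
  have hY := (isOpen_unitCell (d := d)).measurableSet
  rw [← lintegral_indicator (isOpen_hat L V).measurableSet, ← lintegral_indicator hV,
    lintegral_eq_tsum_tile L, lintegral_eq_tsum_tile L]
  refine mul_le_mul' le_rfl (ENNReal.tsum_le_tsum fun ξ => ?_)
  calc ∫⁻ y in unitCell d, (hat L V).indicator
        (fun x => ∫⁻ y in unitCell d, f (tile L (idx L x) y)) (tile L ξ y)
      ≤ ∫⁻ _y in unitCell d, ∫⁻ y in unitCell d, V.indicator f (tile L ξ y) := by
        refine setLIntegral_mono' hY fun y' hy' => ?_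
        by_cases h : tile L ξ y' ∈ hat L V
        · rw [indicator_of_mem h, idx_tile L hy']
          have h2 := tile_idx_subset L h
          rw [idx_tile L hy'] at h2
          refine setLIntegral_mono' hY fun y hy => ?_
          rw [indicator_of_mem (h2 ⟨y, hy, rfl⟩)]
        · rw [indicator_of_notMem h]
          exact zero_le
    _ = _ := by rw [setLIntegral_const, volume_unitCell, mul_one]

end Cells

/-! ### The unfolding operator, its values in W^{1,p}(Y), and its norm bounds. -/

section Unfolding

variable {d N : ℕ} (L : Fin N → Eu d ≃L[ℝ] Eu d) (V : Fin N → Set (Eu d))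

/-- The unfolding of `ψ` with respect to the lattices `Lₙ ℤᵈ` in the sets `Vₙ`. -/
def unf {F : Type*} [AddCommMonoid F] (ψ : Eu d → F) (x y : Eu d) : F :=
  ∑ n, (hat (L n) (V n)).indicator (fun x => ψ (tile (L n) (idx (L n) x) y)) x

variable {L V}

lemma sum_indicator_hat_of_mem (hV : ∀ n, IsOpen (V n))
    (hd : Pairwise (Function.onFun Disjoint V)) {F : Type*} [AddCommMonoid F]
    (f : Fin N → Eu d → F) {x : Eu d} {n : Fin N} (hx : x ∈ hat (L n) (V n)) :
    ∑ m, (hat (L m) (V m)).indicator (f m) x = f n x := by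
  rw [Finset.sum_eq_single n, indicator_of_mem hx]
  · intro m _ hm
    exact indicator_of_notMem (fun h => Set.disjoint_left.1
      (disjoint_hat (L m) (L' := L n) (hV m) (hd hm)) h hx) _
  · simp

lemma sum_indicator_hat_of_notMem {F : Type*} [AddCommMonoid F]
    (f : Fin N → Eu d → F) {x : Eu d} (hx : ∀ n, x ∉ hat (L n) (V n)) :
    ∑ m, (hat (L m) (V m)).indicator (f m) x = 0 :=
  Finset.sum_eq_zero fun m _ => indicator_of_notMem (hx m) _

lemma lintegral_sum_hat_le (hV : ∀ n, IsOpen (V n)) (hd : Pairwise (Function.onFun Disjoint V))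
    {Ω : Set (Eu d)} (hΩ : ∀ n, V n ⊆ Ω) (f : Eu d → ℝ≥0∞) :
    ∫⁻ x, ∑ n, (hat (L n) (V n)).indicator
      (fun x => ∫⁻ y in unitCell d, f (tile (L n) (idx (L n) x) y)) x ≤ ∫⁻ x in Ω, f x := by
  rw [lintegral_finsetSum]
  · calc _ ≤ ∑ n, ∫⁻ x in V n, f x := by
          refine Finset.sum_le_sum fun n _ => ?_
          rw [lintegral_indicator (isOpen_hat _ _).measurableSet]
          exact lintegral_hat_le (L n) (hV n).measurableSet f
      _ = ∫⁻ x in ⋃ n, V n, f x := by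
          rw [lintegral_iUnion (fun n => (hV n).measurableSet) hd, tsum_fintype]
      _ ≤ _ := lintegral_mono_set (iUnion_subset hΩ)
  · intro n _
    refine Measurable.indicator ?_ (isOpen_hat _ _).measurableSet
    exact (Measurable.of_discrete
      (f := fun ξ => ∫⁻ y in unitCell d, f (tile (L n) ξ y))).comp (measurable_idx (L n))

lemma measurable_tile_idx (L : Eu d ≃L[ℝ] Eu d) :
    Measurable fun z : Eu d × Eu d => tile L (idx L z.1) z.2 := by
  refine L.continuous.measurable.comp (measurable_snd.add ?_)
  exact (Measurable.of_discrete (f := fun ξ : Fin d → ℤ => latt ξ)).comp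
    ((measurable_idx L).comp measurable_fst)

lemma stronglyMeasurable_unf {F : Type*} [NormedAddCommGroup F] {ψ : Eu d → F}
    (hψ : StronglyMeasurable ψ) : StronglyMeasurable fun z : Eu d × Eu d => unf L V ψ z.1 z.2 := by
  unfold unf
  refine Finset.stronglyMeasurable_fun_sum _ fun n _ => ?_
  exact (hψ.comp_measurable (measurable_tile_idx (L n))).indicator
    (measurable_fst (isOpen_hat (L n) (V n)).measurableSet)

variable {Ω : Set (Eu d)} {p : ℝ≥0∞} [Fact (1 ≤ p)]

open Classical in
/-- The unfolding of a function in `W^{1,p}(Ω)` as a function with values in `W^{1,p}(Y)`. -/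
def unfSobolev (L : Fin N → Eu d ≃L[ℝ] Eu d) (V : Fin N → Set (Eu d)) (w : sobolev Ω p)
    (x : Eu d) : sobolev (unitCell d) p :=
  ∑ n, (hat (L n) (V n)).indicator (fun x => if h : tile (L n) (idx (L n) x) '' unitCell d ⊆ Ω then
    cellElt w (L n) (idx (L n) x) h else 0) x

lemma unfSobolev_of_mem (hV : ∀ n, IsOpen (V n)) (hd : Pairwise (Function.onFun Disjoint V))
    (hΩ : ∀ n, V n ⊆ Ω) (w : sobolev Ω p) {x : Eu d} {n : Fin N} (hx : x ∈ hat (L n) (V n)) :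
    unfSobolev L V w x = cellElt w (L n) (idx (L n) x) ((tile_idx_subset _ hx).trans (hΩ n)) := by
  rw [unfSobolev, sum_indicator_hat_of_mem hV hd _ hx, dif_pos]

lemma unf_of_mem (hV : ∀ n, IsOpen (V n)) (hd : Pairwise (Function.onFun Disjoint V))
    {F : Type*} [AddCommMonoid F] (ψ : Eu d → F) {x : Eu d} {n : Fin N}
    (hx : x ∈ hat (L n) (V n)) (y : Eu d) :
    unf L V ψ x y = ψ (tile (L n) (idx (L n) x) y) :=
  sum_indicator_hat_of_mem hV hd (fun n x => ψ (tile (L n) (idx (L n) x) y)) hx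

lemma fn_unfSobolev (hV : ∀ n, IsOpen (V n)) (hd : Pairwise (Function.onFun Disjoint V))
    (hΩ : ∀ n, V n ⊆ Ω) (w : sobolev Ω p) (x : Eu d) :
    fn (unfSobolev L V w x) =ᵐ[volume.restrict (unitCell d)] unf L V (fn w) x := by
  by_cases hx : ∃ n, x ∈ hat (L n) (V n)
  · obtain ⟨n, hx⟩ := hx
    rw [unfSobolev_of_mem hV hd hΩ w hx]
    filter_upwards [fn_cellElt w (L n) (idx (L n) x) ((tile_idx_subset _ hx).trans (hΩ n))]
      with y hy
    rw [hy, unf_of_mem hV hd _ hx]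
  · push Not at hx
    rw [unfSobolev, sum_indicator_hat_of_notMem _ hx]
    refine (Lp.coeFn_zero _ _ _).trans (Eventually.of_forall fun y => ?_)
    rw [unf, sum_indicator_hat_of_notMem _ hx]
    rfl

lemma stronglyMeasurable_unfSobolev (w : sobolev Ω p) :
    StronglyMeasurable (unfSobolev L V w) := by
  unfold unfSobolev
  refine Finset.stronglyMeasurable_fun_sum _ fun n _ => ?_
  refine StronglyMeasurable.indicator ?_ (isOpen_hat _ _).measurableSet
  classical
  -- The point x enters only through its cell index, which ranges over a countable discrete set.
  have : StronglyMeasurable fun ξ : Fin d → ℤ => if h : tile (L n) ξ '' unitCell d ⊆ Ω then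
      cellElt w (L n) ξ h else 0 := StronglyMeasurable.of_discrete
  exact this.comp_measurable (measurable_idx (L n))

lemma enorm_sobolev_rpow_le {p : ℝ≥0∞} [Fact (1 ≤ p)] (hp : p ≠ ∞) (u : sobolev (unitCell d) p) :
    ‖u‖ₑ ^ p.toReal ≤ ∫⁻ y in unitCell d, (‖fn u y‖ₑ ^ p.toReal + ‖grad u y‖ₑ ^ p.toReal) := by
  have hp0 : p ≠ 0 := (zero_lt_one.trans_le (Fact.out : 1 ≤ p)).ne'
  rw [lintegral_add_left ((Lp.stronglyMeasurable (fn u)).enorm.pow_const _),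
    ← eLpNorm_rpow_toReal hp0 hp, ← eLpNorm_rpow_toReal hp0 hp, ← Lp.enorm_def, ← Lp.enorm_def]
  have h : ‖u‖ₑ = max ‖fn u‖ₑ ‖grad u‖ₑ := rfl
  rw [h]
  rcases max_cases ‖fn u‖ₑ ‖grad u‖ₑ with h | h
  · rw [h.1]; exact le_self_add
  · rw [h.1]; exact le_add_self

lemma enorm_cellElt_rpow_le (hp : p ≠ ∞) (w : sobolev Ω p) {L : Eu d ≃L[ℝ] Eu d} {M : ℝ}
    (hM : ‖(L : Eu d →L[ℝ] Eu d)‖ ≤ M) (ξ : Fin d → ℤ) (h : tile L ξ '' unitCell d ⊆ Ω) :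
    ‖cellElt w L ξ h‖ₑ ^ p.toReal ≤ ∫⁻ y in unitCell d, (‖fn w (tile L ξ y)‖ₑ ^ p.toReal +
      ENNReal.ofReal M ^ p.toReal * ‖grad w (tile L ξ y)‖ₑ ^ p.toReal) := by
  refine (enorm_sobolev_rpow_le hp _).trans (lintegral_mono_ae ?_)
  filter_upwards [fn_cellElt w L ξ h, grad_cellElt w L ξ h] with y h1 h2
  have h3 : ‖(L : Eu d →L[ℝ] Eu d).adjoint (grad w (tile L ξ y))‖ₑ ≤
      ENNReal.ofReal M * ‖grad w (tile L ξ y)‖ₑ := by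
    rw [← ofReal_norm, ← ofReal_norm, ← ENNReal.ofReal_mul' (norm_nonneg _)]
    refine ENNReal.ofReal_le_ofReal ((ContinuousLinearMap.le_opNorm _ _).trans ?_)
    rw [LinearIsometryEquiv.norm_map]
    exact mul_le_mul_of_nonneg_right hM (norm_nonneg _)
  rw [h1, h2, ← ENNReal.mul_rpow_of_nonneg _ _ ENNReal.toReal_nonneg]
  exact add_le_add le_rfl (ENNReal.rpow_le_rpow h3 ENNReal.toReal_nonneg)

/-- The factor M comes from the chain rule on the cells. It will be a multiple of ε, which is why
control of ε‖∇w‖ is enough. -/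
lemma lintegral_unfSobolev_le (hp : p ≠ ∞) (hV : ∀ n, IsOpen (V n))
    (hd : Pairwise (Function.onFun Disjoint V)) (hΩ : ∀ n, V n ⊆ Ω) (w : sobolev Ω p)
    {M : ℝ} (hM : ∀ n, ‖(L n : Eu d →L[ℝ] Eu d)‖ ≤ M) :
    ∫⁻ x, ‖unfSobolev L V w x‖ₑ ^ p.toReal ≤
      ‖fn w‖ₑ ^ p.toReal + ENNReal.ofReal M ^ p.toReal * ‖grad w‖ₑ ^ p.toReal := by
  have hp0 : p ≠ 0 := (zero_lt_one.trans_le (Fact.out : 1 ≤ p)).ne'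
  obtain ⟨f, hf⟩ : ∃ f : Eu d → ℝ≥0∞, ∀ z, f z = ‖fn w z‖ₑ ^ p.toReal +
      ENNReal.ofReal M ^ p.toReal * ‖grad w z‖ₑ ^ p.toReal := ⟨_, fun _ => rfl⟩
  have hfint : ∫⁻ x in Ω, f x =
      ‖fn w‖ₑ ^ p.toReal + ENNReal.ofReal M ^ p.toReal * ‖grad w‖ₑ ^ p.toReal := by
    simp only [hf]
    rw [lintegral_add_left ((Lp.stronglyMeasurable (fn w)).enorm.pow_const _),
      lintegral_const_mul _ ((Lp.stronglyMeasurable (grad w)).enorm.pow_const _),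
      Lp.enorm_def, Lp.enorm_def, eLpNorm_rpow_toReal hp0 hp, eLpNorm_rpow_toReal hp0 hp]
  rw [← hfint]
  refine (lintegral_mono fun x => ?_).trans (lintegral_sum_hat_le (L := L) hV hd hΩ f)
  by_cases hx : ∃ n, x ∈ hat (L n) (V n)
  · obtain ⟨n, hx⟩ := hx
    have hsub := (tile_idx_subset _ hx).trans (hΩ n)
    rw [unfSobolev_of_mem hV hd hΩ w hx, sum_indicator_hat_of_mem hV hd
      (fun n x => ∫⁻ y in unitCell d, f (tile (L n) (idx (L n) x) y)) hx]
    simp only [hf]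
    exact enorm_cellElt_rpow_le hp w (hM n) _ hsub
  · push Not at hx
    have h0 : ‖(0 : sobolev (unitCell d) p)‖ₑ = 0 := by
      rw [← ofReal_norm, norm_zero, ENNReal.ofReal_zero]
    rw [unfSobolev, sum_indicator_hat_of_notMem _ hx, h0,
      ENNReal.zero_rpow_of_pos (ENNReal.toReal_pos hp0 hp)]
    exact zero_le

lemma lintegral_unf_le (hp : p ≠ ∞) (hV : ∀ n, IsOpen (V n))
    (hd : Pairwise (Function.onFun Disjoint V)) (hΩ : ∀ n, V n ⊆ Ω) {F : Type*}
    [NormedAddCommGroup F] (ψ : Eu d → F) :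
    ∫⁻ x, ∫⁻ y in unitCell d, ‖unf L V ψ x y‖ₑ ^ p.toReal ≤ ∫⁻ x in Ω, ‖ψ x‖ₑ ^ p.toReal := by
  have hp0 : p ≠ 0 := (zero_lt_one.trans_le (Fact.out : 1 ≤ p)).ne'
  refine (lintegral_mono fun x => ?_).trans
    (lintegral_sum_hat_le (L := L) hV hd hΩ fun x => ‖ψ x‖ₑ ^ p.toReal)
  by_cases hx : ∃ n, x ∈ hat (L n) (V n)
  · obtain ⟨n, hx⟩ := hx
    rw [sum_indicator_hat_of_mem hV hd
      (fun n x => ∫⁻ y in unitCell d, ‖ψ (tile (L n) (idx (L n) x) y)‖ₑ ^ p.toReal) hx]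
    simp only [unf_of_mem hV hd _ hx, le_refl]
  · push Not at hx
    simp only [unf, sum_indicator_hat_of_notMem _ hx, enorm_zero,
      ENNReal.zero_rpow_of_pos (ENNReal.toReal_pos hp0 hp), lintegral_zero]
    exact zero_le

end Unfolding

/-! ### Translated weights, and errors that are small off a set of small measure. -/

section BoundaryLayer

variable {d : ℕ}

lemma isClosed_ball_subset (V : Set (Eu d)) (R : ℝ) : IsClosed {x | Metric.ball x R ⊆ V} := by
  rw [← isOpen_compl_iff]
  have : {x | Metric.ball x R ⊆ V}ᶜ = ⋃ z ∈ Vᶜ, Metric.ball z R := by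
    ext x
    simp only [mem_compl_iff, mem_ofPred_eq, Set.not_subset, mem_iUnion, exists_prop, Metric.mem_ball]
    constructor
    · rintro ⟨z, hz, hzV⟩
      exact ⟨z, hzV, by rwa [dist_comm]⟩
    · rintro ⟨z, hz, hzV⟩
      exact ⟨z, by rwa [dist_comm], hz⟩
  rw [this]
  exact isOpen_biUnion fun z _ => Metric.isOpen_ball

/-- If the translates of functions by `a n ζ` sum up to zero on `G n`, then so do their integrals
against the translates of a weight. -/
lemma sum_integral_indicator_translate {ι κ : Type*} [Fintype ι] {Ω : Set (Eu d)} {S : Finset κ}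
    {a : ι → κ → Eu d} {G : ι → Set (Eu d)} (hG : ∀ n, MeasurableSet (G n)) {b : κ → Eu d → ℝ}
    (hb : ∀ ζ ∈ S, IntegrableOn (b ζ) Ω) {η : Eu d → ℝ} (hη : Measurable η) {M : ℝ}
    (hM : ∀ x, ‖η x‖ ≤ M) (hGΩ : ∀ n, ∀ ζ ∈ S, ∀ x ∈ G n, x + a n ζ ∈ Ω)
    (h0 : ∀ n, ∀ x ∈ G n, ∑ ζ ∈ S, b ζ (x + a n ζ) = 0) :
    ∑ ζ ∈ S, ∫ x in Ω, (∑ n, (G n).indicator η (x - a n ζ)) * b ζ x = 0 := by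
  have hint : ∀ n, ∀ ζ ∈ S, IntegrableOn (fun x => (G n).indicator η (x - a n ζ) * b ζ x) Ω := by
    intro n ζ hζ
    refine Integrable.bdd_mul (c := M) (hb ζ hζ) ?_ (Eventually.of_forall fun x => ?_)
    · exact ((hη.indicator (hG n)).comp (measurable_sub_const _)).aestronglyMeasurable
    · exact (norm_indicator_le_norm_self _ _).trans (hM _)
  have hz : ∀ n, ∀ ζ ∈ S, ∀ x ∉ Ω, (G n).indicator η (x - a n ζ) * b ζ x = 0 := by
    intro n ζ hζ x hx
    rw [indicator_of_notMem, zero_mul]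
    intro h
    have := hGΩ n ζ hζ _ h
    rw [sub_add_cancel] at this
    exact hx this
  have hint' : ∀ n, ∀ ζ ∈ S, Integrable fun x => (G n).indicator η (x - a n ζ) * b ζ x :=
    fun n ζ hζ => (integrableOn_iff_integrable_of_support_subset fun x hx => by
      by_contra h; exact hx (hz n ζ hζ x h)).1 (hint n ζ hζ)
  have hint2 : ∀ n, ∀ ζ ∈ S, Integrable fun x => (G n).indicator η x * b ζ (x + a n ζ) := by
    intro n ζ hζ
    simpa using (hint' n ζ hζ).comp_add_right (a n ζ)
  have e1 : ∀ ζ ∈ S, ∫ x in Ω, (∑ n, (G n).indicator η (x - a n ζ)) * b ζ x =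
      ∑ n, ∫ x, (G n).indicator η x * b ζ (x + a n ζ) := by
    intro ζ hζ
    simp only [Finset.sum_mul]
    rw [integral_finsetSum _ fun n _ => hint n ζ hζ]
    refine Finset.sum_congr rfl fun n _ => ?_
    rw [setIntegral_eq_integral_of_forall_compl_eq_zero (hz n ζ hζ),
      ← integral_add_right_eq_self _ (a n ζ)]
    simp
  -- Once each integral is translated by `a n ζ`, all terms with the same n carry the same weight,
  -- and the sum over ζ vanishes pointwise on `G n`.
  rw [Finset.sum_congr rfl e1, Finset.sum_comm]
  refine Finset.sum_eq_zero fun n _ => ?_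
  rw [← integral_finsetSum _ fun ζ hζ => hint2 n ζ hζ]
  simp only [← Finset.mul_sum]
  refine integral_eq_zero_of_ae (Eventually.of_forall fun x => ?_)
  by_cases hx : x ∈ G n
  · simp [h0 n x hx]
  · simp [hx]

/-- The norm is at most that of the constant δ plus that of |M| on `B k`; the latter involves a
positive power of the measure of `B k` because q < ∞. -/
lemma tendsto_eLpNorm_of_small_off {α : Type*} [MeasurableSpace α] {μ : Measure α}
    [IsFiniteMeasure μ] {q : ℝ≥0∞} (hq1 : 1 ≤ q) (hq : q ≠ ∞) {f : ℕ → α → ℝ} {M : ℝ}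
    (hM : ∀ k x, |f k x| ≤ M) {B : ℕ → Set α} (hB : Tendsto (fun k => μ (B k)) atTop (𝓝 0))
    (hδ : ∀ δ > 0, ∀ᶠ k in atTop, ∀ x ∉ B k, |f k x| ≤ δ) :
    Tendsto (fun k => eLpNorm (f k) q μ) atTop (𝓝 0) := by
  have hq0 : q ≠ 0 := (zero_lt_one.trans_le hq1).ne'
  have hQ : 0 < q.toReal := ENNReal.toReal_pos hq0 hq
  have hle : ∀ δ > 0, ∀ᶠ k in atTop, eLpNorm (f k) q μ ≤
      ENNReal.ofReal δ * μ univ ^ (1 / q.toReal) +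
        ENNReal.ofReal |M| * μ (B k) ^ (1 / q.toReal) := by
    intro δ hδ0
    filter_upwards [hδ δ hδ0] with k hk
    -- `B k` need not be measurable; its measurable hull has the same measure.
    set B' := toMeasurable μ (B k) with hB'
    have h1 : eLpNorm (f k) q μ ≤
        eLpNorm ((fun _ => δ) + B'.indicator fun _ => |M|) q μ := by
      refine eLpNorm_mono_real fun x => ?_
      rw [Real.norm_eq_abs, Pi.add_apply]
      by_cases hx : x ∈ B'
      · rw [indicator_of_mem hx]
        linarith [hM k x, le_abs_self M]
      · rw [indicator_of_notMem hx, add_zero]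
        exact hk x fun h => hx (subset_toMeasurable _ _ h)
    refine h1.trans ((eLpNorm_add_le (by fun_prop) ?_ hq1).trans (add_le_add ?_ ?_))
    · exact (measurable_const.indicator (measurableSet_toMeasurable _ _)).aestronglyMeasurable
    · rw [eLpNorm_const' _ hq0 hq, Real.enorm_eq_ofReal hδ0.le]
    · rw [eLpNorm_indicator_const (measurableSet_toMeasurable _ _) hq0 hq,
        Real.enorm_eq_ofReal (abs_nonneg M), measure_toMeasurable]
  have hlim : Tendsto (fun k => ENNReal.ofReal |M| * μ (B k) ^ (1 / q.toReal)) atTop (𝓝 0) := by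
    have h1 := hB.ennrpow_const (1 / q.toReal)
    rw [ENNReal.zero_rpow_of_pos (by positivity)] at h1
    simpa using ENNReal.Tendsto.const_mul h1 (Or.inr ENNReal.ofReal_ne_top)
  have hC : μ univ ^ (1 / q.toReal) ≠ ∞ :=
    ENNReal.rpow_ne_top_of_nonneg (by positivity) (measure_ne_top _ _)
  have hlim2 : Tendsto (fun δ : ℝ => ENNReal.ofReal δ * μ univ ^ (1 / q.toReal)) (𝓝[>] 0)
      (𝓝 0) := by
    have h1 : Tendsto (fun δ : ℝ => ENNReal.ofReal δ) (𝓝[>] 0) (𝓝 0) := by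
      simpa using (ENNReal.continuous_ofReal.tendsto 0).mono_left nhdsWithin_le_nhds
    simpa using ENNReal.Tendsto.mul_const h1 (Or.inr hC)
  rw [ENNReal.tendsto_nhds_zero]
  intro e he
  have he2 : 0 < e / 2 := ENNReal.half_pos he.ne'
  obtain ⟨δ, hδ1, hδ2⟩ := (((ENNReal.tendsto_nhds_zero.1 hlim2) _ he2).and
    self_mem_nhdsWithin).exists
  filter_upwards [hle δ hδ2, (ENNReal.tendsto_nhds_zero.1 hlim) _ he2] with k h1 h2
  calc _ ≤ _ := h1
    _ ≤ e / 2 + e / 2 := add_le_add hδ1 h2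
    _ = e := ENNReal.add_halves e

/-- Hölder's inequality: p > 1 makes the conjugate exponent finite, so f tends to 0 in L^q against a
bounded sequence in L^p. -/
lemma tendsto_integral_mul_of_bounded {α : Type*} [MeasurableSpace α] {μ : Measure α}
    [IsFiniteMeasure μ] {p : ℝ≥0∞} [Fact (1 ≤ p)] (hp1 : 1 < p) {f : ℕ → α → ℝ} {M : ℝ}
    (hf : ∀ k, AEStronglyMeasurable (f k) μ)
    (hM : ∀ k x, |f k x| ≤ M) {B : ℕ → Set α} (hB : Tendsto (fun k => μ (B k)) atTop (𝓝 0))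
    (hδ : ∀ δ > 0, ∀ᶠ k in atTop, ∀ x ∉ B k, |f k x| ≤ δ) {b : ℕ → Lp ℝ p μ} {C : ℝ}
    (hb : ∀ k, ‖b k‖ ≤ C) : Tendsto (fun k => ∫ x, f k x * b k x ∂μ) atTop (𝓝 0) := by
  set q := p.conjExponent with hqdef
  have hpq : p.HolderConjugate q := ENNReal.HolderConjugate.conjExponent hp1.le
  have hqp : q.HolderConjugate p := hpq.symm
  have hq : q ≠ ∞ := ((ENNReal.HolderConjugate.lt_top_iff_one_lt q p).2 hp1).ne
  have hq1 : Fact (1 ≤ q) := ⟨ENNReal.HolderConjugate.one_le q p⟩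
  have hmem : ∀ k, MemLp (f k) q μ := fun k =>
    MemLp.of_bound (hf k) M (Eventually.of_forall (hM k))
  have h1 := tendsto_eLpNorm_of_small_off hq1.out hq hM hB hδ
  have h2 : Tendsto (fun k => ‖(hmem k).toLp (f k)‖) atTop (𝓝 0) := by
    simp only [Lp.norm_toLp]
    simpa [Function.comp_def] using (ENNReal.tendsto_toReal ENNReal.zero_ne_top).comp h1
  set Φ := (ContinuousLinearMap.mul ℝ ℝ).lpPairing μ q p with hΦ
  have h3 : ∀ k, ∫ x, f k x * b k x ∂μ = Φ ((hmem k).toLp (f k)) (b k) := by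
    intro k
    rw [hΦ, ContinuousLinearMap.lpPairing_eq_integral]
    refine integral_congr_ae ?_
    filter_upwards [(hmem k).coeFn_toLp] with x hx
    rw [hx]
    rfl
  simp only [h3]
  refine squeeze_zero_norm (a := fun k => ‖Φ‖ * ‖(hmem k).toLp (f k)‖ * C) (fun k => ?_) ?_
  · refine (Φ.le_opNorm₂ _ _).trans ?_
    gcongr
    exact hb k
  · simpa using (h2.const_mul ‖Φ‖).mul_const C

end BoundaryLayer

/-! ### Periodicity of the weak limits. -/

section Periodicity

variable {d : ℕ} {Ω : Set (Eu d)} {p : ℝ≥0∞} [Fact (1 ≤ p)]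

/-- The periodicity defects of an unfolded function around a point well inside `V n` cancel. -/
lemma sum_cellPairing_unfSobolev {N : ℕ} {L : Fin N → Eu d ≃L[ℝ] Eu d} {V : Fin N → Set (Eu d)}
    (hV : ∀ n, IsOpen (V n)) (hd : Pairwise (Function.onFun Disjoint V)) (hΩ : ∀ n, V n ⊆ Ω)
    (w : sobolev Ω p) {m K : ℝ} (hm : 0 < m) (hL : ∀ n, ‖(L n : Eu d →L[ℝ] Eu d)‖ ≤ m)
    {φ : Eu d → ℝ} (h1 : ContDiff ℝ (⊤ : ℕ∞) φ) (h2 : HasCompactSupport φ) (v : Eu d)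
    {S : Finset (Fin d → ℤ)} (hS : ∀ ζ ∉ S, ∀ y ∈ unitCell d, y + latt ζ ∉ tsupport φ)
    (hK : ∀ ζ ∈ S, ‖latt ζ‖ + 2 * √d < K) (hK' : ∀ z ∈ tsupport φ, ‖z‖ + √d < K) (n : Fin N)
    {x : Eu d} (hx : Metric.ball x (K * m) ⊆ V n) :
    ∑ ζ ∈ S, cellPairing φ v ζ (unfSobolev L V w (x + L n (latt ζ))) = 0 := by
  have hLn : ∀ z, ‖L n z‖ ≤ m * ‖z‖ := fun z =>
    ((L n : Eu d →L[ℝ] Eu d).le_opNorm z).trans (by gcongr; exact hL n)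
  refine sum_cellPairing_cellElt w (L n) (idx (L n) x) h1 h2 ?_ v hS _ fun ζ hζ => ?_
  -- The image of the support of φ around the cell of x stays within K m of x, because ‖z‖ + √d < K.
  · intro z hz
    refine hΩ n (hx ?_)
    have e : tile (L n) (idx (L n) x) z - x = L n (z - frac ((L n).symm x)) := by
      conv_lhs => rw [← congrArg (tile (L n) (idx (L n) x) z - ·) (tile_idx_frac (L n) x)]
      simp only [tile]
      rw [← map_sub, add_sub_add_right_eq_sub]
    rw [mem_ball_iff_norm, e]
    have h3 : ‖frac ((L n).symm x)‖ ≤ √d := norm_sub_latt_fl_le _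
    have h4 := norm_sub_le z (frac ((L n).symm x))
    have h5 := hK' z hz
    nlinarith [hLn (z - frac ((L n).symm x))]
  -- After a shift by L ζ the remaining radius still exceeds 2√d m, which is the margin required by
  -- `mem_hat_of_ball_subset`.
  · have hball : Metric.ball (x + L n (latt ζ)) ((K - ‖latt ζ‖) * m) ⊆ V n := by
      refine (Metric.ball_subset_ball' ?_).trans hx
      rw [dist_eq_norm, add_sub_cancel_left]
      nlinarith [hLn (latt ζ)]
    have hmem : x + L n (latt ζ) ∈ hat (L n) (V n) := by
      refine mem_hat_of_ball_subset (L n) ?_ hball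
      have h3 := hK ζ hζ
      have h4 : ‖(L n : Eu d →L[ℝ] Eu d)‖ * (2 * √d) ≤ m * (2 * √d) := by
        gcongr
        exact hL n
      nlinarith
    have hsub := (tile_idx_subset _ hmem).trans (hΩ n)
    rw [idx_add] at hsub
    refine ⟨hsub, ?_⟩
    rw [unfSobolev_of_mem hV hd hΩ w hmem]
    congr 1
    exact idx_add (L n) x ζ

variable {N : ℕ → ℕ} {L : ∀ k, Fin (N k) → Eu d ≃L[ℝ] Eu d} {V : ∀ k, Fin (N k) → Set (Eu d)}

/-- If the values of `T ζ ∘ U k` at the translates by `a k n ζ`, which are of order `m k`, cancel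
well inside `V k n`, and if the rest of `Ω` has small measure, then the sum of the `T ζ ∘ U k` tends
to zero in the sense of distributions. -/
lemma tendsto_sum_integral_of_cancellation [IsFiniteMeasure (volume.restrict Ω)] (hp1 : 1 < p)
    {W κ : Type*} [NormedAddCommGroup W] [NormedSpace ℝ W] (T : κ → W →L[ℝ] ℝ) (S : Finset κ)
    (hd : ∀ k, Pairwise (Function.onFun Disjoint (V k))) (hΩ : ∀ k n, V k n ⊆ Ω)
    {m : ℕ → ℝ} (hm0 : Tendsto m atTop (𝓝 0))
    {a : ∀ k, Fin (N k) → κ → Eu d} {K : ℝ} (hshift : ∀ k n, ∀ ζ ∈ S, ‖a k n ζ‖ < K * m k)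
    (hlayer : ∀ (K : ℝ) (Q : Set (Eu d)), IsCompact Q → Q ⊆ Ω → Tendsto (fun k =>
      volume {x | x ∈ Q ∧ ∀ n, ¬ Metric.ball x (K * m k) ⊆ V k n}) atTop (𝓝 0))
    {U : ℕ → Eu d → W} (hcancel : ∀ k n x, Metric.ball x (K * m k) ⊆ V k n →
      ∑ ζ ∈ S, T ζ (U k (x + a k n ζ)) = 0)
    {u : ℕ → Lp W p (volume.restrict Ω)} (hu : ∀ k, u k =ᵐ[volume.restrict Ω] U k) {C : ℝ}
    (hC : ∀ k, ‖u k‖ ≤ C) {η : Eu d → ℝ} (hη : Continuous η) (hηc : HasCompactSupport η)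
    (hηΩ : tsupport η ⊆ Ω) :
    Tendsto (fun k => ∑ ζ ∈ S, ∫ x in Ω, η x * T ζ (u k x)) atTop (𝓝 0) := by
  obtain ⟨M, hM⟩ := hηc.exists_bound_of_continuous hη
  have hM0 : 0 ≤ M := (norm_nonneg _).trans (hM 0)
  -- The points of `V k n` deep enough for the cancellation to hold.
  let G : ∀ k, Fin (N k) → Set (Eu d) := fun k n => {x | Metric.ball x (K * m k) ⊆ V k n}
  have hGm : ∀ k n, MeasurableSet (G k n) := fun k n => (isClosed_ball_subset _ _).measurableSet
  let b : ℕ → κ → Eu d → ℝ := fun k ζ x => T ζ (U k x)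
  have hbu : ∀ k ζ, (T ζ).compLp (u k) =ᵐ[volume.restrict Ω] b k ζ := by
    intro k ζ
    filter_upwards [(T ζ).coeFn_compLp (u k), hu k] with x hx1 hx2
    rw [hx1, hx2]
  have hbi : ∀ k ζ, IntegrableOn (b k ζ) Ω := fun k ζ =>
    (((Lp.memLp ((T ζ).compLp (u k))).integrable Fact.out).congr (hbu k ζ))
  have hGV : ∀ k n, ∀ ζ ∈ S, ∀ x ∈ G k n, x + a k n ζ ∈ V k n := by
    intro k n ζ hζ x hx
    refine hx ?_
    rw [mem_ball_iff_norm, add_sub_cancel_left]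
    exact hshift k n ζ hζ
  have hzero : ∀ k, ∑ ζ ∈ S, ∫ x in Ω,
      (∑ n, (G k n).indicator η (x - a k n ζ)) * b k ζ x = 0 := by
    intro k
    refine sum_integral_indicator_translate (a := a k) (hGm k)
      (fun ζ _ => hbi k ζ) hη.measurable hM (fun n ζ hζ x hx => hΩ k n (hGV k n ζ hζ x hx)) ?_
    intro n x hx
    exact hcancel k n x hx
  -- The error made when η is replaced by the translates of its restrictions to the sets `G k n`;
  -- for those weights the sum is exactly zero by `hzero`.
  let f : κ → ℕ → Eu d → ℝ := fun ζ k x => η x - ∑ n, (G k n).indicator η (x - a k n ζ)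
  have hfm : ∀ ζ k, Measurable (f ζ k) := by
    intro ζ k
    refine hη.measurable.sub (Finset.measurable_sum _ fun n _ => ?_)
    exact (hη.measurable.indicator (hGm k n)).comp (measurable_sub_const _)
  -- The shifts depend on n, but x - a ∈ `G k n` forces x ∈ `V k n`, and these sets are disjoint; so
  -- at most one n contributes.
  have hone : ∀ ζ ∈ S, ∀ k x, ∀ n, x - a k n ζ ∈ G k n →
      ∑ n, (G k n).indicator η (x - a k n ζ) = η (x - a k n ζ) := by
    intro ζ hζ k x n hn
    rw [Finset.sum_eq_single n, indicator_of_mem hn]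
    · intro n' _ hn'
      refine indicator_of_notMem (fun h => ?_) _
      have h3 := hGV k n ζ hζ _ hn
      have h4 := hGV k n' ζ hζ _ h
      rw [sub_add_cancel] at h3 h4
      exact Set.disjoint_left.1 (hd k hn') h4 h3
    · simp
  have hnone : ∀ ζ k x, (∀ n, x - a k n ζ ∉ G k n) →
      ∑ n, (G k n).indicator η (x - a k n ζ) = 0 := fun ζ k x h =>
    Finset.sum_eq_zero fun n _ => indicator_of_notMem (h n) _
  have hfM : ∀ ζ ∈ S, ∀ k x, |f ζ k x| ≤ 2 * M := by
    intro ζ hζ k x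
    have h3 : ‖η x‖ ≤ M := hM x
    rw [Real.norm_eq_abs] at h3
    by_cases hx : ∃ n, x - a k n ζ ∈ G k n
    · obtain ⟨n, hn⟩ := hx
      simp only [f, hone ζ hζ k x n hn]
      have h4 : ‖η (x - a k n ζ)‖ ≤ M := hM _
      rw [Real.norm_eq_abs] at h4
      exact (abs_sub _ _).trans (by linarith)
    · push Not at hx
      simp only [f, hnone ζ k x hx, sub_zero]
      linarith
  -- The margin is doubled: if x has margin 2K m, then x - a has margin K m. Outside `B` either one
  -- translate is active and uniform continuity of η applies, or η x = 0 and so is the error.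
  let B : ℕ → Set (Eu d) := fun k =>
    {x | x ∈ tsupport η ∧ ∀ n, ¬ Metric.ball x (2 * K * m k) ⊆ V k n}
  have hBlim : Tendsto (fun k => (volume.restrict Ω) (B k)) atTop (𝓝 0) :=
    tendsto_of_tendsto_of_tendsto_of_le_of_le tendsto_const_nhds
      (hlayer (2 * K) (tsupport η) hηc hηΩ) (fun _ => zero_le)
      fun k => Measure.restrict_apply_le _ _
  have hδ : ∀ ζ ∈ S, ∀ δ > 0, ∀ᶠ k in atTop, ∀ x ∉ B k, |f ζ k x| ≤ δ := by
    intro ζ hζ δ hδ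
    have huc : UniformContinuous η := hηc.uniformContinuous_of_continuous hη
    obtain ⟨r, hr, hηr⟩ := Metric.uniformContinuous_iff.1 huc δ hδ
    have hlim : Tendsto (fun k => K * m k) atTop (𝓝 0) := by simpa using hm0.const_mul K
    filter_upwards [hlim.eventually_lt_const hr] with k hk x hx
    by_cases hx' : ∃ n, x - a k n ζ ∈ G k n
    · obtain ⟨n, hn⟩ := hx'
      simp only [f, hone ζ hζ k x n hn]
      have h4 := hηr (a := x) (b := x - a k n ζ) (by
        rw [dist_eq_norm, sub_sub_cancel]
        exact (hshift k n ζ hζ).trans hk)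
      exact h4.le
    · push Not at hx'
      simp only [f, hnone ζ k x hx', sub_zero]
      by_cases hxη : x ∈ tsupport η
      · exfalso
        refine hx ⟨hxη, fun n hn => hx' n ?_⟩
        refine (Metric.ball_subset_ball' ?_).trans hn
        rw [dist_eq_norm, sub_sub_cancel_left, norm_neg]
        linarith [hshift k n ζ hζ]
      · rw [image_eq_zero_of_notMem_tsupport hxη, abs_zero]
        exact hδ.le
  have hterm : ∀ ζ ∈ S, Tendsto (fun k => ∫ x in Ω, f ζ k x * (T ζ).compLp (u k) x) atTop
      (𝓝 0) := by
    intro ζ hζ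
    refine tendsto_integral_mul_of_bounded hp1 (fun k => (hfm ζ k).aestronglyMeasurable)
      (hfM ζ hζ) hBlim (hδ ζ hζ) (C := ‖T ζ‖ * C) fun k => ?_
    refine ((T ζ).norm_compLp_le (u k)).trans ?_
    gcongr
    exact hC k
  have hsum := tendsto_finsetSum S hterm
  rw [Finset.sum_const_zero] at hsum
  refine hsum.congr fun k => ?_
  rw [← sub_zero (∑ ζ ∈ S, ∫ x in Ω, η x * T ζ (u k x)), ← hzero k,
    ← Finset.sum_sub_distrib]
  refine Finset.sum_congr rfl fun ζ hζ => ?_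
  have e1 : ∫ x in Ω, η x * T ζ (u k x) = ∫ x in Ω, η x * b k ζ x := by
    refine integral_congr_ae ?_
    filter_upwards [hu k] with x hx
    rw [hx]
  have e2 : ∫ x in Ω, f ζ k x * (T ζ).compLp (u k) x = ∫ x in Ω, f ζ k x * b k ζ x := by
    refine integral_congr_ae ?_
    filter_upwards [hbu k ζ] with x hx
    rw [hx]
  have i1 : IntegrableOn (fun x => η x * b k ζ x) Ω :=
    Integrable.bdd_mul (c := M) (hbi k ζ) hη.aestronglyMeasurable (Eventually.of_forall hM)
  have i2 : IntegrableOn (fun x => f ζ k x * b k ζ x) Ω :=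
    Integrable.bdd_mul (c := 2 * M) (hbi k ζ) (hfm ζ k).aestronglyMeasurable
      (Eventually.of_forall (hfM ζ hζ k))
  rw [e1, e2, eq_sub_iff_add_eq, ← eq_sub_iff_add_eq', ← integral_sub i1 i2]
  refine integral_congr_ae (Eventually.of_forall fun x => ?_)
  simp only [f, b]
  ring

lemma exists_weighted_clm {α W κ : Type*} [MeasurableSpace α] {μ : Measure α} [IsFiniteMeasure μ]
    [NormedAddCommGroup W] [NormedSpace ℝ W] (T : κ → W →L[ℝ] ℝ) (S : Finset κ) {η : α → ℝ}
    (hη : AEStronglyMeasurable η μ) {M : ℝ} (hM : ∀ x, ‖η x‖ ≤ M) :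
    ∃ Ψ : Lp W p μ →L[ℝ] ℝ, ∀ a, Ψ a = ∑ ζ ∈ S, ∫ x, η x * T ζ (a x) ∂μ := by
  obtain ⟨P, hP⟩ := exists_integral_inner_clm (p := p) hη hM
  refine ⟨∑ ζ ∈ S, P.comp ((T ζ).compLpL p μ), fun a => ?_⟩
  rw [sum_apply]
  refine Finset.sum_congr rfl fun ζ _ => ?_
  rw [ContinuousLinearMap.comp_apply, hP]
  refine integral_congr_ae ?_
  filter_upwards [(T ζ).coeFn_compLpL a] with x hx
  rw [hx]
  rfl

lemma integrable_clm_comp {α W : Type*} [MeasurableSpace α] {μ : Measure α} [IsFiniteMeasure μ]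
    [NormedAddCommGroup W] [NormedSpace ℝ W] (T : W →L[ℝ] ℝ) (u : Lp W p μ) :
    Integrable (fun x => T (u x)) μ :=
  T.integrable_comp ((Lp.memLp u).integrable Fact.out)

/-- If the integrals of `∑ T ζ ∘ u k` against test functions tend to zero and `u k` tends weakly to
`u₀`, then `∑ T ζ ∘ u₀` vanishes. -/
lemma ae_sum_eq_zero_of_weakTendsto [IsFiniteMeasure (volume.restrict Ω)] (hΩo : IsOpen Ω)
    {W κ : Type*} [NormedAddCommGroup W] [NormedSpace ℝ W] (T : κ → W →L[ℝ] ℝ) (S : Finset κ)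
    {u : ℕ → Lp W p (volume.restrict Ω)} {u₀ : Lp W p (volume.restrict Ω)} (hu : WeakTendsto u u₀)
    (h : ∀ η : Eu d → ℝ, Continuous η → HasCompactSupport η → tsupport η ⊆ Ω →
      Tendsto (fun k => ∑ ζ ∈ S, ∫ x in Ω, η x * T ζ (u k x)) atTop (𝓝 0)) :
    ∀ᵐ x ∂volume.restrict Ω, ∑ ζ ∈ S, T ζ (u₀ x) = 0 := by
  have hint : ∀ ζ, IntegrableOn (fun x => T ζ (u₀ x)) Ω := fun ζ => integrable_clm_comp (T ζ) u₀
  rw [ae_restrict_iff' hΩo.measurableSet]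
  refine hΩo.ae_eq_zero_of_integral_contDiff_smul_eq_zero
    (IntegrableOn.locallyIntegrableOn (integrable_finsetSum _ fun ζ _ => hint ζ)) ?_
  intro η hη hηc hηΩ
  obtain ⟨M, hM⟩ := hηc.exists_bound_of_continuous hη.continuous
  obtain ⟨Ψ, hΨ⟩ := exists_weighted_clm (μ := volume.restrict Ω) (p := p) T S
    hη.continuous.aestronglyMeasurable hM
  have hlim := h η hη.continuous hηc hηΩ
  simp only [← hΨ] at hlim
  -- The weak limit and the cancellation give two limits of the same sequence; equating them for all
  -- η leaves the fundamental lemma of the calculus of variations.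
  have h0 := tendsto_nhds_unique (hu Ψ) hlim
  have hzero : ∀ x ∉ Ω, η x • ∑ ζ ∈ S, T ζ (u₀ x) = 0 := by
    intro x hx
    rw [image_eq_zero_of_notMem_tsupport fun h => hx (hηΩ h), zero_smul]
  rw [← setIntegral_eq_integral_of_forall_compl_eq_zero hzero, ← h0, hΨ]
  simp only [smul_eq_mul, Finset.mul_sum]
  refine integral_finsetSum _ fun ζ _ => ?_
  exact Integrable.bdd_mul (c := M) (hint ζ) hη.continuous.aestronglyMeasurable
    (Eventually.of_forall hM)

instance {U : Set (Eu d)} [Fact (p ≠ ∞)] : SecondCountableTopology (sobolev U p) := by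
  have h1 : SecondCountableTopology (Lp ℝ p ((volume : Measure (Eu d)).restrict U)) := inferInstance
  have h2 : SecondCountableTopology (Lp (Eu d) p ((volume : Measure (Eu d)).restrict U)) :=
    inferInstance
  have h3 : SecondCountableTopology (Lp ℝ p ((volume : Measure (Eu d)).restrict U) ×
      Lp (Eu d) p ((volume : Measure (Eu d)).restrict U)) :=
    @TopologicalSpace.instSecondCountableTopologyProd _ _ _ _ h1 h2
  exact (Topology.IsEmbedding.subtypeVal (p := fun x => x ∈ sobolev U p)).secondCountableTopology

/-- The exceptional null set depends on the test data, which are uncountable. Each violated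
condition defines an open subset of the second countable space W^{1,p}(Y), so countably many
conditions imply all the others. -/
lemma ae_mem_sobolevPer_of_forall [IsFiniteMeasure (volume.restrict Ω)] (hp : p ≠ ∞)
    {u : Eu d → sobolev (unitCell d) p}
    (h : ∀ φ : Eu d → ℝ, ContDiff ℝ (⊤ : ℕ∞) φ → HasCompactSupport φ → ∀ (v : Eu d)
      (S : Finset (Fin d → ℤ)), (∀ ζ ∉ S, ∀ y ∈ unitCell d, y + latt ζ ∉ tsupport φ) →
      ∀ᵐ x ∂volume.restrict Ω, ∑ ζ ∈ S, cellPairing φ v ζ (u x) = 0) :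
    ∀ᵐ x ∂volume.restrict Ω, u x ∈ sobolevPer d p := by
  have : Fact (p ≠ ∞) := ⟨hp⟩
  let I := {i : (Eu d → ℝ) × Eu d × Finset (Fin d → ℤ) // ContDiff ℝ (⊤ : ℕ∞) i.1 ∧
    HasCompactSupport i.1 ∧ ∀ ζ ∉ i.2.2, ∀ y ∈ unitCell d, y + latt ζ ∉ tsupport i.1}
  let O : I → Set (sobolev (unitCell d) p) := fun i =>
    {u | ∑ ζ ∈ i.1.2.2, cellPairing i.1.1 i.1.2.1 ζ u ≠ 0}
  have hO : ∀ i, IsOpen (O i) := by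
    intro i
    choose T hT using fun ζ => exists_cellPairing_clm (p := p) i.2.1 i.2.2.1 i.1.2.1 ζ
    simp only [O, ← hT]
    exact isOpen_ne_fun (continuous_finsetSum _ fun ζ _ => (T ζ).continuous) continuous_const
  obtain ⟨J, hJ, hJU⟩ := TopologicalSpace.isOpen_iUnion_countable O hO
  have hae : ∀ᵐ x ∂volume.restrict Ω, ∀ i ∈ J, u x ∉ O i := by
    rw [ae_ball_iff hJ]
    intro i _
    filter_upwards [h i.1.1 i.2.1 i.2.2.1 i.1.2.1 i.1.2.2 i.2.2.2] with x hx
    simpa [O] using hx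
  filter_upwards [hae] with x hx
  refine mem_sobolevPer_of_cellPairing fun φ h1 h2 v S hS => ?_
  by_contra hne
  have hmem : u x ∈ ⋃ i, O i := mem_iUnion.2 ⟨⟨(φ, v, S), h1, h2, hS⟩, hne⟩
  rw [← hJU] at hmem
  obtain ⟨i, hi, hxi⟩ := mem_iUnion₂.1 hmem
  exact hx i hi hxi

/-- The weak limits of the unfolded functions are periodic. -/
theorem ae_mem_sobolevPer_of_weakTendsto [IsFiniteMeasure (volume.restrict Ω)] (hΩo : IsOpen Ω)
    (hp1 : 1 < p) (hp : p ≠ ∞) (hV : ∀ k n, IsOpen (V k n))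
    (hd : ∀ k, Pairwise (Function.onFun Disjoint (V k))) (hΩ : ∀ k n, V k n ⊆ Ω)
    (w : ℕ → sobolev Ω p) {m : ℕ → ℝ} (hm : ∀ k, 0 < m k) (hm0 : Tendsto m atTop (𝓝 0))
    (hL : ∀ k n, ‖(L k n : Eu d →L[ℝ] Eu d)‖ ≤ m k)
    (hlayer : ∀ (K : ℝ) (Q : Set (Eu d)), IsCompact Q → Q ⊆ Ω → Tendsto (fun k =>
      volume {x | x ∈ Q ∧ ∀ n, ¬ Metric.ball x (K * m k) ⊆ V k n}) atTop (𝓝 0))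
    {u : ℕ → Lp (sobolev (unitCell d) p) p (volume.restrict Ω)}
    (hu : ∀ k, u k =ᵐ[volume.restrict Ω] unfSobolev (L k) (V k) (w k)) {C : ℝ}
    (hC : ∀ k, ‖u k‖ ≤ C) {u₀ : Lp (sobolev (unitCell d) p) p (volume.restrict Ω)}
    (hu₀ : WeakTendsto u u₀) : ∀ᵐ x ∂volume.restrict Ω, u₀ x ∈ sobolevPer d p := by
  refine ae_mem_sobolevPer_of_forall hp fun φ h1 h2 v S hS => ?_
  choose T hT using fun ζ => exists_cellPairing_clm (p := p) h1 h2 v ζ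
  -- K is chosen to dominate the relevant lattice shifts as well as the support of φ.
  obtain ⟨K, hK0, hKS, hKφ⟩ : ∃ K : ℝ, 0 < K ∧ (∀ ζ ∈ S, ‖latt ζ‖ + 2 * √d < K) ∧
      ∀ z ∈ tsupport φ, ‖z‖ + √d < K := by
    obtain ⟨R1, hR1⟩ := h2.isBounded.subset_closedBall 0
    obtain ⟨R2, hR2⟩ := (S.finite_toSet.image
      fun ζ : Fin d → ℤ => (latt ζ : Eu d)).isBounded.subset_closedBall 0
    refine ⟨max (R1 + √d) (max (R2 + 2 * √d) 0) + 1, by positivity, fun ζ hζ => ?_, fun z hz => ?_⟩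
    · have : ‖(latt ζ : Eu d)‖ ≤ R2 := by simpa using hR2 ⟨ζ, hζ, rfl⟩
      have h3 := le_max_left (R2 + 2 * √d) 0
      have h4 := le_max_right (R1 + √d) (max (R2 + 2 * √d) 0)
      linarith
    · have : ‖z‖ ≤ R1 := by simpa using hR1 hz
      have h4 := le_max_left (R1 + √d) (max (R2 + 2 * √d) 0)
      linarith
  have hzero := ae_sum_eq_zero_of_weakTendsto hΩo T S hu₀ fun η hη hηc hηΩ =>
    tendsto_sum_integral_of_cancellation hp1 T S hd hΩ hm0 (K := K)
      (a := fun k n ζ => L k n (latt ζ)) (U := fun k => unfSobolev (L k) (V k) (w k))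
      (fun k n ζ hζ => ?_) hlayer (fun k n x hx => ?_) hu hC hη hηc hηΩ
  · simpa only [hT] using hzero
  · have h3 := ((L k n : Eu d →L[ℝ] Eu d).le_opNorm (latt ζ)).trans
      (mul_le_mul_of_nonneg_right (hL k n) (norm_nonneg _))
    have h4 := hKS ζ hζ
    have h5 : 0 ≤ √(d : ℝ) := Real.sqrt_nonneg _
    refine h3.trans_lt ?_
    rw [mul_comm]
    exact mul_lt_mul_of_pos_right (by linarith) (hm k)
  · simp only [hT]
    exact sum_cellPairing_unfSobolev (hV k) (hd k) (hΩ k) (w k) (hm k) (hL k) h1 h2 v hS hKS hKφ n hx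

end Periodicity

/-! ### Matrices acting on ℝᵈ and the lattice maps ε A. -/

section Matrices

variable {d : ℕ}

lemma act_apply (A : Matrix (Fin d) (Fin d) ℝ) (y : Eu d) (i : Fin d) :
    act A y i = ∑ j, A i j * y j := rfl

lemma act_mul (A B : Matrix (Fin d) (Fin d) ℝ) (y : Eu d) : act (A * B) y = act A (act B y) := by
  ext i
  have h := congrFun (Matrix.mulVec_mulVec (y : Fin d → ℝ) A B) i
  exact h.symm

lemma act_one (y : Eu d) : act 1 y = y := by
  ext i
  simp [act_apply, Matrix.one_apply]

lemma act_sub (A B : Matrix (Fin d) (Fin d) ℝ) (y : Eu d) :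
    act (A - B) y = act A y - act B y := by
  ext i
  simp [act_apply, sub_mul]

lemma act_smul (A : Matrix (Fin d) (Fin d) ℝ) (c : ℝ) (y : Eu d) :
    act A (c • y) = c • act A y := by
  simp [act]

lemma inner_act (A : Matrix (Fin d) (Fin d) ℝ) (x y : Eu d) :
    inner ℝ (act Aᵀ x) y = inner ℝ x (act A y) := by
  simp only [PiLp.inner_apply, act_apply, Matrix.transpose_apply, RCLike.inner_apply, conj_trivial,
    Finset.mul_sum, Finset.sum_mul]
  rw [Finset.sum_comm]
  refine Finset.sum_congr rfl fun i _ => Finset.sum_congr rfl fun j _ => ?_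
  ring

lemma norm_act_le {A : Matrix (Fin d) (Fin d) ℝ} {c : ℝ} (hc : 0 ≤ c) (hA : ∀ i j, |A i j| ≤ c)
    (y : Eu d) : ‖act A y‖ ≤ √d * (d * c) * ‖y‖ := by
  rw [mul_assoc]
  refine norm_le_of_abs_le (by positivity) fun i => ?_
  rw [act_apply]
  calc |∑ j, A i j * y j| ≤ ∑ j, |A i j * y j| := Finset.abs_sum_le_sum_abs _ _
    _ ≤ ∑ _j : Fin d, c * ‖y‖ := by
        refine Finset.sum_le_sum fun j _ => ?_
        rw [abs_mul]
        gcongr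
        · exact hA i j
        · exact abs_apply_le_norm y j
    _ = d * c * ‖y‖ := by simp [mul_assoc]

lemma act_inv_act {A : Matrix (Fin d) (Fin d) ℝ} (hA : IsUnit A) (y : Eu d) :
    act A⁻¹ (act A y) = y := by
  rw [← act_mul, Matrix.nonsing_inv_mul _ ((Matrix.isUnit_iff_isUnit_det A).1 hA), act_one]

lemma act_act_inv {A : Matrix (Fin d) (Fin d) ℝ} (hA : IsUnit A) (y : Eu d) :
    act A (act A⁻¹ y) = y := by
  rw [← act_mul, Matrix.mul_nonsing_inv _ ((Matrix.isUnit_iff_isUnit_det A).1 hA), act_one]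

/-- The linear map `ε A` as an equivalence. -/
def scaleEquiv {A : Matrix (Fin d) (Fin d) ℝ} (hA : IsUnit A) {ε : ℝ} (hε : 0 < ε) :
    Eu d ≃L[ℝ] Eu d :=
  LinearEquiv.toContinuousLinearEquiv
    { toFun := fun y => ε • act A y
      invFun := fun x => ε⁻¹ • act A⁻¹ x
      map_add' := fun x y => by simp [act]
      map_smul' := fun c x => by simp [act, smul_comm c]
      left_inv := fun y => by
        simp only [act_smul, act_inv_act hA, smul_smul, inv_mul_cancel₀ hε.ne', one_smul]
      right_inv := fun y => by
        simp only [act_smul, act_act_inv hA, smul_smul, mul_inv_cancel₀ hε.ne', one_smul] }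

lemma adjoint_scaleEquiv {A : Matrix (Fin d) (Fin d) ℝ} (hA : IsUnit A) {ε : ℝ} (hε : 0 < ε)
    (y : Eu d) : (scaleEquiv hA hε : Eu d →L[ℝ] Eu d).adjoint y = ε • act Aᵀ y := by
  refine ext_inner_right ℝ fun z => ?_
  rw [ContinuousLinearMap.adjoint_inner_left, real_inner_smul_left, inner_act]
  change inner ℝ y (ε • act A z) = _
  rw [real_inner_smul_right]

lemma norm_scaleEquiv_le {A : Matrix (Fin d) (Fin d) ℝ} (hA : IsUnit A) {ε : ℝ} (hε : 0 < ε)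
    {c : ℝ} (hc : 0 ≤ c) (hAc : ∀ i j, |A i j| ≤ c) :
    ‖(scaleEquiv hA hε : Eu d →L[ℝ] Eu d)‖ ≤ √d * (d * c) * ε := by
  refine ContinuousLinearMap.opNorm_le_bound _ (by positivity) fun y => ?_
  change ‖ε • act A y‖ ≤ _
  rw [norm_smul, Real.norm_eq_abs, abs_of_pos hε]
  nlinarith [norm_act_le hc hAc y]

lemma IsLipMatrix.exists_bound {A : Eu d → Matrix (Fin d) (Fin d) ℝ} (hA : IsLipMatrix A)
    {Ω : Set (Eu d)} (hΩ : Bornology.IsBounded Ω) :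
    ∃ c : ℝ, 0 ≤ c ∧ ∀ x ∈ Ω, ∀ i j, |A x i j| ≤ c := by
  obtain ⟨L, hL⟩ := hA
  obtain ⟨R, hR⟩ := hΩ.subset_closedBall 0
  refine ⟨L * |R| + ∑ i, ∑ j, |A 0 i j|, by positivity, fun x hx i j => ?_⟩
  have h1 := (hL i j).dist_le_mul x 0
  have h2 : dist x 0 ≤ |R| := (hR hx).trans (le_abs_self R)
  have h3 : |A 0 i j| ≤ ∑ i, ∑ j, |A 0 i j| :=
    (Finset.single_le_sum (f := fun j => |A 0 i j|) (fun _ _ => abs_nonneg _)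
      (Finset.mem_univ j)).trans
      (Finset.single_le_sum (f := fun i => ∑ j, |A 0 i j|)
        (fun _ _ => Finset.sum_nonneg fun _ _ => abs_nonneg _) (Finset.mem_univ i))
  have h4 : |A x i j| ≤ |A x i j - A 0 i j| + |A 0 i j| := by
    have := abs_add_le (A x i j - A 0 i j) (A 0 i j)
    rwa [sub_add_cancel] at this
  rw [Real.dist_eq] at h1
  have h5 : (L : ℝ) * dist x 0 ≤ L * |R| := by gcongr
  linarith

end Matrices

/-! ### Volumes of cubes and of their boundary layers. -/

section Cubes

variable {d : ℕ}

lemma measurePreserving_affineIsometryEquiv (T : Eu d ≃ᵃⁱ[ℝ] Eu d) :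
    MeasurePreserving T volume volume := by
  have h : (T : Eu d → Eu d) = fun x => T.linearIsometryEquiv x + T 0 := by
    ext1 x
    have := T.map_vadd 0 x
    simpa using this
  rw [h]
  exact (measurePreserving_add_right volume (T 0)).comp T.linearIsometryEquiv.measurePreserving

lemma volume_image_affineIsometryEquiv (T : Eu d ≃ᵃⁱ[ℝ] Eu d) (A : Set (Eu d)) :
    volume (T '' A) = volume A := by
  have h := (measurePreserving_affineIsometryEquiv T).measure_preimage_emb
    T.toHomeomorph.measurableEmbedding (T '' A)
  rw [T.injective.preimage_image] at h
  exact h.symm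

lemma volume_Icc_box (a b : ℝ) : volume {y : Eu d | ∀ i, a ≤ y i ∧ y i ≤ b} =
    ENNReal.ofReal (b - a) ^ d := by
  have h := (EuclideanSpace.volume_preserving_symm_measurableEquiv_toLp (Fin d)).measure_preimage_equiv
    (Set.pi univ fun _ => Icc a b)
  rw [volume_pi_pi] at h
  simp only [Real.volume_Icc, Finset.prod_const, Finset.card_univ, Fintype.card_fin] at h
  rw [← h]
  congr 1
  ext y
  exact ⟨fun h i _ => h i, fun h i => h i (mem_univ i)⟩

lemma volume_Ioo_box (a b : ℝ) : volume {y : Eu d | ∀ i, a < y i ∧ y i < b} =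
    ENNReal.ofReal (b - a) ^ d := by
  have h := (EuclideanSpace.volume_preserving_symm_measurableEquiv_toLp (Fin d)).measure_preimage_equiv
    (Set.pi univ fun _ => Ioo a b)
  rw [volume_pi_pi] at h
  simp only [Real.volume_Ioo, Finset.prod_const, Finset.card_univ, Fintype.card_fin] at h
  rw [← h]
  congr 1
  ext y
  exact ⟨fun h i _ => h i, fun h i => h i (mem_univ i)⟩

lemma isClosed_box (a b : ℝ) : IsClosed {y : Eu d | ∀ i, a ≤ y i ∧ y i ≤ b} := by
  have : {y : Eu d | ∀ i, a ≤ y i ∧ y i ≤ b} = ⋂ i, {y : Eu d | y i ∈ Icc a b} := by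
    ext y; simp
  rw [this]
  exact isClosed_iInter fun i => isClosed_Icc.preimage (f := fun y : Eu d => y i) (by fun_prop)

lemma isOpen_box (a b : ℝ) : IsOpen {y : Eu d | ∀ i, a < y i ∧ y i < b} := by
  have : {y : Eu d | ∀ i, a < y i ∧ y i < b} = ⋂ i, {y : Eu d | y i ∈ Ioo a b} := by
    ext y; simp
  rw [this]
  exact isOpen_iInter_of_finite fun i =>
    isOpen_Ioo.preimage (f := fun y : Eu d => y i) (by fun_prop)

lemma IsOpenCube.isOpen {s : ℝ} {Q : Set (Eu d)} (hQ : IsOpenCube s Q) : IsOpen Q := by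
  obtain ⟨T, rfl⟩ := hQ
  exact T.toHomeomorph.isOpenMap _ (isOpen_box 0 s)

lemma IsOpenCube.volume_eq {s : ℝ} {Q : Set (Eu d)} (hQ : IsOpenCube s Q) :
    volume Q = ENNReal.ofReal s ^ d := by
  obtain ⟨T, rfl⟩ := hQ
  rw [volume_image_affineIsometryEquiv, volume_Ioo_box, sub_zero]

lemma closure_cube_subset (T : Eu d ≃ᵃⁱ[ℝ] Eu d) (s : ℝ) :
    closure (T '' {y | ∀ i, 0 < y i ∧ y i < s}) ⊆ T '' {y | ∀ i, 0 ≤ y i ∧ y i ≤ s} := by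
  refine closure_minimal (image_mono fun y hy i => ⟨(hy i).1.le, (hy i).2.le⟩) ?_
  exact T.toHomeomorph.isClosedMap _ (isClosed_box 0 s)

lemma IsOpenCube.dist_le {s : ℝ} (hs : 0 ≤ s) {Q : Set (Eu d)} (hQ : IsOpenCube s Q) {x y : Eu d}
    (hx : x ∈ closure Q) (hy : y ∈ closure Q) : dist x y ≤ √d * s := by
  obtain ⟨T, rfl⟩ := hQ
  obtain ⟨x', hx', rfl⟩ := closure_cube_subset T s hx
  obtain ⟨y', hy', rfl⟩ := closure_cube_subset T s hy
  rw [T.dist_map, dist_eq_norm]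
  refine norm_le_of_abs_le hs fun i => ?_
  rw [PiLp.sub_apply, abs_le]
  constructor <;> linarith [(hx' i).1, (hx' i).2, (hy' i).1, (hy' i).2]

/-- The volume of the boundary layer of width `a` of a cube. -/
lemma IsOpenCube.volume_layer_le {s : ℝ} {Q : Set (Eu d)} (hQ : IsOpenCube s Q) {a : ℝ}
    (ha : 0 ≤ a) (has : 2 * a ≤ s) :
    volume {x | x ∈ closure Q ∧ ¬ Metric.ball x a ⊆ Q} ≤
      ENNReal.ofReal s ^ d * ENNReal.ofReal (1 - (1 - 2 * a / s) ^ d) := by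
  obtain ⟨T, rfl⟩ := hQ
  -- In the coordinates of the cube the layer lies in [0,s]ᵈ minus [a,s-a]ᵈ, whose volume is sᵈ -
  -- (s-2a)ᵈ.
  have hsub : {x | x ∈ closure (T '' {y | ∀ i, 0 < y i ∧ y i < s}) ∧
      ¬ Metric.ball x a ⊆ T '' {y | ∀ i, 0 < y i ∧ y i < s}} ⊆
      T '' ({y | ∀ i, 0 ≤ y i ∧ y i ≤ s} \ {y | ∀ i, a ≤ y i ∧ y i ≤ s - a}) := by
    rintro x ⟨hx, hxa⟩
    obtain ⟨y, hy, rfl⟩ := closure_cube_subset T s hx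
    refine ⟨y, ⟨hy, fun hya => hxa fun z hz => ?_⟩, rfl⟩
    refine ⟨T.symm z, fun i => ?_, T.apply_symm_apply z⟩
    have h1 : dist (T.symm z) y < a := by
      rw [← T.dist_map, T.apply_symm_apply]
      exact hz
    have h2 := (abs_apply_le_norm (T.symm z - y) i).trans_lt (by rwa [← dist_eq_norm])
    rw [PiLp.sub_apply, abs_lt] at h2
    constructor <;> linarith [(hya i).1, (hya i).2, h2.1, h2.2]
  refine (measure_mono hsub).trans ?_
  rw [volume_image_affineIsometryEquiv, measure_sdiff _ (isClosed_box _ _).nullMeasurableSet,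
    volume_Icc_box, volume_Icc_box]
  · rcases (show 0 ≤ s by linarith).eq_or_lt with h0 | h0
    · have ha0 : a = 0 := by linarith
      simp [← h0, ha0]
    have e : s - a - a = s * (1 - 2 * a / s) := by field_simp; ring
    have ht : 0 ≤ 1 - 2 * a / s := by
      rw [sub_nonneg, div_le_one h0]
      exact has
    have e2 : ENNReal.ofReal (1 - (1 - 2 * a / s) ^ d) =
        1 - ENNReal.ofReal (1 - 2 * a / s) ^ d := by
      rw [ENNReal.ofReal_sub _ (by positivity), ENNReal.ofReal_one, ENNReal.ofReal_pow ht]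
    rw [e, e2, sub_zero, ENNReal.ofReal_mul h0.le, mul_pow,
      ENNReal.mul_sub (fun _ _ => by finiteness), mul_one]
  · rw [volume_Icc_box]
    finiteness
  · exact fun y hy i => ⟨ha.trans (hy i).1, (hy i).2.trans (by linarith)⟩

/-- The part of a compact subset of `Ω` near the boundaries of the cubes has small volume. -/
lemma tendsto_volume_layer {Ω : Set (Eu d)} (hΩ : Bornology.IsBounded Ω) (hΩo : IsOpen Ω) {r : ℝ}
    (hr0 : 0 < r) (hr1 : r < 1) {ε : ℕ → ℝ} (hε : ∀ k, 0 < ε k) (hε0 : Tendsto ε atTop (𝓝 0))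
    (𝒞 : ∀ k, CubeCovering Ω (ε k ^ r)) (M K : ℝ) {Q : Set (Eu d)} (hQ : IsCompact Q)
    (hQΩ : Q ⊆ Ω) : Tendsto (fun k => volume {x | x ∈ Q ∧ ∀ n,
      ¬ Metric.ball x (K * (M * ε k)) ⊆ (𝒞 k).cube n ∩ Ω}) atTop (𝓝 0) := by
  set K' : ℝ := |K * M| with hK'
  have hK0 : 0 ≤ K' := abs_nonneg _
  obtain ⟨δ, hδ, hδΩ⟩ := hQ.exists_cthickening_subset_open hΩo hQΩ
  -- Twice the layer width K'ε divided by the side ε^r of the cubes; it tends to 0 because r < 1.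
  set t : ℕ → ℝ := fun k => 2 * K' * ε k ^ (1 - r) with ht
  have hε' : Tendsto (fun k => ε k ^ (1 - r)) atTop (𝓝 0) := by
    have := hε0.rpow_const (p := 1 - r) (Or.inr (by linarith))
    rwa [Real.zero_rpow (by linarith)] at this
  have hs : Tendsto (fun k => ε k ^ r) atTop (𝓝 0) := by
    have := hε0.rpow_const (p := r) (Or.inr hr0.le)
    rwa [Real.zero_rpow hr0.ne'] at this
  have ht0 : Tendsto t atTop (𝓝 0) := by simpa using hε'.const_mul (2 * K')
  have ha0 : Tendsto (fun k => K' * ε k) atTop (𝓝 0) := by simpa using hε0.const_mul K'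
  -- Every cube contains a point of Ω and has diameter at most √d once its side is at most 1, so all
  -- cubes lie in this bounded set. This bounds their total volume without any bound on their
  -- number.
  set Vol := volume (Metric.cthickening (√d * 1) Ω) with hVol
  have hVolfin : Vol ≠ ∞ := hΩ.cthickening.measure_lt_top.ne
  have hlim : Tendsto (fun k => Vol * ENNReal.ofReal (1 - (1 - t k) ^ d)) atTop (𝓝 0) := by
    have h1 : Tendsto (fun k => 1 - (1 - t k) ^ d) atTop (𝓝 (1 - (1 - 0) ^ d)) :=
      ((ht0.const_sub 1).pow d).const_sub 1
    have h2 := ENNReal.tendsto_ofReal h1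
    simp only [sub_zero, one_pow, sub_self, ENNReal.ofReal_zero] at h2
    simpa using ENNReal.Tendsto.const_mul h2 (Or.inr hVolfin)
  refine tendsto_of_tendsto_of_tendsto_of_le_of_le' tendsto_const_nhds hlim
    (Eventually.of_forall fun _ => zero_le) ?_
  filter_upwards [ht0.eventually_lt_const one_pos, ha0.eventually_lt_const hδ,
    hs.eventually_lt_const one_pos] with k hk1 hk2 hk3
  have hs0 : 0 < ε k ^ r := Real.rpow_pos_of_pos (hε k) r
  have hta : t k = 2 * (K' * ε k) / ε k ^ r := by
    simp only [ht]
    rw [Real.rpow_sub (hε k), Real.rpow_one]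
    ring
  have has : 2 * (K' * ε k) ≤ ε k ^ r := by
    rw [hta, div_lt_one hs0] at hk1
    exact hk1.le
  have hsub : {x | x ∈ Q ∧ ∀ n, ¬ Metric.ball x (K * (M * ε k)) ⊆ (𝒞 k).cube n ∩ Ω} ⊆
      ⋃ n, {x | x ∈ closure ((𝒞 k).cube n) ∧ ¬ Metric.ball x (K' * ε k) ⊆ (𝒞 k).cube n} := by
    rintro x ⟨hx, hxn⟩
    -- For small ε the ball around a point of Q stays in Ω, as Q is compact; hence it can fail to
    -- lie in `cube n ∩ Ω` only by leaving the cube.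
    obtain ⟨n, hn⟩ := mem_iUnion.1 ((𝒞 k).cover (hQΩ hx))
    refine mem_iUnion.2 ⟨n, hn, fun hb => hxn n ?_⟩
    have hle : K * (M * ε k) ≤ K' * ε k := by
      rw [← mul_assoc]
      exact mul_le_mul_of_nonneg_right (le_abs_self _) (hε k).le
    refine (Metric.ball_subset_ball hle).trans (subset_inter hb ?_)
    refine Subset.trans ?_ hδΩ
    refine (Metric.ball_subset_closedBall.trans (Metric.closedBall_subset_closedBall hk2.le)).trans ?_
    exact Metric.closedBall_subset_cthickening hx δ
  have hsum : ∑ _n : Fin (𝒞 k).N, ENNReal.ofReal (ε k ^ r) ^ d ≤ Vol := by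
    calc ∑ _n : Fin (𝒞 k).N, ENNReal.ofReal (ε k ^ r) ^ d
        = ∑ n : Fin (𝒞 k).N, volume ((𝒞 k).cube n) :=
          Finset.sum_congr rfl fun n _ => ((𝒞 k).isCube n).volume_eq.symm
      _ = volume (⋃ n, (𝒞 k).cube n) := by
          rw [measure_iUnion (𝒞 k).disj fun n => ((𝒞 k).isCube n).isOpen.measurableSet, tsum_fintype]
      _ ≤ Vol := by
          refine measure_mono (iUnion_subset fun n x hx => ?_)
          refine Metric.mem_cthickening_of_dist_le x ((𝒞 k).pt n) _ Ω ((𝒞 k).pt_mem n).2 ?_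
          refine (((𝒞 k).isCube n).dist_le hs0.le (subset_closure hx)
            (subset_closure ((𝒞 k).pt_mem n).1)).trans ?_
          gcongr
  calc _ ≤ _ := measure_mono hsub
    _ ≤ ∑ n, volume {x | x ∈ closure ((𝒞 k).cube n) ∧
          ¬ Metric.ball x (K' * ε k) ⊆ (𝒞 k).cube n} := measure_iUnion_fintype_le _ _
    _ ≤ ∑ _n : Fin (𝒞 k).N, ENNReal.ofReal (ε k ^ r) ^ d * ENNReal.ofReal (1 - (1 - t k) ^ d) := by
        refine Finset.sum_le_sum fun n _ => ?_
        rw [hta]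
        exact ((𝒞 k).isCube n).volume_layer_le (mul_nonneg hK0 (hε k).le) has
    _ ≤ _ := by
        rw [← Finset.sum_mul]
        gcongr

end Cubes

/-! ### Weak compactness of L^p(Ω; W^{1,p}(Y)). -/

section WeakCompactnessBochner

lemma WeakSeqCompact.of_leftInverse {X Z : Type*} [NormedAddCommGroup X] [NormedSpace ℝ X]
    [NormedAddCommGroup Z] [NormedSpace ℝ Z] (hZ : WeakSeqCompact Z) (T : X →L[ℝ] Z)
    (S : Z →L[ℝ] X) (h : ∀ x, S (T x) = x) : WeakSeqCompact X := by
  intro u C hu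
  obtain ⟨φ, z, hφ, hz⟩ := hZ (fun k => T (u k)) (‖T‖ * C) fun k =>
    (T.le_opNorm _).trans (by gcongr; exact hu k)
  refine ⟨φ, S z, hφ, ?_⟩
  have := hz.map S
  simpa only [h] using this

variable {α β : Type*} {mα : MeasurableSpace α} {mβ : MeasurableSpace β} {μ : Measure α}
  {ν : Measure β} {p : ℝ≥0∞} [Fact (1 ≤ p)]

lemma weakSeqCompact_lp_eu (h : WeakSeqCompact (Lp ℝ p μ)) (d : ℕ) :
    WeakSeqCompact (Lp (Eu d) p μ) := by
  refine (h.pi d).of_leftInverse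
    (ContinuousLinearMap.pi fun i => (EuclideanSpace.proj (𝕜 := ℝ) i).compLpL p μ)
    (∑ i, ((ContinuousLinearMap.toSpanSingleton ℝ (EuclideanSpace.single i (1 : ℝ))).compLpL p
      μ).comp (ContinuousLinearMap.proj i)) fun f => ?_
  ext1
  have h1 : ∀ i, ((ContinuousLinearMap.toSpanSingleton ℝ (EuclideanSpace.single i (1 : ℝ))).compLpL
      p μ ((EuclideanSpace.proj (𝕜 := ℝ) i : Eu d →L[ℝ] ℝ).compLpL p μ f)) =ᵐ[μ]
      fun x => EuclideanSpace.single i (f x i) := by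
    intro i
    filter_upwards [ContinuousLinearMap.coeFn_compLpL (p := p) (μ := μ)
      (ContinuousLinearMap.toSpanSingleton ℝ (EuclideanSpace.single i (1 : ℝ)))
      ((EuclideanSpace.proj (𝕜 := ℝ) i : Eu d →L[ℝ] ℝ).compLpL p μ f),
      ContinuousLinearMap.coeFn_compLpL (p := p) (μ := μ)
      (EuclideanSpace.proj (𝕜 := ℝ) i : Eu d →L[ℝ] ℝ) f] with x e1 e2
    rw [e1, e2]
    ext j
    by_cases hij : j = i <;> simp [hij]
  simp only [_root_.sum_apply, ContinuousLinearMap.comp_apply,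
    ContinuousLinearMap.proj_apply, ContinuousLinearMap.pi_apply]
  refine (Lp.coeFn_finsetSum _ _).trans ?_
  filter_upwards [ae_all_iff.2 h1] with x hx
  simp only [Finset.sum_apply, hx]
  ext j
  simp [Finset.sum_apply]

lemma weakSeqCompact_lp_prod {E F : Type*} [NormedAddCommGroup E] [NormedSpace ℝ E]
    [NormedAddCommGroup F] [NormedSpace ℝ F] (hE : WeakSeqCompact (Lp E p μ))
    (hF : WeakSeqCompact (Lp F p μ)) : WeakSeqCompact (Lp (E × F) p μ) := by
  refine (hE.prod hF).of_leftInverse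
    (((ContinuousLinearMap.fst ℝ E F).compLpL p μ).prod
      ((ContinuousLinearMap.snd ℝ E F).compLpL p μ))
    (((ContinuousLinearMap.inl ℝ E F).compLpL p μ).coprod
      ((ContinuousLinearMap.inr ℝ E F).compLpL p μ)) fun f => ?_
  ext1
  simp only [ContinuousLinearMap.prod_apply, ContinuousLinearMap.coprod_apply]
  refine (Lp.coeFn_add _ _).trans ?_
  filter_upwards [ContinuousLinearMap.coeFn_compLpL (p := p) (μ := μ)
      (ContinuousLinearMap.inl ℝ E F) ((ContinuousLinearMap.fst ℝ E F).compLpL p μ f),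
    ContinuousLinearMap.coeFn_compLpL (p := p) (μ := μ)
      (ContinuousLinearMap.inr ℝ E F) ((ContinuousLinearMap.snd ℝ E F).compLpL p μ f),
    ContinuousLinearMap.coeFn_compLpL (p := p) (μ := μ) (ContinuousLinearMap.fst ℝ E F) f,
    ContinuousLinearMap.coeFn_compLpL (p := p) (μ := μ) (ContinuousLinearMap.snd ℝ E F) f]
    with x e1 e2 e3 e4
  rw [Pi.add_apply, e1, e2, e3, e4]
  simp

lemma weakSeqCompact_lp_lp [IsFiniteMeasure μ] [IsFiniteMeasure ν]
    [MeasurableSpace.CountablyGenerated β] {E : Type*} [NormedAddCommGroup E] [NormedSpace ℝ E]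
    [SecondCountableTopology E] [CompleteSpace E] (hp : p ≠ ∞)
    (h : WeakSeqCompact (Lp E p (μ.prod ν))) : WeakSeqCompact (Lp (Lp E p ν) p μ) := by
  obtain ⟨K, -⟩ := exists_curry_equiv E μ ν hp
  exact h.of_leftInverse (K.symm : Lp (Lp E p ν) p μ →L[ℝ] Lp E p (μ.prod ν))
    (K : Lp E p (μ.prod ν) →L[ℝ] Lp (Lp E p ν) p μ) fun x => K.apply_symm_apply x

lemma weakSeqCompact_lp_submodule {E : Type*} [NormedAddCommGroup E] [NormedSpace ℝ E]
    (S : Submodule ℝ E) [CompleteSpace S] (h : WeakSeqCompact (Lp E p μ)) :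
    WeakSeqCompact (Lp S p μ) := by
  refine h.of_embedding (S.subtypeL.compLpL p μ) (c := 1) fun f => ?_
  rw [NNReal.coe_one, one_mul, Lp.norm_def, Lp.norm_def]
  refine (congrArg ENNReal.toReal (eLpNorm_congr_norm_ae ?_)).le
  filter_upwards [ContinuousLinearMap.coeFn_compLpL (p := p) (μ := μ) S.subtypeL f] with x hx
  rw [hx]
  rfl

/-- W^{1,p}(U) is a closed subspace of L^p × L^p, and currying turns the Bochner space of each
factor into an L^p space over a product, the vector-valued one being treated by coordinates. -/
theorem weakSeqCompact_lp_sobolev [IsFiniteMeasure μ] [MeasurableSpace.CountablyGenerated α]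
    {d : ℕ} {U : Set (Eu d)} [IsFiniteMeasure (volume.restrict U)] (hp1 : 1 < p) (hp : p ≠ ∞) :
    WeakSeqCompact (Lp (sobolev U p) p μ) :=
  weakSeqCompact_lp_submodule _ (weakSeqCompact_lp_prod
    (weakSeqCompact_lp_lp hp (weakSeqCompact_lp hp1 hp))
    (weakSeqCompact_lp_lp hp (weakSeqCompact_lp_eu (weakSeqCompact_lp hp1 hp) d)))

end WeakCompactnessBochner

/-! ### Multiplication by x-dependent matrices as a bounded operator. -/

section Multiplication

variable {α : Type*} {mα : MeasurableSpace α} {μ : Measure α} {p : ℝ≥0∞} [Fact (1 ≤ p)]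

/-- Multiplication by a bounded operator-valued function. -/
lemma exists_mul_clm {E F : Type*} [NormedAddCommGroup E] [NormedSpace ℝ E]
    [NormedAddCommGroup F] [NormedSpace ℝ F] {A : α → E →L[ℝ] F}
    (hA : AEStronglyMeasurable A μ) {c : ℝ} (hc : ∀ᵐ x ∂μ, ‖A x‖ ≤ c) :
    ∃ T : Lp E p μ →L[ℝ] Lp F p μ, ∀ f, T f =ᵐ[μ] fun x => A x (f x) := by
  have hAp : MemLp A ∞ μ := memLp_top_of_bound hA c hc
  refine ⟨(ContinuousLinearMap.id ℝ (E →L[ℝ] F)).holderL μ ∞ p p hAp.toLp, fun f => ?_⟩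
  filter_upwards [ContinuousLinearMap.coeFn_holder (r := p) (ContinuousLinearMap.id ℝ (E →L[ℝ] F))
    hAp.toLp f, hAp.coeFn_toLp] with x h1 h2
  rw [ContinuousLinearMap.holderL_apply_apply, h1, h2]
  rfl

variable {d : ℕ}

lemma continuous_toEuclideanCLM_transpose {A : Eu d → Matrix (Fin d) (Fin d) ℝ}
    (hA : IsLipMatrix A) : Continuous fun x =>
      (Matrix.toEuclideanLin (A x)ᵀ).toContinuousLinearMap := by
  obtain ⟨c, hc⟩ := hA
  have h1 : Continuous fun x => (A x)ᵀ :=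
    continuous_pi fun i => continuous_pi fun j => (hc j i).continuous
  exact (LinearMap.continuous_of_finiteDimensional
    ((LinearMap.toContinuousLinearMap (𝕜 := ℝ) (E := Eu d) (F' := Eu d)).toLinearMap ∘ₗ
      (Matrix.toEuclideanLin (𝕜 := ℝ) (m := Fin d) (n := Fin d)).toLinearMap)).comp h1

/-- The operator `u ↦ A(x) (P u(x))(y)`. -/
lemma exists_mul_curry_clm {β E F W : Type*} {mβ : MeasurableSpace β} {ν : Measure β}
    [IsFiniteMeasure μ] [IsFiniteMeasure ν] [MeasurableSpace.CountablyGenerated β]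
    [NormedAddCommGroup E] [NormedSpace ℝ E] [CompleteSpace E] [SecondCountableTopology E]
    [NormedAddCommGroup F] [NormedSpace ℝ F] [NormedAddCommGroup W] [NormedSpace ℝ W]
    (hp : p ≠ ∞) (P : W →L[ℝ] Lp E p ν) {A : α → E →L[ℝ] F} (hA : AEStronglyMeasurable A μ)
    {c : ℝ} (hc : ∀ᵐ x ∂μ, ‖A x‖ ≤ c) :
    ∃ T : Lp W p μ →L[ℝ] Lp F p (μ.prod ν),
      ∀ u, ∀ᵐ x ∂μ, ∀ᵐ y ∂ν, T u (x, y) = A x (P (u x) y) := by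
  obtain ⟨K, hK⟩ := exists_curry_equiv (p := p) E μ ν hp
  obtain ⟨T, hT⟩ := exists_mul_clm (p := p) (μ := μ.prod ν) (A := fun z => A z.1) (c := c)
    (hA.comp_fst) (Measure.quasiMeasurePreserving_fst.ae hc)
  refine ⟨T.comp ((K.symm : Lp (Lp E p ν) p μ →L[ℝ] _).comp (P.compLpL p μ)), fun u => ?_⟩
  filter_upwards [Measure.ae_ae_of_ae_prod (hT (K.symm (P.compLpL p μ u))),
    hK (K.symm (P.compLpL p μ u)), ContinuousLinearMap.coeFn_compLpL (p := p) (μ := μ) P u]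
    with x h1 h2 h3
  rw [K.apply_symm_apply, h3] at h2
  filter_upwards [h1, h2] with y h1 h2
  rw [h2]
  exact h1

/-- The weak gradient as a continuous linear map. -/
def gradL {U : Set (Eu d)} : sobolev U p →L[ℝ] Lp (Eu d) p (volume.restrict U) :=
  (ContinuousLinearMap.snd ℝ (Lp ℝ p (volume.restrict U)) (Lp (Eu d) p (volume.restrict U))).comp
    (sobolev U p).subtypeL

/-- The function `g` is `(x, y) ↦ A(x)ᵀ ∇_y u(x, y)`. -/
def IsMulGrad {Ω : Set (Eu d)} (A : Eu d → Matrix (Fin d) (Fin d) ℝ)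
    (u : Lp (sobolev (unitCell d) p) p (volume.restrict Ω))
    (g : Lp (Eu d) p ((volume.restrict Ω).prod (volume.restrict (unitCell d)))) : Prop :=
  ∀ᵐ x ∂volume.restrict Ω, ∀ᵐ y ∂volume.restrict (unitCell d),
    g (x, y) = act (A x)ᵀ (grad (u x) y)

/-- A Lipschitz matrix is bounded on the bounded set Ω. Applied to D⁻¹, this operator carries the
weak convergence of the unfolded functions over to the gradients. -/
lemma exists_mul_grad_clm {Ω : Set (Eu d)} [IsFiniteMeasure (volume.restrict Ω)]
    (hp : p ≠ ∞) (hΩ : Bornology.IsBounded Ω) (hΩm : MeasurableSet Ω)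
    {A : Eu d → Matrix (Fin d) (Fin d) ℝ} (hA : IsLipMatrix A) :
    ∃ T : Lp (sobolev (unitCell d) p) p (volume.restrict Ω) →L[ℝ]
        Lp (Eu d) p ((volume.restrict Ω).prod (volume.restrict (unitCell d))),
      ∀ u, IsMulGrad A u (T u) := by
  have hcb := hA.exists_bound hΩ
  obtain ⟨c, hc0, hc⟩ := hcb
  have hb : ∀ᵐ x ∂volume.restrict Ω,
      ‖(Matrix.toEuclideanLin (A x)ᵀ).toContinuousLinearMap‖ ≤ √d * (d * c) := by
    filter_upwards [ae_restrict_mem hΩm] with x hx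
    refine ContinuousLinearMap.opNorm_le_bound _ (by positivity) fun y => ?_
    exact norm_act_le hc0 (fun i j => hc _ hx j i) y
  have h := exists_mul_curry_clm (μ := volume.restrict Ω) (ν := volume.restrict (unitCell d))
    (E := Eu d) (F := Eu d) (W := sobolev (unitCell d) p) hp (gradL (p := p) (U := unitCell d))
    (continuous_toEuclideanCLM_transpose hA).aestronglyMeasurable hb
  exact h

end Multiplication

lemma norm_sub_le_of_ae_ae {α β E : Type*} {p : ℝ≥0∞} [MeasurableSpace α] [MeasurableSpace β]
    {μ : Measure α} {ν : Measure β} [SFinite ν] [NormedAddCommGroup E] {f g : Lp E p (μ.prod ν)}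
    {c : ℝ} (h : ∀ᵐ x ∂μ, ∀ᵐ y ∂ν, ‖g (x, y) - f (x, y)‖ ≤ c * ‖g (x, y)‖) :
    ‖g - f‖ ≤ c * ‖g‖ := by
  refine Lp.norm_le_mul_norm_of_ae_le_mul ?_
  have hms : MeasurableSet {z : α × β | ‖g z - f z‖ ≤ c * ‖g z‖} :=
    measurableSet_le ((Lp.stronglyMeasurable g).sub (Lp.stronglyMeasurable f)).norm.measurable
      ((Lp.stronglyMeasurable g).norm.measurable.const_mul c)
  filter_upwards [(Measure.ae_prod_iff_ae_ae hms).2 h, Lp.coeFn_sub g f] with z h1 h2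
  rw [h2]
  exact h1

/-! ### Passing from functions to elements of L^p. -/

section Representatives

variable {α E : Type*} {mα : MeasurableSpace α} {μ : Measure α} [NormedAddCommGroup E]
  {p : ℝ≥0∞}

lemma exists_lp_of_lintegral_le [Fact (1 ≤ p)] (hp : p ≠ ∞) {f : α → E} (hf : AEStronglyMeasurable f μ)
    {K : ℝ≥0∞} (hK : K ≠ ∞) (h : ∫⁻ x, ‖f x‖ₑ ^ p.toReal ∂μ ≤ K) :
    ∃ F : Lp E p μ, F =ᵐ[μ] f ∧ ‖F‖ ≤ (K ^ (1 / p.toReal)).toReal := by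
  have hp0 : p ≠ 0 := (zero_lt_one.trans_le (Fact.out : 1 ≤ p)).ne'
  have hle : eLpNorm f p μ ≤ K ^ (1 / p.toReal) := by
    rw [eLpNorm_eq_lintegral_rpow_enorm_toReal hp0 hp]
    exact ENNReal.rpow_le_rpow h (by positivity)
  have hfin : K ^ (1 / p.toReal) ≠ ∞ := ENNReal.rpow_ne_top_of_nonneg (by positivity) hK
  have hmem : MemLp f p μ := ⟨hf, hle.trans_lt hfin.lt_top⟩
  refine ⟨hmem.toLp, hmem.coeFn_toLp, ?_⟩
  rw [Lp.norm_toLp]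
  exact ENNReal.toReal_mono hfin hle

lemma exists_lp_submodule [NormedSpace ℝ E] (S : Submodule ℝ E) {u : Lp E p μ}
    (hu : ∀ᵐ x ∂μ, u x ∈ S) : ∃ W : Lp S p μ, ∀ᵐ x ∂μ, (W x : E) = u x := by
  classical
  obtain ⟨g, hg⟩ : ∃ g : α → S, ∀ x, u x ∈ S → (g x : E) = u x :=
    ⟨fun x => if h : u x ∈ S then ⟨u x, h⟩ else 0, fun x hx => by simp only [dif_pos hx]⟩
  have hgu : (fun x => (g x : E)) =ᵐ[μ] u := hu.mono hg
  have hgm : AEStronglyMeasurable g μ :=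
    Topology.IsEmbedding.subtypeVal.aestronglyMeasurable_comp_iff.1
      ((Lp.aestronglyMeasurable u).congr hgu.symm)
  have hmem : MemLp g p μ :=
    (Lp.memLp u).congr_norm hgm (hgu.mono fun x hx => by rw [← hx]; rfl)
  refine ⟨hmem.toLp, ?_⟩
  filter_upwards [hmem.coeFn_toLp, hgu] with x h1 h2
  rw [h1]
  exact h2

end Representatives

/-! ### Uniform bounds for the unfolded sequence, and comparison of the two gradients. -/

section UnfoldedSequence

variable {d N : ℕ} {L : Fin N → Eu d ≃L[ℝ] Eu d} {V : Fin N → Set (Eu d)} {Ω : Set (Eu d)}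
  {p : ℝ≥0∞} [Fact (1 ≤ p)]

lemma grad_unfSobolev_of_mem (hV : ∀ n, IsOpen (V n)) (hd : Pairwise (Function.onFun Disjoint V))
    (hΩ : ∀ n, V n ⊆ Ω) (w : sobolev Ω p) {x : Eu d} {n : Fin N} (hx : x ∈ hat (L n) (V n)) :
    grad (unfSobolev L V w x) =ᵐ[volume.restrict (unitCell d)]
      fun y => (L n : Eu d →L[ℝ] Eu d).adjoint (unf L V (grad w) x y) := by
  rw [unfSobolev_of_mem hV hd hΩ w hx]
  filter_upwards [grad_cellElt w (L n) (idx (L n) x) ((tile_idx_subset _ hx).trans (hΩ n))]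
    with y hy
  rw [hy, unf_of_mem hV hd _ hx]

/-- The unfolded gradient is close to the transformed gradient of the unfolding. -/
lemma ae_norm_unf_sub_le {A : Fin N → Matrix (Fin d) (Fin d) ℝ} (hA : ∀ n, IsUnit (A n)) {ε : ℝ}
    (hε : 0 < ε) (hV : ∀ n, IsOpen (V n)) (hd : Pairwise (Function.onFun Disjoint V))
    (hΩ : ∀ n, V n ⊆ Ω) (w : sobolev Ω p) {c δ : ℝ} (hc : 0 ≤ c) (hδ : 0 ≤ δ)
    (hAc : ∀ n i j, |A n i j| ≤ c) (B : Matrix (Fin d) (Fin d) ℝ) {x : Eu d}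
    (hB : ∀ n, x ∈ hat (scaleEquiv (hA n) hε) (V n) → ∀ i j, |(A n)⁻¹ i j - B i j| ≤ δ) :
    ∀ᵐ y ∂volume.restrict (unitCell d),
      ‖ε • unf (fun n => scaleEquiv (hA n) hε) V (grad w) x y -
        act Bᵀ (grad (unfSobolev (fun n => scaleEquiv (hA n) hε) V w x) y)‖ ≤
      √d * (d * δ) * (√d * (d * c)) *
        ‖ε • unf (fun n => scaleEquiv (hA n) hε) V (grad w) x y‖ := by
  by_cases hx : ∃ n, x ∈ hat (scaleEquiv (hA n) hε) (V n)
  · obtain ⟨n, hx⟩ := hx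
    filter_upwards [grad_unfSobolev_of_mem (L := fun n => scaleEquiv (hA n) hε) hV hd hΩ w hx]
      with y hy
    rw [hy, adjoint_scaleEquiv, ← act_smul]
    generalize ε • unf (fun n => scaleEquiv (hA n) hε) V (grad w) x y = G
    -- Writing G = A⁻ᵀ Aᵀ G exhibits the difference as (A⁻¹ - B)ᵀ Aᵀ G; the two factors of the
    -- constant are the matrix bounds for δ and for c.
    have h1 : G = act ((A n)⁻¹)ᵀ (act (A n)ᵀ G) := by
      rw [Matrix.transpose_nonsing_inv]
      refine (act_inv_act ?_ G).symm
      exact (Matrix.isUnit_transpose _).2 (hA n)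
    have h2 : G - act Bᵀ (act (A n)ᵀ G) = act ((A n)⁻¹ - B)ᵀ (act (A n)ᵀ G) := by
      rw [Matrix.transpose_sub, act_sub, ← h1]
    rw [h2, mul_assoc]
    refine (norm_act_le hδ (fun i j => hB n hx j i) _).trans ?_
    gcongr
    exact norm_act_le hc (fun i j => hAc n j i) G
  · push Not at hx
    have h0 : unfSobolev (fun n => scaleEquiv (hA n) hε) V w x = 0 := by
      rw [unfSobolev, sum_indicator_hat_of_notMem _ hx]
    rw [h0]
    have hz : (grad (0 : sobolev (unitCell d) p)) =ᵐ[volume.restrict (unitCell d)] 0 :=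
      Lp.coeFn_zero _ _ _
    filter_upwards [hz] with y hy
    rw [hy, unf, sum_indicator_hat_of_notMem _ hx]
    simp [act]

/-- The bound is free of ε: the factor M ε from the cell maps is absorbed by ε‖∇w‖ ≤ C. -/
lemma exists_lp_unfSobolev (hp : p ≠ ∞) (hV : ∀ n, IsOpen (V n))
    (hd : Pairwise (Function.onFun Disjoint V)) (hΩ : ∀ n, V n ⊆ Ω) (w : sobolev Ω p)
    {ε C M : ℝ} (hε : 0 < ε) (hM0 : 0 ≤ M) (hM : ∀ n, ‖(L n : Eu d →L[ℝ] Eu d)‖ ≤ M * ε)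
    (hw : ‖fn w‖ + ε * ‖grad w‖ ≤ C) :
    ∃ u : Lp (sobolev (unitCell d) p) p (volume.restrict Ω),
      u =ᵐ[volume.restrict Ω] unfSobolev L V w ∧
      ‖u‖ ≤ ((ENNReal.ofReal C ^ p.toReal + ENNReal.ofReal (M * C) ^ p.toReal) ^
        (1 / p.toReal)).toReal := by
  refine exists_lp_of_lintegral_le hp (stronglyMeasurable_unfSobolev w).aestronglyMeasurable
    (by finiteness) ?_
  refine (setLIntegral_le_lintegral _ _).trans ((lintegral_unfSobolev_le hp hV hd hΩ w hM).trans ?_)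
  have h1 : ‖fn w‖ₑ ≤ ENNReal.ofReal C := by
    rw [← ofReal_norm]
    refine ENNReal.ofReal_le_ofReal ?_
    have : 0 ≤ ε * ‖grad w‖ := by positivity
    linarith
  have h2 : ENNReal.ofReal (M * ε) * ‖grad w‖ₑ ≤ ENNReal.ofReal (M * C) := by
    rw [← ofReal_norm, ← ENNReal.ofReal_mul (by positivity), mul_assoc]
    refine ENNReal.ofReal_le_ofReal (mul_le_mul_of_nonneg_left ?_ hM0)
    have : 0 ≤ ‖fn w‖ := norm_nonneg _
    linarith
  rw [← ENNReal.mul_rpow_of_nonneg _ _ ENNReal.toReal_nonneg]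
  gcongr

lemma exists_lp_unf_grad (hp : p ≠ ∞) (hV : ∀ n, IsOpen (V n))
    (hd : Pairwise (Function.onFun Disjoint V)) (hΩ : ∀ n, V n ⊆ Ω) (w : sobolev Ω p)
    [IsFiniteMeasure (volume.restrict Ω)] {ε C : ℝ} (hε : 0 < ε)
    (hw : ‖fn w‖ + ε * ‖grad w‖ ≤ C) :
    ∃ g : Lp (Eu d) p ((volume.restrict Ω).prod (volume.restrict (unitCell d))),
      (g =ᵐ[(volume.restrict Ω).prod (volume.restrict (unitCell d))]
        fun z => ε • unf L V (grad w) z.1 z.2) ∧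
      ‖g‖ ≤ ((ENNReal.ofReal C ^ p.toReal) ^ (1 / p.toReal)).toReal := by
  have hp0 : p ≠ 0 := (zero_lt_one.trans_le (Fact.out : 1 ≤ p)).ne'
  have hm : StronglyMeasurable fun z : Eu d × Eu d => unf L V (grad w) z.1 z.2 :=
    stronglyMeasurable_unf (Lp.stronglyMeasurable (grad w))
  refine exists_lp_of_lintegral_le hp (hm.const_smul ε).aestronglyMeasurable (by finiteness) ?_
  have he : ∀ z : Eu d × Eu d, ‖ε • unf L V (grad w) z.1 z.2‖ₑ ^ p.toReal =
      ‖ε‖ₑ ^ p.toReal * ‖unf L V (grad w) z.1 z.2‖ₑ ^ p.toReal := fun z => by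
    rw [enorm_smul, ENNReal.mul_rpow_of_nonneg _ _ ENNReal.toReal_nonneg]
  refine (lintegral_congr he).trans_le ?_
  rw [lintegral_const_mul _ (hm.enorm.pow_const _),
    lintegral_prod _ (hm.enorm.pow_const _).aemeasurable]
  have h1 := (setLIntegral_le_lintegral Ω _).trans (lintegral_unf_le (L := L) hp hV hd hΩ (grad w))
  rw [← eLpNorm_rpow_toReal hp0 hp, ← Lp.enorm_def] at h1
  refine (mul_le_mul_right h1 _).trans ?_
  rw [← ENNReal.mul_rpow_of_nonneg _ _ ENNReal.toReal_nonneg]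
  refine ENNReal.rpow_le_rpow ?_ ENNReal.toReal_nonneg
  rw [← ofReal_norm, ← ofReal_norm, ← ENNReal.ofReal_mul (norm_nonneg _), Real.norm_eq_abs,
    abs_of_pos hε]
  refine ENNReal.ofReal_le_ofReal ?_
  have : 0 ≤ ‖fn w‖ := norm_nonneg _
  linarith

end UnfoldedSequence

/-! ### Translation of the given microstructure into lattices and hats. -/

section LocallyPeriodic

variable {d : ℕ} {Ω : Set (Eu d)} {s : ℝ}

lemma IsMulGrad.ae_ae_eq {p : ℝ≥0∞} [Fact (1 ≤ p)] {A : Eu d → Matrix (Fin d) (Fin d) ℝ}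
    {u : Lp (sobolev (unitCell d) p) p (volume.restrict Ω)}
    {g : Lp (Eu d) p ((volume.restrict Ω).prod (volume.restrict (unitCell d)))}
    (h : IsMulGrad A u g) {f : Eu d → sobolev (unitCell d) p} (hf : u =ᵐ[volume.restrict Ω] f) :
    ∀ᵐ x ∂volume.restrict Ω, ∀ᵐ y ∂volume.restrict (unitCell d),
      g (x, y) = act (A x)ᵀ (grad (f x) y) := by
  filter_upwards [h, hf] with x h1 h2
  filter_upwards [h1] with y h1
  exact h1.trans (congrArg (fun v => act (A x)ᵀ (grad v y)) h2)

lemma unfolding_eq_unf {F : Type*} [AddCommMonoid F] {D : Eu d → Matrix (Fin d) (Fin d) ℝ}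
    (hD : ∀ x, IsUnit (D x)) {ε : ℝ} (hε : 0 < ε) (𝒞 : CubeCovering Ω s) (ψ : Eu d → F)
    (x y : Eu d) : unfolding D ε 𝒞 ψ x y =
      unf (fun n => scaleEquiv (hD (𝒞.pt n)) hε) (fun n => 𝒞.cube n ∩ Ω) ψ x y := by
  refine Finset.sum_congr rfl fun n _ => ?_
  have h1 : hatCube D ε 𝒞 n = hat (scaleEquiv (hD (𝒞.pt n)) hε) (𝒞.cube n ∩ Ω) := rfl
  have h2 : ∀ x, ε • act (D (𝒞.pt n)) (intPart (ε⁻¹ • act (D (𝒞.pt n))⁻¹ x))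
      + ε • act (D (𝒞.pt n)) y =
      tile (scaleEquiv (hD (𝒞.pt n)) hε) (idx (scaleEquiv (hD (𝒞.pt n)) hε) x) y := by
    intro x
    rw [tile, map_add, add_comm]
    rfl
  simp only [h1, h2]

/-- Both x and the chosen point lie in the closure of one cube, whose diameter is at most √d s. -/
lemma CubeCovering.abs_sub_le (𝒞 : CubeCovering Ω s) (hs : 0 ≤ s)
    {A : Eu d → Matrix (Fin d) (Fin d) ℝ} {Λ : ℝ≥0}
    (hA : ∀ i j, LipschitzWith Λ fun x => A x i j) (L : Eu d ≃L[ℝ] Eu d) {n : Fin 𝒞.N} {x : Eu d}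
    (hx : x ∈ hat L (𝒞.cube n ∩ Ω)) (i j : Fin d) :
    |A (𝒞.pt n) i j - A x i j| ≤ Λ * (√d * s) := by
  rw [← Real.dist_eq]
  refine ((hA i j).dist_le_mul _ _).trans (mul_le_mul_of_nonneg_left ?_ Λ.2)
  exact (𝒞.isCube n).dist_le hs (subset_closure (𝒞.pt_mem n).1)
    (closure_mono inter_subset_left (hat_subset_closure L _ hx))

end LocallyPeriodic

end

end LocPer

/-! ### The theorem. -/

theorem mainTheorem1 {d : ℕ} (hd : 1 ≤ d) (Ω : Set (Eu d)) (hΩ : IsBoundedLipschitzDomain Ω)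
    (D : Eu d → Matrix (Fin d) (Fin d) ℝ) (hDinv : ∀ x, IsUnit (D x))
    (hD : IsLipMatrix D) (hD' : IsLipMatrix fun x => (D x)⁻¹)
    (D₁ D₂ : ℝ) (hD₁ : 0 < D₁) (hdet : ∀ x ∈ closure Ω, D₁ ≤ |(D x).det| ∧ |(D x).det| ≤ D₂)
    (r : ℝ) (hr0 : 0 < r) (hr1 : r < 1)
    (p : ℝ≥0∞) [Fact (1 ≤ p)] (hp : 1 < p) (hp' : p ≠ ⊤)
    -- the sequence of scales, and for each of them a covering of the domain by cubes
    (ε : ℕ → ℝ) (hε : ∀ k, 0 < ε k) (hε0 : Tendsto ε atTop (𝓝 0))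
    (𝒞 : ∀ k, CubeCovering Ω (ε k ^ r))
    (w : ℕ → sobolev Ω p) (C : ℝ) (hw : ∀ k, ‖fn (w k)‖ + ε k * ‖grad (w k)‖ ≤ C) :
    ∃ (φ : ℕ → ℕ) (w₀ : Eu d → Eu d → ℝ), StrictMono φ ∧ MemLpSobolevPer Ω D p w₀ ∧
      -- the unfolded functions and `w₀(x, D_x y)`, as elements of `L^p(Ω; W^{1,p}(Y))`
      ∃ (u : ℕ → Lp (sobolev (unitCell d) p) p (volume.restrict Ω))
        (u₀ : Lp (sobolev (unitCell d) p) p (volume.restrict Ω)),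
        (∀ k, IsRep (u k) (unfolding D (ε k) (𝒞 k) (fn (w k)))) ∧
        IsRep u₀ (fun x y => w₀ x (act (D x) y)) ∧
        WeakTendsto (fun k => u (φ k)) u₀ ∧
        -- the unfolded gradients and `D_x^{-T} ∇_y [w₀(x, D_x y)]`, as elements of `L^p(Ω × Y)`
        ∃ (g : ℕ → Lp (Eu d) p ((volume.restrict Ω).prod (volume.restrict (unitCell d))))
          (g₀ : Lp (Eu d) p ((volume.restrict Ω).prod (volume.restrict (unitCell d)))),
          (∀ k, g k =ᵐ[(volume.restrict Ω).prod (volume.restrict (unitCell d))]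
            fun z => ε k • unfolding D (ε k) (𝒞 k) (grad (w k)) z.1 z.2) ∧
          (∀ᵐ x ∂volume.restrict Ω, ∀ᵐ y ∂volume.restrict (unitCell d),
            g₀ (x, y) = act ((D x)⁻¹)ᵀ (grad (u₀ x) y)) ∧
          WeakTendsto (fun k => g (φ k)) g₀ := by
  have hΩo := hΩ.isOpen
  have hΩb := hΩ.bounded
  have hfin : IsFiniteMeasure (volume.restrict Ω) := ⟨by
    rw [Measure.restrict_apply_univ]
    exact hΩb.measure_lt_top⟩
  have hDb := hD.exists_bound hΩb
  obtain ⟨c, hc0, hc⟩ := hDb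
  have hD'' := hD'
  obtain ⟨Λ, hΛ⟩ := hD''
  -- The summand 1 keeps M positive even if c = 0.
  have hMe : ∃ M : ℝ, M = √d * (d * c) + 1 := ⟨_, rfl⟩
  obtain ⟨M, hM⟩ := hMe
  have hM0 : 0 < M := by rw [hM]; positivity
  have hLe : ∃ L : ∀ k, Fin (𝒞 k).N → Eu d ≃L[ℝ] Eu d,
      ∀ k, L k = fun n => scaleEquiv (hDinv ((𝒞 k).pt n)) (hε k) := ⟨_, fun _ => rfl⟩
  obtain ⟨L, hL⟩ := hLe
  have hVe : ∃ V : ∀ k, Fin (𝒞 k).N → Set (Eu d),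
      ∀ k, V k = fun n => (𝒞 k).cube n ∩ Ω := ⟨_, fun _ => rfl⟩
  obtain ⟨V, hVdef⟩ := hVe
  have hptc : ∀ k n i j, |D ((𝒞 k).pt n) i j| ≤ c := fun k n => hc _ ((𝒞 k).pt_mem n).2
  have hVo : ∀ k n, IsOpen (V k n) := fun k n => by
    rw [hVdef]
    exact ((𝒞 k).isCube n).isOpen.inter hΩo
  have hVd : ∀ k, Pairwise (Function.onFun Disjoint (V k)) := fun k m n hmn => by
    rw [hVdef]
    exact ((𝒞 k).disj hmn).mono inter_subset_left inter_subset_left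
  have hVΩ : ∀ k n, V k n ⊆ Ω := fun k n => by
    rw [hVdef]
    exact inter_subset_right
  have hLM : ∀ k n, ‖(L k n : Eu d →L[ℝ] Eu d)‖ ≤ M * ε k := fun k n => by
    rw [hL]
    refine (norm_scaleEquiv_le (hDinv _) (hε k) hc0 (hptc k n)).trans ?_
    exact mul_le_mul_of_nonneg_right (by linarith) (hε k).le
  have hunf : ∀ {F : Type} [AddCommMonoid F] (k) (ψ : Eu d → F) x y,
      unfolding D (ε k) (𝒞 k) ψ x y = unf (L k) (V k) ψ x y := fun k ψ x y => by
    rw [hL, hVdef, unfolding_eq_unf hDinv (hε k)]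
  have hue := fun k => exists_lp_unfSobolev (L := L k) (V := V k) hp' (hVo k) (hVd k)
    (hVΩ k) (w k) (hε k) hM0.le (hLM k) (hw k)
  have hge := fun k => exists_lp_unf_grad (L := L k) (V := V k) hp' (hVo k) (hVd k)
    (hVΩ k) (w k) (hε k) (hw k)
  choose u hu hub using hue
  choose g hg hgb using hge
  have hcpt := weakSeqCompact_lp_sobolev (μ := volume.restrict Ω) (U := unitCell d) hp hp' u _ hub
  obtain ⟨φ, u₀, hφ, hu₀⟩ := hcpt
  have hper : ∀ᵐ x ∂volume.restrict Ω, u₀ x ∈ sobolevPer d p := by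
    refine ae_mem_sobolevPer_of_weakTendsto (L := fun k => L (φ k)) (V := fun k => V (φ k)) hΩo hp
      hp' (fun k => hVo _) (fun k => hVd _) (fun k => hVΩ _) (fun k => w (φ k))
      (m := fun k => M * ε (φ k)) (fun k => mul_pos hM0 (hε _)) ?_ (fun k => hLM _) ?_
      (fun k => hu (φ k)) (fun k => hub (φ k)) hu₀
    · simpa using (hε0.comp hφ.tendsto_atTop).const_mul M
    · intro K Q hQ hQΩ
      simp only [hVdef]
      exact (tendsto_volume_layer hΩb hΩo hr0 hr1 hε hε0 𝒞 M K hQ hQΩ).comp hφ.tendsto_atTop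
  have hve : ∃ v : Eu d → Eu d → ℝ, (∀ x y ξ, v x (y + latt ξ) = v x y) ∧
      ∀ᵐ x ∂volume.restrict Ω, v x =ᵐ[volume.restrict (unitCell d)] fn (u₀ x) := by
    -- A periodic representative is chosen for every x, with the default 0 on the exceptional null
    -- set, so that periodicity holds for all x.
    have : ∀ x, ∃ v : Eu d → ℝ, (∀ y ξ, v (y + latt ξ) = v y) ∧
        (u₀ x ∈ sobolevPer d p → v =ᵐ[volume.restrict (unitCell d)] fn (u₀ x)) := by
      intro x
      by_cases hx : u₀ x ∈ sobolevPer d p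
      · have hx' := hx
        obtain ⟨v, -, hv, -, h1, -⟩ := hx'
        exact ⟨v, hv, fun _ => h1⟩
      · exact ⟨fun _ => 0, fun _ _ => rfl, fun h => absurd h hx⟩
    choose v hv hvu using this
    exact ⟨v, hv, hper.mono hvu⟩
  obtain ⟨v, hv, hvu⟩ := hve
  have hW := exists_lp_submodule _ hper
  obtain ⟨W, hW⟩ := hW
  have hT := exists_mul_grad_clm hp' hΩb hΩo.measurableSet hD'
  obtain ⟨T, hT⟩ := hT
  -- With w₀(x, z) = v(x, D_x⁻¹ z), the ℤᵈ-periodicity of v becomes D_xℤᵈ-periodicity, and w₀(x, D_x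
  -- y) = v(x, y).
  refine ⟨φ, fun x z => v x (act (D x)⁻¹ z), hφ, ⟨?_, W, ?_⟩, u, u₀, ?_, ?_, hu₀, g, T u₀, ?_,
    hT u₀, ?_⟩
  · refine Eventually.of_forall fun x y ξ => ?_
    have h : act (D x)⁻¹ (y + act (D x) (latt ξ)) = act (D x)⁻¹ y + latt ξ := by
      conv_rhs => rw [← act_inv_act (hDinv x) (latt ξ)]
      exact map_add _ _ _
    simp only [h, hv]
  · filter_upwards [hvu, hW] with x h1 h2
    rw [h2]
    simp only [act_inv_act (hDinv x)]
    exact h1.symm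
  · intro k
    filter_upwards [hu k] with x hx
    rw [hx]
    filter_upwards [fn_unfSobolev (L := L k) (hVo k) (hVd k) (hVΩ k) (w k) x] with y hy
    rw [hy, hunf]
  · filter_upwards [hvu] with x h1
    simp only [act_inv_act (hDinv x)]
    exact h1.symm
  · intro k
    filter_upwards [hg k] with z hz
    rw [hz, hunf]
  -- T u tends weakly to T u₀, and the unfolded gradients differ from T u by O(ε^r) in norm.
  · refine (hu₀.map T).congr_of_norm_sub_tendsto ?_
    have hs : Tendsto (fun k => ε k ^ r) atTop (𝓝 0) := by
      have := hε0.rpow_const (p := r) (Or.inr hr0.le)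
      rwa [Real.zero_rpow hr0.ne'] at this
    have hlim : Tendsto (fun k => √d * (d * (Λ * (√d * ε (φ k) ^ r))) * (√d * (d * c)) *
        ((ENNReal.ofReal C ^ p.toReal) ^ (1 / p.toReal)).toReal) atTop (𝓝 0) := by
      have h := (((((hs.comp hφ.tendsto_atTop).const_mul (√d)).const_mul (Λ : ℝ)).const_mul
        (d : ℝ)).const_mul (√d)).mul_const (√d * (d * c)) |>.mul_const
        ((ENNReal.ofReal C ^ p.toReal) ^ (1 / p.toReal)).toReal
      simpa using h
    refine squeeze_zero (fun _ => norm_nonneg _) (fun k => ?_) hlim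
    have hs0 : 0 ≤ ε (φ k) ^ r := (Real.rpow_pos_of_pos (hε _) r).le
    refine (norm_sub_le_of_ae_ae (c := √d * (d * (Λ * (√d * ε (φ k) ^ r))) * (√d * (d * c)))
      ?_).trans (mul_le_mul_of_nonneg_left (hgb _) (by positivity))
    filter_upwards [(hT (u (φ k))).ae_ae_eq (hu (φ k)), Measure.ae_ae_of_ae_prod (hg (φ k))]
      with x h2 h3
    -- δ is the oscillation of the Lipschitz matrix D⁻¹ over a cube of diameter √d ε^r.
    have h4 := ae_norm_unf_sub_le (V := V (φ k)) (fun n => hDinv ((𝒞 (φ k)).pt n)) (hε (φ k))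
      (hVo _) (hVd _) (hVΩ _) (w (φ k)) hc0 (δ := Λ * (√d * ε (φ k) ^ r)) (by positivity)
      (hptc (φ k)) (D x)⁻¹ (x := x) (fun n hx => by
        rw [hVdef] at hx
        exact (𝒞 (φ k)).abs_sub_le hs0 hΛ _ hx)
    rw [← hL (φ k)] at h4
    filter_upwards [h2, h3, h4] with y h2 h3 h4
    rw [h2, h3]
    exact h4
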